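/- **Theorem 2.** Consider the rank-constrained optimization problem over the cone $\mathcal{K}=S^n_+$ of $n\times n$ positive semidefinite real matrices $$\min_{X\in S^n_+}\ \langle C,X\rangle+\lambda\cdot\mathrm{Rank}(X)\quad\text{s.t.}\quad \langle A_i,X\rangle=b_i\ (i=1,\dots,\ell),\qquad \mathrm{Rank}(X)\le k,$$ where $\langle\cdot,\cdot\rangle$ is the Euclidean inner product of matrices, and its decision version: given $n,\ell,k\in\mathbb{N}$, rational matrices $C,A_1,\dots,A_\ell\in\mathbb{Q}^{n\times n}$ and rational numbers $b_1,\dots,b_\ell,\lambda,t$ (written in binary, matrices as dense lists of entries), decide whether there is a feasible $X$ with objective value $\langle C,X\rangle+\lambda\cdot\mathrm{Rank}(X)\le t$. This problem belongs to the complexity class $\exists\mathbb{R}$, and it is $\exists\mathbb{R}$-complete. Here $\exists\mathbb{R}$ is the class of decision problems that reduce, by a polynomial-time many-one reduction, to deciding whether a sentence $(\exists x_1,\dots,x_N)\,\varphi(x_1,\dots,x_N)$ is true over the real numbers, where $\varphi$ is a quantifier-free Boolean formula in equalities and inequalities between polynomials with integer coefficients (written as arithmetic terms over $0,1,-,+,\cdot$);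 a problem is $\exists\mathbb{R}$-hard if every problem in $\exists\mathbb{R}$ reduces to it by a polynomial-time many-one reduction, and $\exists\mathbb{R}$-complete if it is in $\exists\mathbb{R}$ and $\exists\mathbb{R}$-hard. -/

import Mathlib

/-! ### Decision problems, polynomial-time reductions -/

/-- A decision problem: a type of instances, an injective encoding of the instances as words over
a finite alphabet, and the set of yes-instances. -/
structure DecisionProblem where
  /-- the instances -/
  Inst : Type
  /-- the alphabet in which instances are written -/
  Letter : Type
  finite_letter : Finite Letter
  /-- the word that is given to a machine as its input -/
  encode : Inst → List Letter
  encode_injective : Function.Injective encode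
  /-- the yes-instances -/
  Yes : Inst → Prop

/-- Polynomial-time many-one (Karp) reducibility, with Mathlib's Turing machines: a function that
maps instances to instances, is computed by a Turing machine within a number of steps bounded by a
polynomial in the length of the encoded input, and preserves the answer. -/
def PolyTimeReducible (P Q : DecisionProblem) : Prop :=
  ∃ f : P.Inst → Q.Inst,
    Nonempty (Turing.TM2ComputableInPolyTime P.encode Q.encode f) ∧
    ∀ x, P.Yes x ↔ Q.Yes (f x)

/-- Encodings none of whose values is a proper prefix of another one. -/
def PrefixInjective {α Γ : Type} (e : α → List Γ) : Prop :=
  ∀ a b u v, e a ++ u = e b ++ v → a = b ∧ u = v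

/-! ### The existential theory of the reals -/

/-- Arithmetic terms over the signature `0, 1, -, +, *` with variables `x₀, x₁, …`; they denote the
polynomials with integer coefficients. -/
inductive PolyTerm where
  | var (i : ℕ)
  | zero
  | one
  | neg (s : PolyTerm)
  | add (s t : PolyTerm)
  | mul (s t : PolyTerm)

/-- Quantifier-free Boolean formulas in polynomial equalities and inequalities. -/
inductive PolyFormula where
  | eq (s t : PolyTerm)
  | lt (s t : PolyTerm)
  | le (s t : PolyTerm)
  | not (φ : PolyFormula)
  | and (φ ψ : PolyFormula)
  | or (φ ψ : PolyFormula)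

/-- The value of a term at a real point. -/
def PolyTerm.eval (x : ℕ → ℝ) : PolyTerm → ℝ
  | .var i => x i
  | .zero => 0
  | .one => 1
  | .neg s => -s.eval x
  | .add s t => s.eval x + t.eval x
  | .mul s t => s.eval x * t.eval x

/-- Truth of a formula at a real point. -/
def PolyFormula.Holds (x : ℕ → ℝ) : PolyFormula → Prop
  | .eq s t => s.eval x = t.eval x
  | .lt s t => s.eval x < t.eval x
  | .le s t => s.eval x ≤ t.eval x
  | .not φ => ¬ φ.Holds x
  | .and φ ψ => φ.Holds x ∧ ψ.Holds x
  | .or φ ψ => φ.Holds x ∨ ψ.Holds x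

/-- The letters with which formulas are written. -/
inductive FormulaLetter where
  | stroke | x | zero | one | neg | add | mul | eq | lt | le | not | and | or
  deriving DecidableEq

instance : Fintype FormulaLetter :=
  ⟨{.stroke, .x, .zero, .one, .neg, .add, .mul, .eq, .lt, .le, .not, .and, .or}, by
    rintro ⟨⟩ <;> decide⟩

/-- Prefix (Polish) notation of a term; the variable `xᵢ` is written as `i` strokes followed by the
letter `x`. -/
def PolyTerm.encode : PolyTerm → List FormulaLetter
  | .var i => List.replicate i .stroke ++ [.x]
  | .zero => [.zero]
  | .one => [.one]
  | .neg s => .neg :: s.encode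
  | .add s t => .add :: (s.encode ++ t.encode)
  | .mul s t => .mul :: (s.encode ++ t.encode)

/-- Prefix (Polish) notation of a formula. -/
def PolyFormula.encode : PolyFormula → List FormulaLetter
  | .eq s t => .eq :: (s.encode ++ t.encode)
  | .lt s t => .lt :: (s.encode ++ t.encode)
  | .le s t => .le :: (s.encode ++ t.encode)
  | .not φ => .not :: φ.encode
  | .and φ ψ => .and :: (φ.encode ++ ψ.encode)
  | .or φ ψ => .or :: (φ.encode ++ ψ.encode)

theorem prefixInjective_replicate {Γ : Type} {a b : Γ} (h : a ≠ b) :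
    PrefixInjective (fun i : ℕ => List.replicate i a ++ [b]) := by
  intro i
  induction i with
  | zero =>
    intro j u v huv
    cases j with
    | zero => simpa using huv
    | succ j => simp [List.replicate_succ, h.symm] at huv
  | succ i ih =>
    intro j u v huv
    cases j with
    | zero => simp [List.replicate_succ, h] at huv
    | succ j =>
      have := ih j u v (by simpa [List.replicate_succ] using huv)
      exact ⟨by rw [this.1], this.2⟩

theorem PolyTerm.prefixInjective_encode : PrefixInjective PolyTerm.encode := by
  intro s
  induction s with
  | var i =>
    intro t u v h
    cases t with
    | var j =>
      have := prefixInjective_replicate (a := FormulaLetter.stroke) (b := .x) (by decide) i j u v h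
      exact ⟨by rw [this.1], this.2⟩
    | _ => cases i <;> simp [PolyTerm.encode, List.replicate_succ] at h
  | zero =>
    intro t u v h
    cases t with
    | var j => cases j <;> simp [PolyTerm.encode, List.replicate_succ] at h
    | _ => simp_all [PolyTerm.encode]
  | one =>
    intro t u v h
    cases t with
    | var j => cases j <;> simp [PolyTerm.encode, List.replicate_succ] at h
    | _ => simp_all [PolyTerm.encode]
  | neg s ih =>
    intro t u v h
    cases t with
    | var j => cases j <;> simp [PolyTerm.encode, List.replicate_succ] at h
    | neg t =>
      have := ih t u v (by simpa [PolyTerm.encode] using h)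
      exact ⟨by rw [this.1], this.2⟩
    | _ => simp [PolyTerm.encode] at h
  | add s₁ s₂ ih₁ ih₂ =>
    intro t u v h
    cases t with
    | var j => cases j <;> simp [PolyTerm.encode, List.replicate_succ] at h
    | add t₁ t₂ =>
      have h₁ := ih₁ t₁ _ _ (by simpa [PolyTerm.encode] using h)
      have h₂ := ih₂ t₂ u v h₁.2
      exact ⟨by rw [h₁.1, h₂.1], h₂.2⟩
    | _ => simp [PolyTerm.encode] at h
  | mul s₁ s₂ ih₁ ih₂ =>
    intro t u v h
    cases t with
    | var j => cases j <;> simp [PolyTerm.encode, List.replicate_succ] at h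
    | mul t₁ t₂ =>
      have h₁ := ih₁ t₁ _ _ (by simpa [PolyTerm.encode] using h)
      have h₂ := ih₂ t₂ u v h₁.2
      exact ⟨by rw [h₁.1, h₂.1], h₂.2⟩
    | _ => simp [PolyTerm.encode] at h

theorem PolyFormula.prefixInjective_encode : PrefixInjective PolyFormula.encode := by
  have key := PolyTerm.prefixInjective_encode
  intro φ
  induction φ with
  | eq s₁ s₂ | lt s₁ s₂ | le s₁ s₂ =>
    intro ψ u v h
    cases ψ <;> simp only [PolyFormula.encode, List.cons_append, List.append_assoc,
      List.cons.injEq, reduceCtorEq, false_and, true_and] at h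
    obtain ⟨rfl, h₁⟩ := key _ _ _ _ h
    obtain ⟨rfl, h₂⟩ := key _ _ _ _ h₁
    exact ⟨rfl, h₂⟩
  | not φ ih =>
    intro ψ u v h
    cases ψ <;> simp only [PolyFormula.encode, List.cons_append, List.append_assoc,
      List.cons.injEq, reduceCtorEq, false_and, true_and] at h
    obtain ⟨rfl, h₁⟩ := ih _ _ _ h
    exact ⟨rfl, h₁⟩
  | and φ₁ φ₂ ih₁ ih₂ | or φ₁ φ₂ ih₁ ih₂ =>
    intro ψ u v h
    cases ψ <;> simp only [PolyFormula.encode, List.cons_append, List.append_assoc,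
      List.cons.injEq, reduceCtorEq, false_and, true_and] at h
    obtain ⟨rfl, h₁⟩ := ih₁ _ _ _ h
    obtain ⟨rfl, h₂⟩ := ih₂ _ _ _ h₁
    exact ⟨rfl, h₂⟩

/-- The problem ETR: is the sentence `(∃ x₁, …, xₙ) φ(x₁, …, xₙ)` true over the reals, for a given
quantifier-free formula `φ`? All variables that occur in `φ` are quantified existentially. -/
def etr : DecisionProblem where
  Inst := PolyFormula
  Letter := FormulaLetter
  finite_letter := inferInstance
  encode := PolyFormula.encode
  encode_injective φ ψ h :=
    (PolyFormula.prefixInjective_encode φ ψ [] [] (by rw [h])).1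
  Yes φ := ∃ x : ℕ → ℝ, φ.Holds x

/-- Membership in the complexity class `∃ℝ`: polynomial-time reducibility to ETR. -/
def InExistsR (P : DecisionProblem) : Prop :=
  PolyTimeReducible P etr

/-- `∃ℝ`-hardness: every problem in `∃ℝ` reduces to `P` in polynomial time. -/
def ExistsRHard (P : DecisionProblem) : Prop :=
  ∀ Q : DecisionProblem, InExistsR Q → PolyTimeReducible Q P

/-- `∃ℝ`-completeness. -/
def ExistsRComplete (P : DecisionProblem) : Prop :=
  InExistsR P ∧ ExistsRHard P

/-! ### Rank-constrained semidefinite optimization -/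

/-- The Euclidean inner product of a rational and a real matrix. -/
def matrixInner {n : ℕ} (C : Matrix (Fin n) (Fin n) ℚ) (X : Matrix (Fin n) (Fin n) ℝ) : ℝ :=
  ∑ i, ∑ j, (C i j : ℝ) * X i j

/-- Rational data of the decision version of
`min ⟨C, X⟩ + lam * Rank X  s.t.  ⟨A i, X⟩ = b i (i < l),  Rank X ≤ k,  X ∈ S^n_+`:
is there a feasible `X` whose objective value is at most `t`? -/
structure LowRankInstance where
  n : ℕ
  l : ℕ
  k : ℕ
  lam : ℚ
  t : ℚ
  C : Matrix (Fin n) (Fin n) ℚ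
  A : Fin l → Matrix (Fin n) (Fin n) ℚ
  b : Fin l → ℚ

/-- The feasible set. -/
def LowRankInstance.Feasible (p : LowRankInstance) (X : Matrix (Fin p.n) (Fin p.n) ℝ) : Prop :=
  (∀ i, matrixInner (p.A i) X = (p.b i : ℝ)) ∧ X.rank ≤ p.k ∧ X.PosSemidef

/-- The objective function. -/
noncomputable def LowRankInstance.objective (p : LowRankInstance)
    (X : Matrix (Fin p.n) (Fin p.n) ℝ) : ℝ :=
  matrixInner p.C X + (p.lam : ℝ) * (X.rank : ℝ)

/-- The letters with which the instances are written. -/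
inductive DataLetter where
  | stroke | bit0 | bit1 | minus | sep
  deriving DecidableEq

instance : Fintype DataLetter :=
  ⟨{.stroke, .bit0, .bit1, .minus, .sep}, by rintro ⟨⟩ <;> decide⟩

/-- Unary notation. -/
def encodeUnary (m : ℕ) : List DataLetter :=
  List.replicate m .stroke ++ [.sep]

/-- Binary notation, least significant bit first. -/
def encodeNat (m : ℕ) : List DataLetter :=
  m.bits.map (fun b => if b then .bit1 else .bit0) ++ [.sep]

/-- Binary notation with a sign. -/
def encodeInt (z : ℤ) : List DataLetter :=
  if z < 0 then .minus :: encodeNat z.natAbs else encodeNat z.natAbs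

/-- Numerator and denominator in binary. -/
def encodeRat (q : ℚ) : List DataLetter :=
  encodeInt q.num ++ encodeNat q.den

/-- The entries of a vector, one after the other. -/
def encodeVec {α : Type} (e : α → List DataLetter) {n : ℕ} (v : Fin n → α) : List DataLetter :=
  (List.ofFn v).flatMap e

/-- The entries of a matrix, row by row. -/
def encodeMatrix {n : ℕ} (M : Matrix (Fin n) (Fin n) ℚ) : List DataLetter :=
  encodeVec (encodeVec encodeRat) M

/-- The dimensions `n` and `l` (in unary: they are at most the number of entries that follow), the
rank bound (in binary), and all rational data (in binary, dense matrices). -/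
def LowRankInstance.encode (p : LowRankInstance) : List DataLetter :=
  encodeUnary p.n ++ encodeUnary p.l ++
    encodeNat p.k ++ encodeRat p.lam ++ encodeRat p.t ++
    encodeMatrix p.C ++ encodeVec encodeMatrix p.A ++ encodeVec encodeRat p.b

theorem bits_injective : Function.Injective Nat.bits := by
  intro a
  induction a using Nat.strong_induction_on with
  | _ a ih =>
    intro b h
    have hb := Nat.bodd_eq_bits_head
    have hd := Nat.div2_bits_eq_tail
    rcases Nat.eq_zero_or_pos a with rfl | ha
    · rcases Nat.eq_zero_or_pos b with rfl | hb'
      · rfl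
      · exfalso
        have := Nat.bit_bodd_div2 b
        rw [← this, Nat.bits_append_bit _ _ (by
          intro h0
          rw [h0] at this
          cases hbb : b.bodd
          · rw [hbb] at this; simp at this; omega
          · rfl)] at h
        simp at h
    · have h₁ : a.bodd = b.bodd := by rw [hb, hb, h]
      have h₂ : a.div2.bits = b.div2.bits := by rw [hd, hd, h]
      have h₃ := ih a.div2 (by rw [Nat.div2_val]; omega) h₂
      rw [← Nat.bit_bodd_div2 a, ← Nat.bit_bodd_div2 b, h₁, h₃]

theorem prefixInjective_encodeNat : PrefixInjective encodeNat := by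
  have key : ∀ (a b : List Bool) (u v : List DataLetter),
      a.map (fun b => if b then DataLetter.bit1 else .bit0) ++ DataLetter.sep :: u =
        b.map (fun b => if b then DataLetter.bit1 else .bit0) ++ DataLetter.sep :: v →
      a = b ∧ u = v := by
    intro a
    induction a with
    | nil =>
      intro b u v h
      cases b with
      | nil => simpa using h
      | cons c b => cases c <;> simp at h
    | cons d a ih =>
      intro b u v h
      cases b with
      | nil => cases d <;> simp at h
      | cons c b =>
        cases c <;> cases d <;> simp only [List.map_cons, List.cons_append, List.cons.injEq,
          Bool.false_eq_true, if_true, if_false, reduceCtorEq, false_and, true_and] at h ⊢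
        all_goals exact ih b u v h
  intro a b u v h
  obtain ⟨h₁, h₂⟩ := key a.bits b.bits u v (by simpa [encodeNat] using h)
  exact ⟨bits_injective h₁, h₂⟩

theorem prefixInjective_encodeInt : PrefixInjective encodeInt := by
  have hne : ∀ (m : ℕ) (u v : List DataLetter), encodeNat m ++ u ≠ DataLetter.minus :: v := by
    intro m u v h
    unfold encodeNat at h
    rcases hb : m.bits with _ | ⟨c, l⟩
    · simp [hb] at h
    · cases c <;> simp [hb] at h
  intro a b u v h
  unfold encodeInt at h
  split_ifs at h with ha hb hb
  · obtain ⟨h₁, h₂⟩ := prefixInjective_encodeNat _ _ _ _ (by simpa using h)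
    exact ⟨by omega, h₂⟩
  · exact absurd h.symm (hne _ _ _)
  · exact absurd h (hne _ _ _)
  · obtain ⟨h₁, h₂⟩ := prefixInjective_encodeNat _ _ _ _ h
    exact ⟨by omega, h₂⟩

theorem prefixInjective_encodeRat : PrefixInjective encodeRat := by
  intro a b u v h
  simp only [encodeRat, List.append_assoc] at h
  obtain ⟨h₁, h⟩ := prefixInjective_encodeInt _ _ _ _ h
  obtain ⟨h₂, h⟩ := prefixInjective_encodeNat _ _ _ _ h
  exact ⟨Rat.ext h₁ h₂, h⟩

theorem prefixInjective_encodeVec {α : Type} {e : α → List DataLetter} (he : PrefixInjective e)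
    (n : ℕ) : PrefixInjective (fun v : Fin n → α => encodeVec e v) := by
  induction n with
  | zero => exact fun a b u v h => ⟨Subsingleton.elim _ _, by simpa [encodeVec] using h⟩
  | succ n ih =>
    intro a b u v h
    simp only [encodeVec, List.ofFn_succ, List.flatMap_cons, List.append_assoc] at h
    obtain ⟨h₀, h⟩ := he _ _ _ _ h
    obtain ⟨h₁, h⟩ := ih _ _ _ _ h
    refine ⟨funext fun i => ?_, h⟩
    refine Fin.cases h₀ (fun j => congrFun h₁ j) i

theorem LowRankInstance.encode_injective : Function.Injective LowRankInstance.encode := by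
  rintro ⟨n, l, k, lam, t, C, A, b⟩ ⟨n', l', k', lam', t', C', A', b'⟩ h
  have hu : PrefixInjective encodeUnary := prefixInjective_replicate (a := DataLetter.stroke) (b := .sep) (by decide)
  have hm (n : ℕ) : PrefixInjective (encodeMatrix (n := n)) :=
    prefixInjective_encodeVec (prefixInjective_encodeVec prefixInjective_encodeRat n) n
  have h := congrArg (· ++ ([] : List DataLetter)) h
  simp only [LowRankInstance.encode, List.append_assoc] at h
  obtain ⟨rfl, h₁⟩ := hu _ _ _ _ h
  obtain ⟨rfl, h₂⟩ := hu _ _ _ _ h₁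
  obtain ⟨rfl, h₃⟩ := prefixInjective_encodeNat _ _ _ _ h₂
  obtain ⟨rfl, h₄⟩ := prefixInjective_encodeRat _ _ _ _ h₃
  obtain ⟨rfl, h₅⟩ := prefixInjective_encodeRat _ _ _ _ h₄
  obtain ⟨rfl, h₆⟩ := hm _ _ _ _ _ h₅
  obtain ⟨rfl, h₇⟩ := prefixInjective_encodeVec (hm _) _ _ _ _ _ h₆
  obtain ⟨rfl, h₈⟩ := prefixInjective_encodeVec prefixInjective_encodeRat _ _ _ _ _ h₇
  rfl

/-- The decision version of rank-constrained optimization over the positive semidefinite cone. -/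
def lowRankPSD : DecisionProblem where
  Inst := LowRankInstance
  Letter := DataLetter
  finite_letter := inferInstance
  encode := LowRankInstance.encode
  encode_injective := LowRankInstance.encode_injective
  Yes p := ∃ X, p.Feasible X ∧ p.objective X ≤ (p.t : ℝ)

/-! Membership. By the spectral theorem a positive semidefinite `X = U D Uᵀ` equals `Y Yᵀ` with `Y =
U √D`, a square matrix with orthogonal columns. Conversely every `Y Yᵀ` is positive semidefinite,
and if `Yᵀ Y` is diagonal, then its rank is the number of nonzero columns of `Y`. So one quantifies
existentially over the entries of `Y` and over indicators `d i ∈ {0, 1}` of the nonzero columns, and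
the rank becomes `∑ d i`. This is the exact rank and not only an upper bound, which matters because
`lam` may be negative. The equivalence is `LowRankInstance.yes_iff`. The formula stays polynomially
long: binary numerals are expanded by Horner's scheme, and a rational number gets a variable `x`
with `den * x = num`.

Hardness. A formula in Polish notation is read from right to left with a stack of variable indices.
Each operation letter introduces fresh variables and at most six equations `x_a x_b + x_c x_d = x_e
x_f` that force the value of the subterm, or the truth value `0` or `1` of the subformula
(`gadget_sound`, `gadget_complete`, `exists_holds_iff`). In the entries of `X = x xᵀ` these
equations are linear. A symmetric matrix of rank at most one with `X₀₀ = 1` is of this form, so the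
rank bound `1` with objective zero suffices (`exists_holds_iff_yes`). Since membership in `∃ℝ` means
reducibility to ETR, hardness then follows by composing reductions (`TM2ComputableInPolyTime.comp`).

Machines. The running times are proved for actual stack machines by a small calculus. Structured
stack programs act on words for binary trees; the functions `PolyTime` that they compute are closed
under composition, pairing, case distinction on lists, and iteration as long as the intermediate
values stay of polynomial size. Lists, unary arithmetic and lookup in finite tables follow, and
`PolyTime.computable` returns to Turing machines. Both reductions are written as functions from
words to words. No program handles a syntax tree: in prefix notation, the sums, conjunctions and
numerals that are needed are plain concatenations. -/

/-! ### Composition of polynomial-time Turing machines -/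

namespace Turing

open StateTransition

namespace TM2

variable {K : Type} {Γ : K → Type} {Λ σ : Type}

/-- The number of push instructions in a statement. -/
def Stmt.pushes : Stmt Γ Λ σ → ℕ
  | .push _ _ q => q.pushes + 1
  | .peek _ _ q => q.pushes
  | .pop _ _ q => q.pushes
  | .load _ q => q.pushes
  | .branch _ q₁ q₂ => q₁.pushes + q₂.pushes
  | .goto _ => 0
  | .halt => 0

theorem length_stepAux_le [DecidableEq K] (q : Stmt Γ Λ σ) (v : σ) (S : ∀ k, List (Γ k)) (k : K) :
    ((stepAux q v S).stk k).length ≤ (S k).length + q.pushes := by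
  induction q generalizing v S with
  | push k' f q ih =>
    refine (ih _ _).trans ?_
    by_cases h : k = k'
    · subst h; simp only [Function.update_self, List.length_cons, Stmt.pushes]; omega
    · simp only [Function.update_of_ne h, Stmt.pushes]; omega
  | peek k' f q ih => exact ih _ _
  | pop k' f q ih =>
    refine (ih _ _).trans ?_
    by_cases h : k = k'
    · subst h; simp [Stmt.pushes]
    · simp [Stmt.pushes, Function.update_of_ne h]
  | load f q ih => exact ih _ _
  | branch f q₁ q₂ ih₁ ih₂ =>
    simp only [stepAux, Stmt.pushes]
    cases f v
    · exact (ih₂ _ _).trans (by omega)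
    · exact (ih₁ _ _).trans (by omega)
  | goto f => simp [Stmt.pushes]
  | halt => simp [Stmt.pushes]

end TM2

theorem iterate_bind_none {α : Type*} (f : α → Option α) (n : ℕ) :
    (flip bind f)^[n] none = none := by
  induction n with
  | zero => rfl
  | succ n ih => rw [Function.iterate_succ_apply]; exact ih

/-- A run of a machine transported along a simulation. -/
theorem iterate_bind_map {α β : Type*} {f : α → Option α} {g : β → Option β} (e : α → β)
    (h : ∀ a b, f a = some b → g (e a) = some (e b)) {n : ℕ} {a b : α}
    (hab : (flip bind f)^[n] (some a) = some b) :
    (flip bind g)^[n] (some (e a)) = some (e b) := by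
  induction n generalizing a with
  | zero => simpa using congrArg (Option.map e) hab
  | succ n ih =>
    rw [Function.iterate_succ_apply] at hab ⊢
    cases hfa : f a with
    | none =>
      have : flip bind f (some a) = none := hfa
      rw [this, iterate_bind_none] at hab
      cases hab
    | some c =>
      have h₁ : flip bind f (some a) = some c := hfa
      have h₂ : flip bind g (some (e a)) = some (e c) := h a c hfa
      rw [h₁] at hab
      rw [h₂]
      exact ih hab

namespace FinTM2

/-- The largest number of push instructions in one step. -/
def maxPushes (tm : FinTM2) : ℕ :=
  haveI := tm.ΛFin
  Finset.univ.sup fun l => (tm.m l).pushes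

/-- One step lengthens a stack by a bounded amount, so a polynomial-time machine has outputs of
polynomial length. In a composition this bounds the input of the second machine. -/
theorem length_stk_le (tm : FinTM2) (k : tm.K) {n : ℕ} {a b : tm.Cfg}
    (h : (flip bind tm.step)^[n] (some a) = some b) :
    (b.stk k).length ≤ (a.stk k).length + n * tm.maxPushes := by
  induction n generalizing a with
  | zero =>
    obtain rfl : a = b := by simpa using h
    simp
  | succ n ih =>
    rw [Function.iterate_succ_apply] at h
    cases hfa : tm.step a with
    | none =>
      have : flip bind tm.step (some a) = none := hfa
      rw [this, iterate_bind_none] at h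
      cases h
    | some c =>
      have h₁ : flip bind tm.step (some a) = some c := hfa
      rw [h₁] at h
      refine (ih h).trans ?_
      obtain ⟨l, v, S⟩ := a
      cases l with
      | none => cases hfa
      | some l =>
        obtain rfl : TM2.stepAux (tm.m l) v S = c := Option.some.inj hfa
        have := TM2.length_stepAux_le (tm.m l) v S k
        have h₂ : (tm.m l).pushes ≤ tm.maxPushes :=
          Finset.le_sup (s := @Finset.univ _ tm.ΛFin) (f := fun l => (tm.m l).pushes) (@Finset.mem_univ _ tm.ΛFin l)
        have h₃ : (n + 1) * tm.maxPushes = n * tm.maxPushes + tm.maxPushes := by ring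
        simp only at this ⊢
        omega

end FinTM2

/-! ### The composite of two stack machines. -/

namespace Comp

variable (tm₁ tm₂ : FinTM2) (t : tm₁.Γ tm₁.k₁ ≃ tm₂.Γ tm₂.k₀)

/-- The stacks of the composite of two machines: those of the two machines and an auxiliary one. -/
abbrev Stk : Type := tm₁.K ⊕ tm₂.K ⊕ Unit

/-- The stack alphabets of the composite. -/
abbrev Alph : Stk tm₁ tm₂ → Type :=
  Sum.rec tm₁.Γ (Sum.rec tm₂.Γ fun _ => tm₂.Γ tm₂.k₀)

/-- The labels of the composite: the two last summands serve to move the output of the first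
machine to the auxiliary stack and from there to the input stack of the second machine. -/
abbrev Lab : Type := tm₁.Λ ⊕ tm₂.Λ ⊕ Option (tm₂.Γ tm₂.k₀) ⊕ Option (tm₂.Γ tm₂.k₀)

/-- The internal states of the composite. -/
abbrev St : Type := tm₁.σ × tm₂.σ × Option (tm₂.Γ tm₂.k₀)

/-- The statements of the first machine inside the composite. -/
def stmt₁ : TM2.Stmt tm₁.Γ tm₁.Λ tm₁.σ → TM2.Stmt (Alph tm₁ tm₂) (Lab tm₁ tm₂) (St tm₁ tm₂)
  | .push k f q => .push (Sum.inl k) (fun v => f v.1) (stmt₁ q)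
  | .peek k f q => .peek (Sum.inl k) (fun v o => (f v.1 o, v.2)) (stmt₁ q)
  | .pop k f q => .pop (Sum.inl k) (fun v o => (f v.1 o, v.2)) (stmt₁ q)
  | .load f q => .load (fun v => (f v.1, v.2)) (stmt₁ q)
  | .branch f q₁ q₂ => .branch (fun v => f v.1) (stmt₁ q₁) (stmt₁ q₂)
  | .goto f => .goto fun v => .inl (f v.1)
  | .halt => .goto fun _ => .inr (.inr (.inl none))

/-- The statements of the second machine inside the composite. -/
def stmt₂ : TM2.Stmt tm₂.Γ tm₂.Λ tm₂.σ → TM2.Stmt (Alph tm₁ tm₂) (Lab tm₁ tm₂) (St tm₁ tm₂)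
  | .push k f q => .push (Sum.inr (.inl k)) (fun v => f v.2.1) (stmt₂ q)
  | .peek k f q => .peek (Sum.inr (.inl k)) (fun v o => (v.1, f v.2.1 o, v.2.2)) (stmt₂ q)
  | .pop k f q => .pop (Sum.inr (.inl k)) (fun v o => (v.1, f v.2.1 o, v.2.2)) (stmt₂ q)
  | .load f q => .load (fun v => (v.1, f v.2.1, v.2.2)) (stmt₂ q)
  | .branch f q₁ q₂ => .branch (fun v => f v.2.1) (stmt₂ q₁) (stmt₂ q₂)
  | .goto f => .goto fun v => .inr (.inl (f v.2.1))
  | .halt => .halt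

/-- The program of the composite. -/
def code : Lab tm₁ tm₂ → TM2.Stmt (Alph tm₁ tm₂) (Lab tm₁ tm₂) (St tm₁ tm₂)
  | .inl l => stmt₁ tm₁ tm₂ (tm₁.m l)
  | .inr (.inl l) => stmt₂ tm₁ tm₂ (tm₂.m l)
  | .inr (.inr (.inl none)) =>
    .pop (Sum.inl tm₁.k₁) (fun v o => (v.1, v.2.1, Option.map t o)) (.goto fun v =>
      match v.2.2 with
      | none => .inr (.inr (.inr none))
      | some a => .inr (.inr (.inl (some a))))
  | .inr (.inr (.inl (some a))) =>
    .push (Sum.inr (.inr ())) (fun _ => a) (.goto fun _ => .inr (.inr (.inl none)))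
  | .inr (.inr (.inr none)) =>
    .pop (Sum.inr (.inr ())) (fun v o => (v.1, v.2.1, o)) (.goto fun v =>
      match v.2.2 with
      | none => .inr (.inl tm₂.main)
      | some a => .inr (.inr (.inr (some a))))
  | .inr (.inr (.inr (some a))) =>
    .push (Sum.inr (.inl tm₂.k₀)) (fun _ => a) (.goto fun _ => .inr (.inr (.inr none)))

/-- The composite machine. -/
def machine : FinTM2 :=
  haveI := tm₁.kFin
  haveI := tm₂.kFin
  haveI := tm₁.ΛFin
  haveI := tm₂.ΛFin
  haveI := tm₁.σFin
  haveI := tm₂.σFin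
  haveI := tm₁.Γk₀Fin
  haveI := tm₂.Γk₀Fin
  { K := Stk tm₁ tm₂
    k₀ := .inl tm₁.k₀
    k₁ := .inr (.inl tm₂.k₁)
    Γ := Alph tm₁ tm₂
    Λ := Lab tm₁ tm₂
    main := .inl tm₁.main
    σ := St tm₁ tm₂
    initialState := (tm₁.initialState, tm₂.initialState, none)
    Γk₀Fin := tm₁.Γk₀Fin
    m := code tm₁ tm₂ t }

variable {tm₁ tm₂}

/-- The stacks of the composite, assembled from those of the parts. -/
def stk (S₁ : ∀ k, List (tm₁.Γ k)) (S₂ : ∀ k, List (tm₂.Γ k)) (w : List (tm₂.Γ tm₂.k₀)) :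
    ∀ k, List (Alph tm₁ tm₂ k) :=
  Sum.rec S₁ (Sum.rec S₂ fun _ => w)

variable (S₁ : ∀ k, List (tm₁.Γ k)) (S₂ : ∀ k, List (tm₂.Γ k)) (w : List (tm₂.Γ tm₂.k₀))

theorem update_stk_inl (k : tm₁.K) (u : List (tm₁.Γ k)) :
    Function.update (stk S₁ S₂ w) (Sum.inl k) u = stk (Function.update S₁ k u) S₂ w := by
  funext k'
  rcases k' with k' | k' | k'
  · by_cases h : k' = k
    · subst h; simp [stk]
    · rw [Function.update_of_ne (by simpa using h)]
      simp [stk, Function.update_of_ne h]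
  · rw [Function.update_of_ne (by simp)]; rfl
  · rw [Function.update_of_ne (by simp)]; rfl

theorem update_stk_inr (k : tm₂.K) (u : List (tm₂.Γ k)) :
    Function.update (stk S₁ S₂ w) (Sum.inr (.inl k)) u = stk S₁ (Function.update S₂ k u) w := by
  funext k'
  rcases k' with k' | k' | k'
  · rw [Function.update_of_ne (by simp)]; rfl
  · by_cases h : k' = k
    · subst h; simp [stk]
    · rw [Function.update_of_ne (by simpa using h)]
      simp [stk, Function.update_of_ne h]
  · rw [Function.update_of_ne (by simp)]; rfl

theorem update_stk_aux (u : List (tm₂.Γ tm₂.k₀)) :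
    Function.update (stk S₁ S₂ w) (Sum.inr (.inr ())) u = stk S₁ S₂ u := by
  funext k'
  rcases k' with k' | k' | k'
  · rw [Function.update_of_ne (by simp)]; rfl
  · rw [Function.update_of_ne (by simp)]; rfl
  · simp [stk]

/-- A configuration of the first machine inside the composite. -/
def cfg₁ (c : tm₁.Cfg) : TM2.Cfg (Alph tm₁ tm₂) (Lab tm₁ tm₂) (St tm₁ tm₂) :=
  ⟨match c.l with
    | some l => some (.inl l)
    | none => some (.inr (.inr (.inl none))),
    (c.var, tm₂.initialState, none), stk c.stk (fun _ => []) []⟩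

/-- A configuration of the second machine inside the composite. -/
def cfg₂ (c : tm₂.Cfg) : TM2.Cfg (Alph tm₁ tm₂) (Lab tm₁ tm₂) (St tm₁ tm₂) :=
  ⟨c.l.map fun l => .inr (.inl l), (tm₁.initialState, c.var, none), stk (fun _ => []) c.stk []⟩

/-- `cfg₁` reads a halted configuration as the label that starts the transfer of the output, and
this is where `stmt₁` sends `halt`. Hence halting of the first machine needs no separate treatment.
-/
theorem stepAux_stmt₁ (q : TM2.Stmt tm₁.Γ tm₁.Λ tm₁.σ) (v : tm₁.σ) (S : ∀ k, List (tm₁.Γ k)) :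
    TM2.stepAux (stmt₁ tm₁ tm₂ q) (v, tm₂.initialState, none) (stk S (fun _ => []) []) =
      cfg₁ (TM2.stepAux q v S) := by
  induction q generalizing v S with
  | push k f q ih =>
    simp only [stmt₁, TM2.stepAux]
    rw [update_stk_inl, ← ih]; rfl
  | peek k f q ih => simp only [stmt₁, TM2.stepAux]; rw [← ih]; rfl
  | pop k f q ih =>
    simp only [stmt₁, TM2.stepAux]
    rw [update_stk_inl, ← ih]; rfl
  | load f q ih => simp only [stmt₁, TM2.stepAux]; rw [← ih]
  | branch f q₁ q₂ ih₁ ih₂ =>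
    simp only [stmt₁, TM2.stepAux, ih₁, ih₂]
    cases f v <;> rfl
  | goto f => rfl
  | halt => rfl

theorem stepAux_stmt₂ (q : TM2.Stmt tm₂.Γ tm₂.Λ tm₂.σ) (v : tm₂.σ) (S : ∀ k, List (tm₂.Γ k)) :
    TM2.stepAux (stmt₂ tm₁ tm₂ q) (tm₁.initialState, v, none) (stk (fun _ => []) S []) =
      cfg₂ (TM2.stepAux q v S) := by
  induction q generalizing v S with
  | push k f q ih =>
    simp only [stmt₂, TM2.stepAux]
    rw [update_stk_inr, ← ih]; rfl
  | peek k f q ih => simp only [stmt₂, TM2.stepAux]; rw [← ih]; rfl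
  | pop k f q ih =>
    simp only [stmt₂, TM2.stepAux]
    rw [update_stk_inr, ← ih]; rfl
  | load f q ih => simp only [stmt₂, TM2.stepAux]; rw [← ih]
  | branch f q₁ q₂ ih₁ ih₂ =>
    simp only [stmt₂, TM2.stepAux, ih₁, ih₂]
    cases f v <;> rfl
  | goto f => rfl
  | halt => rfl

theorem step_cfg₁ (a b : tm₁.Cfg) (h : tm₁.step a = some b) :
    (machine tm₁ tm₂ t).step (cfg₁ a) = some (cfg₁ b) := by
  obtain ⟨l, v, S⟩ := a
  cases l with
  | none => cases h
  | some l =>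
    obtain rfl : TM2.stepAux (tm₁.m l) v S = b := Option.some.inj h
    exact congrArg some (stepAux_stmt₁ (tm₁.m l) v S)

theorem step_cfg₂ (a b : tm₂.Cfg) (h : tm₂.step a = some b) :
    (machine tm₁ tm₂ t).step (cfg₂ a) = some (cfg₂ b) := by
  obtain ⟨l, v, S⟩ := a
  cases l with
  | none => cases h
  | some l =>
    obtain rfl : TM2.stepAux (tm₂.m l) v S = b := Option.some.inj h
    exact congrArg some (stepAux_stmt₂ (tm₂.m l) v S)

/-- A stack contents with one nonempty stack. -/
def single {K : Type} [DecidableEq K] {Γ : K → Type} (k : K) (u : List (Γ k)) :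
    ∀ k, List (Γ k) :=
  Function.update (fun _ => []) k u

/-- The right hand side agrees by definition with the stack contents in `initList` and `haltList`.
-/
theorem single_eq_dite {K : Type} [DecidableEq K] {Γ : K → Type} (k : K) (u : List (Γ k)) :
    single k u = fun k' => if h : k' = k then (by rw [h]; exact u) else [] := by
  funext k'
  by_cases h : k' = k
  · subst h; simp [single]
  · simp [single, h]

theorem single_nil {K : Type} [DecidableEq K] {Γ : K → Type} (k : K) :
    single k [] = fun k : K => ([] : List (Γ k)) :=
  Function.update_eq_self k _

theorem update_single {K : Type} [DecidableEq K] {Γ : K → Type} (k : K) (u v : List (Γ k)) :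
    Function.update (single k u) k v = single k v :=
  Function.update_idem _ _ _

theorem initList_eq (tm : FinTM2) (s : List (tm.Γ tm.k₀)) :
    initList tm s = ⟨some tm.main, tm.initialState, single tm.k₀ s⟩ := by
  rw [single_eq_dite]; rfl

theorem haltList_eq (tm : FinTM2) (s : List (tm.Γ tm.k₁)) :
    haltList tm s = ⟨none, tm.initialState, single tm.k₁ s⟩ := by
  rw [single_eq_dite]; rfl

theorem step_unload_nil (w : List (tm₂.Γ tm₂.k₀)) (o : Option (tm₂.Γ tm₂.k₀)) :
    (machine tm₁ tm₂ t).step ⟨some (.inr (.inr (.inl none))),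
      (tm₁.initialState, tm₂.initialState, o), stk (single tm₁.k₁ []) (fun _ => []) w⟩ =
    some ⟨some (.inr (.inr (.inr none))), (tm₁.initialState, tm₂.initialState, none),
      stk (fun _ => []) (fun _ => []) w⟩ := by
  have hk : stk (tm₂ := tm₂) (single tm₁.k₁ []) (fun _ => []) w (Sum.inl tm₁.k₁) = [] := by
    simp [stk, single]
  change some (TM2.stepAux (code tm₁ tm₂ t (.inr (.inr (.inl none)))) _ _) = _
  simp only [code, TM2.stepAux, hk, List.head?_nil, Option.map_none, List.tail_nil]
  rw [update_stk_inl, update_single, single_nil]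
  rfl

theorem step_unload_cons (a : tm₁.Γ tm₁.k₁) (u : List (tm₁.Γ tm₁.k₁)) (w : List (tm₂.Γ tm₂.k₀))
    (o : Option (tm₂.Γ tm₂.k₀)) :
    (machine tm₁ tm₂ t).step ⟨some (.inr (.inr (.inl none))),
      (tm₁.initialState, tm₂.initialState, o), stk (single tm₁.k₁ (a :: u)) (fun _ => []) w⟩ =
    some ⟨some (.inr (.inr (.inl (some (t a))))), (tm₁.initialState, tm₂.initialState, some (t a)),
      stk (single tm₁.k₁ u) (fun _ => []) w⟩ := by
  have hk : stk (tm₂ := tm₂) (single tm₁.k₁ (a :: u)) (fun _ => []) w (Sum.inl tm₁.k₁) =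
      a :: u := by
    simp [stk, single]
  change some (TM2.stepAux (code tm₁ tm₂ t (.inr (.inr (.inl none)))) _ _) = _
  simp only [code, TM2.stepAux, hk, List.head?_cons, Option.map_some, List.tail_cons]
  rw [update_stk_inl, update_single]
  rfl

theorem step_unload_put (a : tm₂.Γ tm₂.k₀) (S : ∀ k, List (tm₁.Γ k)) (w : List (tm₂.Γ tm₂.k₀))
    (v : St tm₁ tm₂) :
    (machine tm₁ tm₂ t).step ⟨some (.inr (.inr (.inl (some a)))), v, stk S (fun _ => []) w⟩ =
    some ⟨some (.inr (.inr (.inl none))), v, stk S (fun _ => []) (a :: w)⟩ :=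
  congrArg some (congrArg (TM2.Cfg.mk _ _) (update_stk_aux S (fun _ => []) w (a :: w)))

/-- Finding the auxiliary stack empty clears the letter held in the internal state, so that the
result has the form `cfg₂`. -/
theorem step_load_nil (S : ∀ k, List (tm₂.Γ k)) (o : Option (tm₂.Γ tm₂.k₀)) :
    (machine tm₁ tm₂ t).step ⟨some (.inr (.inr (.inr none))),
      (tm₁.initialState, tm₂.initialState, o), stk (fun _ => []) S []⟩ =
    some ⟨some (.inr (.inl tm₂.main)), (tm₁.initialState, tm₂.initialState, none),
      stk (fun _ => []) S []⟩ :=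
  congrArg some (congrArg (TM2.Cfg.mk _ _) (update_stk_aux (fun _ => []) S [] []))

theorem step_load_cons (a : tm₂.Γ tm₂.k₀) (S : ∀ k, List (tm₂.Γ k)) (w : List (tm₂.Γ tm₂.k₀))
    (o : Option (tm₂.Γ tm₂.k₀)) :
    (machine tm₁ tm₂ t).step ⟨some (.inr (.inr (.inr none))),
      (tm₁.initialState, tm₂.initialState, o), stk (fun _ => []) S (a :: w)⟩ =
    some ⟨some (.inr (.inr (.inr (some a)))), (tm₁.initialState, tm₂.initialState, some a),
      stk (fun _ => []) S w⟩ :=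
  congrArg some (congrArg (TM2.Cfg.mk _ _) (update_stk_aux (fun _ => []) S (a :: w) w))

theorem step_load_put (a : tm₂.Γ tm₂.k₀) (u w : List (tm₂.Γ tm₂.k₀)) (v : St tm₁ tm₂) :
    (machine tm₁ tm₂ t).step ⟨some (.inr (.inr (.inr (some a)))), v,
      stk (fun _ => []) (single tm₂.k₀ u) w⟩ =
    some ⟨some (.inr (.inr (.inr none))), v, stk (fun _ => []) (single tm₂.k₀ (a :: u)) w⟩ := by
  have hk : stk (tm₁ := tm₁) (fun _ => []) (single tm₂.k₀ u) w (Sum.inr (.inl tm₂.k₀)) = u := by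
    simp [stk, single]
  change some (TM2.stepAux (code tm₁ tm₂ t (.inr (.inr (.inr (some a))))) _ _) = _
  simp only [code, TM2.stepAux, hk]
  rw [update_stk_inr, update_single]
  rfl

/-- Two steps per letter and one to notice the empty stack. The transfer reverses the word;
`evals_load` reverses it back. -/
theorem evals_unload (u : List (tm₁.Γ tm₁.k₁)) (w : List (tm₂.Γ tm₂.k₀))
    (o : Option (tm₂.Γ tm₂.k₀)) :
    (flip bind (machine tm₁ tm₂ t).step)^[2 * u.length + 1]
      (some ⟨some (.inr (.inr (.inl none))), (tm₁.initialState, tm₂.initialState, o),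
        stk (single tm₁.k₁ u) (fun _ => []) w⟩) =
      some ⟨some (.inr (.inr (.inr none))), (tm₁.initialState, tm₂.initialState, none),
        stk (fun _ => []) (fun _ => []) (u.reverse.map t ++ w)⟩ := by
  induction u generalizing w o with
  | nil => exact step_unload_nil t w o
  | cons a u ih =>
    rw [show 2 * (a :: u).length + 1 = 2 * u.length + 1 + 1 + 1 by simp; ring,
      Function.iterate_succ_apply, Function.iterate_succ_apply]
    simp only [List.reverse_cons, List.map_append, List.append_assoc]
    refine Eq.trans (congrArg _ ?_) (ih (t a :: w) (some (t a)))
    exact (congrArg (flip bind _) (step_unload_cons t a u w o)).trans (step_unload_put t _ _ _ _)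

theorem evals_load (v w : List (tm₂.Γ tm₂.k₀)) (o : Option (tm₂.Γ tm₂.k₀)) :
    (flip bind (machine tm₁ tm₂ t).step)^[2 * v.length + 1]
      (some ⟨some (.inr (.inr (.inr none))), (tm₁.initialState, tm₂.initialState, o),
        stk (fun _ => []) (single tm₂.k₀ w) v⟩) =
      some ⟨some (.inr (.inl tm₂.main)), (tm₁.initialState, tm₂.initialState, none),
        stk (fun _ => []) (single tm₂.k₀ (v.reverse ++ w)) []⟩ := by
  induction v generalizing w o with
  | nil => exact step_load_nil t _ o
  | cons a u ih =>
    rw [show 2 * (a :: u).length + 1 = 2 * u.length + 1 + 1 + 1 by simp; ring,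
      Function.iterate_succ_apply, Function.iterate_succ_apply]
    simp only [List.reverse_cons, List.append_assoc]
    refine Eq.trans (congrArg _ ?_) (ih (a :: w) (some a))
    exact (congrArg (flip bind _) (step_load_cons t a _ u o)).trans (step_load_put t _ _ _ _)

end Comp

theorem _root_.Polynomial.eval_nat_mono (p : Polynomial ℕ) : Monotone fun n => p.eval n := by
  intro m n h
  simp only [Polynomial.eval_eq_sum, Polynomial.sum_def]
  gcongr

theorem iterate_trans {α : Type*} {f : α → α} {m n : ℕ} {a b c : α} (h₁ : f^[m] a = b)
    (h₂ : f^[n] b = c) : f^[n + m] a = c := by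
  rw [Function.iterate_add_apply, h₁, h₂]

/-- Functions computable in polynomial time are closed under composition. -/
theorem TM2ComputableInPolyTime.comp {α β γ αΓ βΓ γΓ : Type} {eα : α → List αΓ}
    {eβ : β → List βΓ} {eγ : γ → List γΓ} {f : α → β} {g : β → γ}
    (h₁ : TM2ComputableInPolyTime eα eβ f) (h₂ : TM2ComputableInPolyTime eβ eγ g) :
    Nonempty (TM2ComputableInPolyTime eα eγ (g ∘ f)) := by
  classical
  let t : h₁.tm.Γ h₁.tm.k₁ ≃ h₂.tm.Γ h₂.tm.k₀ := h₁.outputAlphabet.trans h₂.inputAlphabet.symm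
  -- A bound for the length of the intermediate word: the input, plus what the first machine can
  -- push in its running time.
  let L : Polynomial ℕ := Polynomial.X + h₁.time * Polynomial.C h₁.tm.maxPushes
  refine ⟨⟨⟨Comp.machine h₁.tm h₂.tm t, h₁.inputAlphabet, h₂.outputAlphabet⟩,
    h₁.time + (2 * L + 1) + (2 * L + 1) + h₂.time.comp L, fun a => ?_⟩⟩
  obtain ⟨⟨n₁, e₁⟩, hn₁⟩ := h₁.outputsFun a
  obtain ⟨⟨n₂, e₂⟩, hn₂⟩ := h₂.outputsFun (f a)
  simp only [Option.map_some] at e₁ e₂ ⊢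
  have hn₁ : n₁ ≤ h₁.time.eval (eα a).length := hn₁
  have hn₂ : n₂ ≤ h₂.time.eval (eβ (f a)).length := hn₂
  set w₀ : List _ := List.map h₁.inputAlphabet.invFun (eα a) with hw₀
  set w₁ : List _ := List.map h₁.outputAlphabet.invFun (eβ (f a)) with hw₁
  set w₂ : List _ := List.map h₂.inputAlphabet.invFun (eβ (f a)) with hw₂
  set w₃ : List _ := List.map h₂.outputAlphabet.invFun (eγ (g (f a))) with hw₃
  have hlen : (eβ (f a)).length ≤ L.eval (eα a).length := by
    have := h₁.tm.length_stk_le h₁.tm.k₁ e₁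
    rw [Comp.initList_eq, Comp.haltList_eq] at this
    have hk : (Comp.single h₁.tm.k₀ w₀ h₁.tm.k₁).length ≤ (eα a).length := by
      -- The output stack may coincide with the input stack, and then it starts with the input on
      -- it; otherwise it starts empty.
      by_cases h : h₁.tm.k₁ = h₁.tm.k₀
      · rw [Comp.single_eq_dite]
        simp only [h, dite_true]
        have : ∀ (k : h₁.tm.K) (h : k = h₁.tm.k₀) (e : List (h₁.tm.Γ h₁.tm.k₀) =
            List (h₁.tm.Γ k)), (cast e w₀).length = w₀.length := by
          intro k h e; subst h; rfl
        refine (this _ h _).le.trans ?_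
        simp [hw₀]
      · simp [Comp.single, Function.update_of_ne h]
    have hw : (Comp.single h₁.tm.k₁ w₁ h₁.tm.k₁).length = (eβ (f a)).length := by
      simp [Comp.single, hw₁]
    simp only [hw] at this
    simp only [L, Polynomial.eval_add, Polynomial.eval_X, Polynomial.eval_mul, Polynomial.eval_C]
    have := Nat.mul_le_mul_right h₁.tm.maxPushes hn₁
    omega
  have r₁ := iterate_bind_map (Comp.cfg₁ (tm₂ := h₂.tm)) (Comp.step_cfg₁ t) e₁
  have r₂ := Comp.evals_unload t w₁ [] none
  have r₃ := Comp.evals_load t (w₁.reverse.map t ++ []) [] none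
  have r₄ := iterate_bind_map (Comp.cfg₂ (tm₁ := h₁.tm)) (Comp.step_cfg₂ t) e₂
  have hw : (w₁.reverse.map t ++ []).reverse ++ [] = w₂ := by
    simp only [List.append_nil, ← List.map_reverse, List.reverse_reverse, hw₁, hw₂, List.map_map]
    refine List.map_congr_left fun b _ => ?_
    simp [t]
  rw [hw] at r₃
  have i₀ : initList (Comp.machine h₁.tm h₂.tm t) w₀ = Comp.cfg₁ (initList h₁.tm w₀) := by
    rw [Comp.initList_eq h₁.tm]
    refine (Comp.initList_eq (Comp.machine h₁.tm h₂.tm t) w₀).trans ?_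
    simp only [Comp.cfg₁]
    have := Comp.update_stk_inl (tm₁ := h₁.tm) (tm₂ := h₂.tm) (fun _ => []) (fun _ => []) []
      h₁.tm.k₀ w₀
    refine congrArg (TM2.Cfg.mk _ _) ?_
    refine Eq.trans ?_ this
    refine congrArg (fun s => Function.update s _ _) ?_
    funext k
    rcases k with k | k | k <;> rfl
  have i₁ : haltList (Comp.machine h₁.tm h₂.tm t) w₃ = Comp.cfg₂ (haltList h₂.tm w₃) := by
    rw [Comp.haltList_eq h₂.tm]
    refine (Comp.haltList_eq (Comp.machine h₁.tm h₂.tm t) w₃).trans ?_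
    simp only [Comp.cfg₂]
    have := Comp.update_stk_inr (tm₁ := h₁.tm) (tm₂ := h₂.tm) (fun _ => []) (fun _ => []) []
      h₂.tm.k₁ w₃
    refine congrArg (TM2.Cfg.mk _ _) ?_
    refine Eq.trans ?_ this
    refine congrArg (fun s => Function.update s _ _) ?_
    funext k
    rcases k with k | k | k <;> rfl
  rw [Comp.haltList_eq] at r₁
  rw [Comp.initList_eq] at r₄
  rw [Comp.single_nil] at r₃
  refine ⟨⟨n₂ + ((2 * (w₁.reverse.map t ++ []).length + 1) + ((2 * w₁.length + 1) +
    n₁)), ?_⟩, ?_⟩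
  · refine Eq.trans ?_ (congrArg some i₁.symm)
    refine iterate_trans ?_ r₄
    refine iterate_trans ?_ r₃
    refine iterate_trans ?_ r₂
    exact (congrArg _ (congrArg some i₀)).trans r₁
  · have s₁ := hn₁
    have s₂ := hn₂.trans (h₂.time.eval_nat_mono hlen)
    simp only [Polynomial.eval_add, Polynomial.eval_mul, Polynomial.eval_ofNat,
      Polynomial.eval_one, Polynomial.eval_comp]
    have l₁ : w₁.length = (eβ (f a)).length := by simp [hw₁]
    simp only [List.append_nil, List.length_map, List.length_reverse, l₁]
    simp only at s₂
    omega

end Turing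

/-! ### Structured stack programs -/

/-- The stacks of a structured program: two for input and output and four with bits. -/
inductive Reg where
  | data | form | main | left | right | count
  deriving DecidableEq

instance : Fintype Reg :=
  ⟨{.data, .form, .main, .left, .right, .count}, by rintro ⟨⟩ <;> decide⟩

/-- The alphabets of the stacks. -/
abbrev Reg.Alph : Reg → Type
  | .data => DataLetter
  | .form => FormulaLetter
  | _ => Bool

/-- The contents of the stacks. -/
abbrev Store : Type := ∀ k : Reg, List k.Alph

/-- An instruction with successor labels in `L`. -/
inductive Instr (L : Type) where
  | push (k : Reg) (a : k.Alph) (l : L)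
  | pop (k : Reg) (next : Option k.Alph → L)

/-- Change of labels. -/
def Instr.map {L L' : Type} (g : L → L') : Instr L → Instr L'
  | .push k a l => .push k a (g l)
  | .pop k next => .pop k fun o => g (next o)

/-- `Run code n a b`: the program leads from `a` to `b` in `n` steps. The label `none` is the
exit. -/
inductive Run {L : Type} (code : L → Instr (Option L)) :
    ℕ → Option L × Store → Option L × Store → Prop
  | refl (a) : Run code 0 a a
  | push {n l s c k a l'} (h : code l = .push k a l')
      (hr : Run code n (l', Function.update s k (a :: s k)) c) : Run code (n + 1) (some l, s) c
  | pop {n l s c k next} (h : code l = .pop k next)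
      (hr : Run code n (next (s k).head?, Function.update s k (s k).tail) c) :
      Run code (n + 1) (some l, s) c

theorem Run.trans {L : Type} {code : L → Instr (Option L)} {m n : ℕ} {a b c : Option L × Store}
    (h₁ : Run code m a b) (h₂ : Run code n b c) : Run code (m + n) a c := by
  induction h₁ with
  | refl a => simpa using h₂
  | push h _ ih => rw [Nat.add_right_comm]; exact .push h (ih h₂)
  | pop h _ ih => rw [Nat.add_right_comm]; exact .pop h (ih h₂)

/-- Programs are combined by relabelling. Since `g none` is arbitrary, the exit of a part can be
redirected to the start of the next part or to the head of a loop. -/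
theorem Run.map {L L' : Type} {code : L → Instr (Option L)} {code' : L' → Instr (Option L')}
    (g : Option L → Option L')
    (hg : ∀ l, ∃ l', g (some l) = some l' ∧ code' l' = (code l).map g)
    {n : ℕ} {a b : Option L × Store} (h : Run code n a b) :
    Run code' n (g a.1, a.2) (g b.1, b.2) := by
  induction h with
  | refl a => exact .refl _
  | @push n l s c k a l₁ h _ ih =>
    obtain ⟨l', h₁, h₂⟩ := hg l
    change Run code' (n + 1) (g (some l), s) _
    rw [h₁]
    exact .push (k := k) (a := a) (by rw [h₂, h]; rfl) ih
  | @pop n l s c k next h _ ih =>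
    obtain ⟨l', h₁, h₂⟩ := hg l
    change Run code' (n + 1) (g (some l), s) _
    rw [h₁]
    exact .pop (k := k) (by rw [h₂, h]; rfl) ih

/-- A program with finitely many labels and an entry. -/
structure StackProg where
  L : Type
  [fin : Finite L]
  start : Option L
  code : L → Instr (Option L)

attribute [instance] StackProg.fin

/-- The program turns the store `s` into `s'` in at most `n` steps. -/
def StackProg.Exec (P : StackProg) (s s' : Store) (n : ℕ) : Prop :=
  ∃ m ≤ n, Run P.code m (P.start, s) (none, s')

namespace StackProg

theorem Exec.mono {P : StackProg} {s s' : Store} {m n : ℕ} (h : P.Exec s s' m) (hmn : m ≤ n) :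
    P.Exec s s' n := by
  obtain ⟨k, hk, hr⟩ := h
  exact ⟨k, hk.trans hmn, hr⟩

/-- The empty program. -/
def skip : StackProg := ⟨Empty, none, Empty.elim⟩

theorem exec_skip (s : Store) : skip.Exec s s 0 := ⟨0, le_rfl, .refl _⟩

/-- Push a letter. -/
def push (k : Reg) (a : k.Alph) : StackProg := ⟨Unit, some (), fun _ => .push k a none⟩

theorem exec_push (k : Reg) (a : k.Alph) (s : Store) :
    (push k a).Exec s (Function.update s k (a :: s k)) 1 :=
  ⟨1, le_rfl, .push rfl (.refl _)⟩

/-- One program after the other. -/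
def seq (P Q : StackProg) : StackProg where
  L := P.L ⊕ Q.L
  start := (P.start.map Sum.inl).orElse fun _ => Q.start.map Sum.inr
  code := Sum.elim
    (fun l => (P.code l).map fun o => (o.map Sum.inl).orElse fun _ => Q.start.map Sum.inr)
    (fun l => (Q.code l).map (Option.map Sum.inr))

theorem Exec.seq {P Q : StackProg} {s s' s'' : Store} {m n : ℕ} (h₁ : P.Exec s s' m)
    (h₂ : Q.Exec s' s'' n) : (P.seq Q).Exec s s'' (m + n) := by
  obtain ⟨m', hm, h₁⟩ := h₁
  obtain ⟨n', hn, h₂⟩ := h₂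
  refine ⟨m' + n', by omega, Run.trans (b := (Q.start.map Sum.inr, s')) ?_ ?_⟩
  · exact h₁.map (code' := (P.seq Q).code)
      (fun o => (o.map Sum.inl).orElse fun _ => Q.start.map Sum.inr)
      (fun l => ⟨Sum.inl l, rfl, rfl⟩)
  · exact h₂.map (code' := (P.seq Q).code) (Option.map Sum.inr) (fun l => ⟨Sum.inr l, rfl, rfl⟩)

/-- Pop a letter and branch. -/
def pop (k : Reg) [Finite k.Alph] (P : Option k.Alph → StackProg) : StackProg where
  L := Option (Σ o, (P o).L)
  start := some none
  code
    | none => .pop k fun o => (P o).start.map fun l => some ⟨o, l⟩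
    | some l => ((P l.1).code l.2).map (Option.map fun l' => some ⟨l.1, l'⟩)

theorem Exec.pop {k : Reg} [Finite k.Alph] {P : Option k.Alph → StackProg} {s s' : Store} {n : ℕ}
    (h : (P (s k).head?).Exec (Function.update s k (s k).tail) s' n) :
    (pop k P).Exec s s' (n + 1) := by
  obtain ⟨n', hn, h⟩ := h
  refine ⟨n' + 1, by omega, .pop (k := k) rfl ?_⟩
  exact h.map (code' := (StackProg.pop k P).code) (Option.map fun l' => some ⟨(s k).head?, l'⟩)
    (fun l => ⟨some ⟨_, l⟩, rfl, rfl⟩)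

/-- Pop letters until the stack is empty, and execute a program for each of them. -/
def loop (k : Reg) [Finite k.Alph] (P : k.Alph → StackProg) : StackProg where
  L := Option (Σ a, (P a).L)
  start := some none
  code
    | none => .pop k fun
      | none => none
      | some a => some ((P a).start.map fun l => ⟨a, l⟩)
    | some l => ((P l.1).code l.2).map fun o => some (o.map fun l' => ⟨l.1, l'⟩)

theorem exec_loop_nil {k : Reg} [Finite k.Alph] {P : k.Alph → StackProg} {s : Store} (h : s k = []) :
    (loop k P).Exec s s 1 := by
  refine ⟨1, le_rfl, .pop (k := k) rfl ?_⟩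
  rw [h, List.tail_nil, ← h, Function.update_eq_self, h]
  exact .refl _

theorem Exec.loop {k : Reg} [Finite k.Alph] {P : k.Alph → StackProg} {s s' s'' : Store} {m n : ℕ}
    {a : k.Alph} {u : List k.Alph} (h : s k = a :: u)
    (h₁ : (P a).Exec (Function.update s k u) s' m) (h₂ : (loop k P).Exec s' s'' n) :
    (loop k P).Exec s s'' (m + n + 1) := by
  obtain ⟨m', hm, h₁⟩ := h₁
  obtain ⟨n', hn, h₂⟩ := h₂
  refine ⟨m' + n' + 1, by omega, .pop (k := k) rfl ?_⟩
  rw [h]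
  refine Run.trans (b := (some none, s')) ?_ h₂
  exact h₁.map (code' := (StackProg.loop k P).code) (fun o => some (o.map fun l' => ⟨a, l'⟩))
    (fun l => ⟨some ⟨a, l⟩, rfl, rfl⟩)

open Turing

/-- The instructions as statements of a stack machine whose internal state is a label. -/
def stmt {L : Type} : Instr (Option L) → TM2.Stmt Reg.Alph (Option L) (Option L)
  | .push k a l => .push k (fun _ => a) (.goto fun _ => l)
  | .pop k next => .pop k (fun _ o => next o) (.goto fun v => v)

/-- The program as a stack machine. -/
noncomputable def machine (P : StackProg) (k₀ k₁ : Reg) [Fintype k₀.Alph] : FinTM2 :=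
  haveI := Fintype.ofFinite P.L
  { K := Reg
    k₀ := k₀
    k₁ := k₁
    Γ := Reg.Alph
    Λ := Option P.L
    main := P.start
    σ := Option P.L
    initialState := none
    m := fun
      | none => .load (fun _ => none) .halt
      | some l => stmt (P.code l) }

/-- The internal state only transmits the label chosen by a `pop` to the `goto` of the same
statement. Its value between steps is irrelevant and left open. -/
theorem evals_run (P : StackProg) (k₀ k₁ : Reg) [Fintype k₀.Alph] {n : ℕ}
    {a b : Option P.L × Store} (h : Run P.code n a b) (v : Option P.L) :
    ∃ v', (flip bind (P.machine k₀ k₁).step)^[n] (some ⟨some a.1, v, a.2⟩) =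
      some ⟨some b.1, v', b.2⟩ := by
  induction h generalizing v with
  | refl a => exact ⟨v, rfl⟩
  | @push n l s c k a l' h hr ih =>
    obtain ⟨v', hv'⟩ := ih v
    refine ⟨v', ?_⟩
    rw [Function.iterate_succ_apply]
    refine Eq.trans (congrArg _ ?_) hv'
    change some (TM2.stepAux (stmt (P.code l)) v s) = _
    rw [h]; rfl
  | @pop n l s c k next h hr ih =>
    obtain ⟨v', hv'⟩ := ih (next (s k).head?)
    refine ⟨v', ?_⟩
    rw [Function.iterate_succ_apply]
    refine Eq.trans (congrArg _ ?_) hv'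
    change some (TM2.stepAux (stmt (P.code l)) v s) = _
    rw [h]; rfl

/-- The additional step is the exit, which resets the internal state to `none`, as `haltList`
demands. -/
theorem evals_exec (P : StackProg) (k₀ k₁ : Reg) [Fintype k₀.Alph] {n : ℕ} {s s' : Store}
    (h : P.Exec s s' n) :
    ∃ m ≤ n + 1, (flip bind (P.machine k₀ k₁).step)^[m] (some ⟨some P.start, none, s⟩) =
      some ⟨none, none, s'⟩ := by
  obtain ⟨m, hm, h⟩ := h
  obtain ⟨v, hv⟩ := evals_run P k₀ k₁ h none
  exact ⟨1 + m, by omega, iterate_trans hv rfl⟩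

/-- A program with polynomial running time computes a function in polynomial time. -/
theorem computable (P : StackProg) (k₀ k₁ : Reg) [Fintype k₀.Alph] {α β : Type}
    (ea : α → List k₀.Alph) (eb : β → List k₁.Alph) (f : α → β) (time : Polynomial ℕ)
    (h : ∀ a, P.Exec (Function.update (fun _ => []) k₀ (ea a))
      (Function.update (fun _ => []) k₁ (eb (f a))) (time.eval (ea a).length)) :
    Nonempty (TM2ComputableInPolyTime ea eb f) := by
  choose m hm he using fun a => evals_exec P k₀ k₁ (h a)
  refine ⟨⟨⟨P.machine k₀ k₁, Equiv.refl _, Equiv.refl _⟩, time + 1, fun a =>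
    ⟨⟨m a, ?_⟩, by simpa using hm a⟩⟩⟩
  have e₀ : (ea a).map (Equiv.refl k₀.Alph).invFun = ea a := List.map_id _
  have e₁ : (eb (f a)).map (Equiv.refl k₁.Alph).invFun = eb (f a) := List.map_id _
  refine (congrArg (fun w => (flip bind (P.machine k₀ k₁).step)^[m a]
    (some (initList (P.machine k₀ k₁) w))) e₀).trans ?_
  refine Eq.trans ?_ (congrArg (fun w => some (haltList (P.machine k₀ k₁) w)) e₁).symm
  refine Eq.trans (congrArg _ (congrArg some (Comp.initList_eq _ _))) ?_
  exact (he a).trans (congrArg some (Comp.haltList_eq (P.machine k₀ k₁) (eb (f a))).symm)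

end StackProg

/-! ### Polynomial-time functions on trees -/

/-- Binary trees, the universal data type for polynomial-time computations. -/
inductive BinTree where
  | nil
  | node (a b : BinTree)

namespace BinTree

/-- Polish notation with bits. -/
def enc : BinTree → List Bool
  | nil => [false]
  | node a b => true :: (a.enc ++ b.enc)

/-- The number of letters of the Polish notation. -/
def size : BinTree → ℕ
  | nil => 1
  | node a b => a.size + b.size + 1

theorem length_enc (a : BinTree) : a.enc.length = a.size := by
  induction a with
  | nil => rfl
  | node a b iha ihb => simp [enc, size, iha, ihb]

theorem size_pos (a : BinTree) : 0 < a.size := by cases a <;> simp [size]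

end BinTree

/-- The contents of the stacks as a list of its components. -/
def store (d : List DataLetter) (g : List FormulaLetter) (m l r c : List Bool) : Store
  | .data => d
  | .form => g
  | .main => m
  | .left => l
  | .right => r
  | .count => c

section

variable (d : List DataLetter) (g : List FormulaLetter) (m l r c u : List Bool)

theorem update_store_data (u : List DataLetter) :
    Function.update (store d g m l r c) .data u = store u g m l r c := by
  funext k; cases k <;> simp [store]

theorem update_store_form (u : List FormulaLetter) :
    Function.update (store d g m l r c) .form u = store d u m l r c := by
  funext k; cases k <;> simp [store]

theorem update_store_main :
    Function.update (store d g m l r c) .main u = store d g u l r c := by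
  funext k; cases k <;> simp [store]

theorem update_store_left :
    Function.update (store d g m l r c) .left u = store d g m u r c := by
  funext k; cases k <;> simp [store]

theorem update_store_right :
    Function.update (store d g m l r c) .right u = store d g m l u c := by
  funext k; cases k <;> simp [store]

theorem update_store_count :
    Function.update (store d g m l r c) .count u = store d g m l r u := by
  funext k; cases k <;> simp [store]

end

instance (k : Reg) : Finite k.Alph := by
  cases k <;> simp only [Reg.Alph] <;> infer_instance

/-! ### Rearranging trees on the main stack. -/

namespace StackProg

section

variable {d : List DataLetter} {g : List FormulaLetter} {m l r c : List Bool}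

theorem exec_push_main (a : Bool) :
    (push .main a).Exec (store d g m l r c) (store d g (a :: m) l r c) 1 := by
  have h := exec_push Reg.main a (store d g m l r c)
  rwa [update_store_main] at h

theorem exec_push_count (a : Bool) :
    (push .count a).Exec (store d g m l r c) (store d g m l r (a :: c)) 1 := by
  have h := exec_push Reg.count a (store d g m l r c)
  rwa [update_store_count] at h

/-- Push a letter if a condition is satisfied. -/
def pushIf (b : Bool) (k : Reg) (a : k.Alph) : StackProg := bif b then push k a else skip

theorem exec_pushIf_left (b a : Bool) : (pushIf b .left a).Exec (store d g m l r c)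
    (store d g m ((bif b then [a] else []) ++ l) r c) 1 := by
  cases b
  · exact (exec_skip _).mono zero_le_one
  · have h := exec_push Reg.left a (store d g m l r c)
    rwa [update_store_left] at h

theorem exec_pushIf_right (b a : Bool) : (pushIf b .right a).Exec (store d g m l r c)
    (store d g m l ((bif b then [a] else []) ++ r) c) 1 := by
  cases b
  · exact (exec_skip _).mono zero_le_one
  · have h := exec_push Reg.right a (store d g m l r c)
    rwa [update_store_right] at h

theorem Exec.pop_main {P : Option Bool → StackProg} {a : Bool} {s' : Store} {n : ℕ}
    (h : (P (some a)).Exec (store d g m l r c) s' n) :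
    (StackProg.pop .main P).Exec (store d g (a :: m) l r c) s' (n + 1) :=
  Exec.pop (k := Reg.main) (by rw [update_store_main]; exact h)

theorem Exec.loop_count {P : Bool → StackProg} {a : Bool} {s' s'' : Store} {n n' : ℕ}
    (h₁ : (P a).Exec (store d g m l r c) s' n) (h₂ : (StackProg.loop .count P).Exec s' s'' n') :
    (StackProg.loop .count P).Exec (store d g m l r (a :: c)) s'' (n + n' + 1) :=
  Exec.loop (k := Reg.count) (a := a) (u := c) rfl (by rw [update_store_count]; exact h₁) h₂

/-- The treatment of one letter when a tree is removed from the main stack. -/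
def pullCase (x y : Bool) : Option Bool → StackProg
  | none => skip
  | some false => (pushIf x .left false).seq (pushIf y .right false)
  | some true => (pushIf x .left true).seq <| (pushIf y .right true).seq <|
      (push .count true).seq (push .count true)

/-- The body of the loop that removes one tree from the main stack. -/
def pullBody (x y : Bool) : StackProg := pop .main (pullCase x y)

/-- Remove one tree from the main stack and copy it in reverse to the stacks `left` and `right`, if
so indicated. -/
def pull (x y : Bool) : StackProg :=
  (push .count true).seq (loop .count fun _ => pullBody x y)

/-- The stack `count` holds one letter for each tree still to be read: a leaf uses up one letter, a
node uses up one and adds two. The rest of the loop is a hypothesis, so that at a node the induction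
hypotheses for the two subtrees can be chained. -/
theorem exec_pull_loop (x y : Bool) (a : BinTree) {s' : Store} {n : ℕ}
    (h : (loop .count fun _ => pullBody x y).Exec
      (store d g m ((bif x then a.enc.reverse else []) ++ l)
        ((bif y then a.enc.reverse else []) ++ r) c) s' n) :
    (loop .count fun _ => pullBody x y).Exec (store d g (a.enc ++ m) l r (true :: c)) s'
      (n + 6 * a.size) := by
  induction a generalizing m l r c n with
  | nil =>
    have h₁ : (pullBody x y).Exec (store d g (false :: m) l r c) _ _ :=
      Exec.pop_main (P := pullCase x y) (a := false)
        ((exec_pushIf_left x false).seq (exec_pushIf_right y false))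
    exact (Exec.loop_count (P := fun _ => pullBody x y) (a := true) h₁ h).mono (by simp [BinTree.size]; omega)
  | node a b iha ihb =>
    have h₁ : (pullBody x y).Exec (store d g (true :: (a.enc ++ (b.enc ++ m))) l r c) _ _ :=
      Exec.pop_main (P := pullCase x y) (a := true) ((exec_pushIf_left x true).seq ((exec_pushIf_right y true).seq
        ((exec_push_count true).seq (exec_push_count true))))
    have h₂ : (bif x then (BinTree.node a b).enc.reverse else []) ++ l =
        (bif x then b.enc.reverse else []) ++ ((bif x then a.enc.reverse else []) ++
          ((bif x then [true] else []) ++ l)) := by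
      cases x <;> simp [BinTree.enc]
    have h₃ : (bif y then (BinTree.node a b).enc.reverse else []) ++ r =
        (bif y then b.enc.reverse else []) ++ ((bif y then a.enc.reverse else []) ++
          ((bif y then [true] else []) ++ r)) := by
      cases y <;> simp [BinTree.enc]
    rw [h₂, h₃] at h
    have := Exec.loop_count (P := fun _ => pullBody x y) (a := true) h₁ (iha (ihb h))
    simp only [BinTree.enc, List.cons_append, List.append_assoc]
    exact this.mono (by simp only [BinTree.size]; omega)

theorem exec_pull (x y : Bool) (a : BinTree) :
    (pull x y).Exec (store d g (a.enc ++ m) l r [])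
      (store d g m ((bif x then a.enc.reverse else []) ++ l)
        ((bif y then a.enc.reverse else []) ++ r) []) (6 * a.size + 2) :=
  ((exec_push_count true).seq (exec_pull_loop x y a (exec_loop_nil rfl))).mono (by omega)

/-- Move the contents of a stack to the main stack. -/
def restoreLeft : StackProg := loop .left fun a => push .main a

/-- Move the contents of a stack to the main stack. -/
def restoreRight : StackProg := loop .right fun a => push .main a

/-- This reversal undoes the one in `pull`. -/
theorem exec_restoreLeft : restoreLeft.Exec (store d g m l r c)
    (store d g (l.reverse ++ m) [] r c) (2 * l.length + 1) := by
  induction l generalizing m with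
  | nil => exact exec_loop_nil rfl
  | cons a l ih =>
    have := Exec.loop (k := Reg.left) (P := fun a => push .main a) (s := store d g m (a :: l) r c)
      rfl (by rw [update_store_left]; exact exec_push_main a) ih
    simp only [List.reverse_cons, List.append_assoc]
    exact this.mono (by simp; omega)

theorem exec_restoreRight : restoreRight.Exec (store d g m l r c)
    (store d g (r.reverse ++ m) l [] c) (2 * r.length + 1) := by
  induction r generalizing m with
  | nil => exact exec_loop_nil rfl
  | cons a r ih =>
    have := Exec.loop (k := Reg.right) (P := fun a => push .main a) (s := store d g m l (a :: r) c)
      rfl (by rw [update_store_right]; exact exec_push_main a) ih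
    simp only [List.reverse_cons, List.append_assoc]
    exact this.mono (by simp; omega)

/-- Duplicate the top tree. -/
def dup : StackProg := (pull true true).seq (restoreLeft.seq restoreRight)

theorem exec_dup (a : BinTree) : dup.Exec (store d g (a.enc ++ m) [] [] [])
    (store d g (a.enc ++ (a.enc ++ m)) [] [] []) (10 * a.size + 4) := by
  have h₁ := exec_pull (d := d) (g := g) (m := m) (l := []) (r := []) true true a
  have h₂ := exec_restoreLeft (d := d) (g := g) (m := m) (l := a.enc.reverse)
    (r := a.enc.reverse) (c := [])
  have h₃ := exec_restoreRight (d := d) (g := g) (m := a.enc ++ m) (l := [])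
    (r := a.enc.reverse) (c := [])
  simp only [cond_true, List.append_nil, List.reverse_reverse, List.length_reverse,
    BinTree.length_enc] at h₁ h₂ h₃
  exact (h₁.seq (h₂.seq h₃)).mono (by omega)

/-- Exchange the two top trees. -/
def swap : StackProg := (pull true false).seq ((pull false true).seq (restoreLeft.seq restoreRight))

theorem exec_swap (a b : BinTree) : swap.Exec (store d g (a.enc ++ (b.enc ++ m)) [] [] [])
    (store d g (b.enc ++ (a.enc ++ m)) [] [] []) (8 * a.size + 8 * b.size + 6) := by
  have h₁ := exec_pull (d := d) (g := g) (m := b.enc ++ m) (l := []) (r := []) true false a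
  have h₂ := exec_pull (d := d) (g := g) (m := m) (l := a.enc.reverse) (r := []) false true b
  have h₃ := exec_restoreLeft (d := d) (g := g) (m := m) (l := a.enc.reverse)
    (r := b.enc.reverse) (c := [])
  have h₄ := exec_restoreRight (d := d) (g := g) (m := a.enc ++ m) (l := [])
    (r := b.enc.reverse) (c := [])
  simp only [cond_true, cond_false, List.append_nil, List.nil_append, List.reverse_reverse,
    List.length_reverse, BinTree.length_enc] at h₁ h₂ h₃ h₄
  exact (h₁.seq (h₂.seq (h₃.seq h₄))).mono (by omega)

/-- Remove the top tree. -/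
def drop : StackProg := pull false false

theorem exec_drop (a : BinTree) : drop.Exec (store d g (a.enc ++ m) [] [] [])
    (store d g m [] [] []) (6 * a.size + 2) :=
  exec_pull false false a

/-- Remove the second tree. -/
def nip : StackProg := (pull true false).seq ((pull false false).seq restoreLeft)

theorem exec_nip (a b : BinTree) : nip.Exec (store d g (a.enc ++ (b.enc ++ m)) [] [] [])
    (store d g (a.enc ++ m) [] [] []) (8 * a.size + 6 * b.size + 5) := by
  have h₁ := exec_pull (d := d) (g := g) (m := b.enc ++ m) (l := []) (r := []) true false a
  have h₂ := exec_pull (d := d) (g := g) (m := m) (l := a.enc.reverse) (r := []) false false b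
  have h₃ := exec_restoreLeft (d := d) (g := g) (m := m) (l := a.enc.reverse) (r := []) (c := [])
  simp only [cond_true, cond_false, List.append_nil, List.nil_append, List.reverse_reverse,
    List.length_reverse, BinTree.length_enc] at h₁ h₂ h₃
  exact (h₁.seq (h₂.seq h₃)).mono (by omega)

/-- Push a word. -/
def pushWord : List Bool → StackProg
  | [] => skip
  | b :: w => (pushWord w).seq (push .main b)

theorem exec_pushWord (w : List Bool) : (pushWord w).Exec (store d g m l r c)
    (store d g (w ++ m) l r c) w.length := by
  induction w with
  | nil => exact exec_skip _
  | cons b w ih => exact ih.seq (exec_push_main b)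

end

/-- A step pushes at most one letter, so the running time bounds the growth of the result. Closure
of `PolyTime` under composition depends on this. -/
theorem _root_.Run.length_le {L : Type} {code : L → Instr (Option L)} {n : ℕ}
    {a b : Option L × Store} (h : Run code n a b) (k : Reg) :
    (b.2 k).length ≤ (a.2 k).length + n := by
  induction h with
  | refl a => simp
  | @push n l s c k' x l' h hr ih =>
    refine ih.trans ?_
    by_cases hk : k = k'
    · subst hk; simp only [Function.update_self, List.length_cons]; omega
    · simp only [Function.update_of_ne hk]; omega
  | @pop n l s c k' next h hr ih =>
    refine ih.trans ?_
    by_cases hk : k = k'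
    · subst hk; simp only [Function.update_self, List.length_tail]; omega
    · simp only [Function.update_of_ne hk]; omega

end StackProg

/-- Data types whose elements are represented by trees. -/
class TreeRepr (α : Type) where
  toTree : α → BinTree

/-- The size of the representation. -/
def tsize {α : Type} [TreeRepr α] (a : α) : ℕ := (TreeRepr.toTree a).size

theorem tsize_pos {α : Type} [TreeRepr α] (a : α) : 0 < tsize a := BinTree.size_pos _

/-- Functions that a structured program computes in polynomial time on representations, without
touching what is below the argument on the main stack. -/
@[fun_prop]
def PolyTime {α β : Type} [TreeRepr α] [TreeRepr β] (f : α → β) : Prop :=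
  ∃ (P : StackProg) (p : Polynomial ℕ), ∀ d g x m,
    P.Exec (store d g ((TreeRepr.toTree x).enc ++ m) [] [] [])
      (store d g ((TreeRepr.toTree (f x)).enc ++ m) [] [] []) (p.eval (tsize x))

namespace TreeRepr

instance : TreeRepr Unit := ⟨fun _ => .nil⟩

instance : TreeRepr Bool := ⟨fun b => bif b then .node .nil .nil else .nil⟩

/-- Unary representation. The numbers that programs compute with are indices, dimensions and
lengths, polynomial in the input length; binary numerals remain lists of letters. -/
instance : TreeRepr ℕ := ⟨fun n => n.rec .nil fun _ t => .node .nil t⟩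

instance {α β : Type} [TreeRepr α] [TreeRepr β] : TreeRepr (α × β) :=
  ⟨fun x => .node (toTree x.1) (toTree x.2)⟩

instance {α : Type} [TreeRepr α] : TreeRepr (List α) :=
  ⟨fun l => l.foldr (fun a t => .node (toTree a) t) .nil⟩

end TreeRepr

/-! ### Closure properties of polynomial-time functions on trees. -/

namespace PolyTime

open StackProg TreeRepr

variable {α β γ δ : Type} [TreeRepr α] [TreeRepr β] [TreeRepr γ] [TreeRepr δ]

theorem of_repr_eq {f : α → β} (h : ∀ x, toTree (f x) = toTree x) : PolyTime f :=
  ⟨skip, 0, fun d g x m => by rw [h]; exact (exec_skip _).mono (by simp)⟩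

@[fun_prop]
theorem id : PolyTime (fun x : α => x) := of_repr_eq fun _ => rfl

/-- The size of the values of a polynomial-time function. -/
theorem exists_tsize_le {f : α → β} (hf : PolyTime f) :
    ∃ p : Polynomial ℕ, ∀ x, tsize (f x) ≤ p.eval (tsize x) := by
  obtain ⟨P, p, h⟩ := hf
  refine ⟨Polynomial.X + p, fun x => ?_⟩
  obtain ⟨n, hn, hr⟩ := h [] [] x []
  have := hr.length_le .main
  simp only [store, List.append_nil, BinTree.length_enc] at this
  simp only [tsize, Polynomial.eval_add, Polynomial.eval_X] at hn ⊢
  omega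

@[fun_prop]
theorem comp {f : β → γ} {f' : α → β} (hf : PolyTime f) (hf' : PolyTime f') :
    PolyTime (fun x => f (f' x)) := by
  obtain ⟨q, hq⟩ := hf'.exists_tsize_le
  obtain ⟨P, p, h⟩ := hf
  obtain ⟨P', p', h'⟩ := hf'
  refine ⟨P'.seq P, p' + p.comp q, fun d g x m => ((h' d g x m).seq (h d g _ m)).mono ?_⟩
  have := p.eval_nat_mono (hq x)
  simp only [Polynomial.eval_add, Polynomial.eval_comp] at this ⊢
  omega

@[fun_prop]
theorem const (b : β) : PolyTime (fun _ : α => b) := by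
  refine ⟨drop.seq (pushWord (toTree b).enc), 6 * .X + .C (2 + (toTree b).enc.length),
    fun d g x m => ((exec_drop _).seq (exec_pushWord _)).mono ?_⟩
  simp [tsize]
  omega

@[fun_prop]
theorem prodMk {f : α → β} {f' : α → γ} (hf : PolyTime f) (hf' : PolyTime f') :
    PolyTime (fun x => (f x, f' x)) := by
  obtain ⟨q, hq⟩ := hf'.exists_tsize_le
  obtain ⟨P, p, h⟩ := hf
  obtain ⟨P', p', h'⟩ := hf'
  refine ⟨dup.seq (P'.seq (swap.seq (P.seq (push .main true)))),
    18 * .X + 11 + p + p' + 8 * q, fun d g x m => ?_⟩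
  have h₁ := exec_dup (d := d) (g := g) (m := m) (toTree x)
  have h₂ := h' d g x ((toTree x).enc ++ m)
  have h₃ := exec_swap (d := d) (g := g) (m := m) (toTree (f' x)) (toTree x)
  have h₄ := h d g x ((toTree (f' x)).enc ++ m)
  have h₅ := exec_push_main (d := d) (g := g) (m := (toTree (f x)).enc ++ ((toTree (f' x)).enc ++ m))
    (l := []) (r := []) (c := []) true
  have e₁ : true :: ((toTree (f x)).enc ++ ((toTree (f' x)).enc ++ m)) =
      (toTree (f x, f' x)).enc ++ m := by simp [toTree, BinTree.enc]
  rw [e₁] at h₅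
  refine (h₁.seq (h₂.seq (h₃.seq (h₄.seq h₅)))).mono ?_
  have := hq x
  simp only [tsize, Polynomial.eval_add, Polynomial.eval_mul, Polynomial.eval_ofNat,
    Polynomial.eval_X] at this ⊢
  omega

theorem fst' : PolyTime (fun x : α × β => x.1) := by
  refine ⟨(pop .main fun _ => skip).seq nip, 14 * .X + 6, fun d g x m => ?_⟩
  have h₁ : (pop .main fun _ => skip).Exec (store d g ((toTree x).enc ++ m) [] [] [])
      (store d g ((toTree x.1).enc ++ ((toTree x.2).enc ++ m)) [] [] []) (0 + 1) := by
    have e : (toTree x).enc ++ m = true :: ((toTree x.1).enc ++ ((toTree x.2).enc ++ m)) := by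
      simp [toTree, BinTree.enc]
    rw [e]
    exact Exec.pop_main (P := fun _ => skip) (exec_skip _)
  refine (h₁.seq (exec_nip _ _)).mono ?_
  simp only [tsize, toTree, BinTree.size, Polynomial.eval_add, Polynomial.eval_mul,
    Polynomial.eval_ofNat, Polynomial.eval_X]
  omega

theorem snd' : PolyTime (fun x : α × β => x.2) := by
  refine ⟨(pop .main fun _ => skip).seq drop, 14 * .X + 6, fun d g x m => ?_⟩
  have h₁ : (pop .main fun _ => skip).Exec (store d g ((toTree x).enc ++ m) [] [] [])
      (store d g ((toTree x.1).enc ++ ((toTree x.2).enc ++ m)) [] [] []) (0 + 1) := by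
    have e : (toTree x).enc ++ m = true :: ((toTree x.1).enc ++ ((toTree x.2).enc ++ m)) := by
      simp [toTree, BinTree.enc]
    rw [e]
    exact Exec.pop_main (P := fun _ => skip) (exec_skip _)
  refine (h₁.seq (exec_drop _)).mono ?_
  simp only [tsize, toTree, BinTree.size, Polynomial.eval_add, Polynomial.eval_mul,
    Polynomial.eval_ofNat, Polynomial.eval_X]
  omega

@[fun_prop]
theorem fst {f : α → β × γ} (hf : PolyTime f) : PolyTime (fun x => (f x).1) := fst'.comp hf

@[fun_prop]
theorem snd {f : α → β × γ} (hf : PolyTime f) : PolyTime (fun x => (f x).2) := snd'.comp hf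

/-- A program for case distinctions on lists. -/
def _root_.StackProg.listCase (P P' : StackProg) : Option Bool → StackProg
  | none => skip
  | some false => P
  | some true => (push .main true).seq (swap.seq ((push .main true).seq P'))

/-- A program for one step of an iteration. -/
def _root_.StackProg.iterCase (P : StackProg) : Option Bool → StackProg
  | none => skip
  | some false => (push .main false).seq (push .main true)
  | some true => (push .main true).seq ((push .main true).seq (P.seq (push .count true)))

/-- Case distinction on a list. -/
theorem list_casesOn' {f : γ → β} {f' : γ × α × List α → β} (hf : PolyTime f)
    (hf' : PolyTime f') :
    PolyTime (fun x : List α × γ => match x.1 with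
      | [] => f x.2
      | a :: t => f' (x.2, a, t)) := by
  obtain ⟨P, p, h⟩ := hf
  obtain ⟨P', p', h'⟩ := hf'
  refine ⟨pop .main fun _ => pop .main (listCase P P'),
    p + p'.comp .X + 16 * .X + 20, fun d g x m => ?_⟩
  obtain ⟨l, x⟩ := x
  cases l with
  | nil =>
    -- The first `pop` removes the root of the pair, the second one the root of the list, which
    -- tells the empty list from a nonempty one.
    have h₁ := Exec.pop_main (P := fun _ => pop .main (listCase P P')) (a := true)
        (Exec.pop_main (P := listCase P P') (a := false) (h d g x m))
    refine h₁.mono ?_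
    have : tsize x ≤ tsize (([] : List α), x) := by simp [tsize, toTree, BinTree.size]; omega
    have := p.eval_nat_mono this
    simp only [Polynomial.eval_add] at this ⊢
    simp
    omega
  | cons a t =>
    have h₁ := exec_push_main (d := d) (g := g)
      (m := (toTree a).enc ++ ((toTree t).enc ++ ((toTree x).enc ++ m))) (l := []) (r := []) (c := [])
      true
    have h₂ := exec_swap (d := d) (g := g) (m := m) (toTree (a, t)) (toTree x)
    have h₃ := exec_push_main (d := d) (g := g)
      (m := (toTree x).enc ++ ((toTree (a, t)).enc ++ m)) (l := []) (r := []) (c := []) true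
    have h₄ := h' d g (x, a, t) m
    have e₁ : true :: ((toTree a).enc ++ ((toTree t).enc ++ ((toTree x).enc ++ m))) =
        (toTree (a, t)).enc ++ ((toTree x).enc ++ m) := by simp [toTree, BinTree.enc]
    have e₂ : true :: ((toTree x).enc ++ ((toTree (a, t)).enc ++ m)) =
        (toTree (x, a, t)).enc ++ m := by simp [toTree, BinTree.enc]
    have e₃ : (toTree (a :: t, x)).enc ++ m = true :: true ::
        ((toTree a).enc ++ ((toTree t).enc ++ ((toTree x).enc ++ m))) := by simp [toTree, BinTree.enc]
    rw [e₁] at h₁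
    rw [e₂] at h₃
    have h₅ := Exec.pop_main (P := fun _ => pop .main (listCase P P')) (a := true)
        (Exec.pop_main (P := listCase P P') (a := true) (h₁.seq (h₂.seq (h₃.seq h₄))))
    rw [e₃]
    refine h₅.mono ?_
    have : tsize (x, a, t) = tsize (a :: t, x) := by simp [tsize, toTree, BinTree.size]; omega
    rw [this]
    simp only [Polynomial.eval_add, tsize, toTree, BinTree.size, List.foldr]
    simp
    omega

/-- Iteration while the first component is not empty. -/
theorem iterate {f : List α × β → List α × β} {i : γ → List α × β} (hf : PolyTime f)
    (hi : PolyTime i) (n : γ → ℕ) (hn : ∀ c, (f^[n c] (i c)).1 = [])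
    (hn' : ∀ c, ∀ j < n c, (f^[j] (i c)).1 ≠ [])
    (q : Polynomial ℕ) (hq : ∀ c, n c ≤ q.eval (tsize c))
    (hq' : ∀ c, ∀ j ≤ n c, tsize (f^[j] (i c)) ≤ q.eval (tsize c)) :
    PolyTime (fun c => f^[n c] (i c)) := by
  obtain ⟨I, pi, hi⟩ := hi
  obtain ⟨P, p, h⟩ := hf
  let B : Bool → StackProg := fun _ => pop .main fun _ => pop .main (iterCase P)
  -- A letter on `count` asks for another round. The body inspects the list: if it is empty, the two
  -- letters read are put back and `count` stays empty; otherwise `P` is executed and the request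
  -- renewed. `K` bounds the cost of `P` in a round.
  have key : ∀ (d : List DataLetter) (g : List FormulaLetter) (m : List Bool) (K : ℕ)
      (k : ℕ) (x : List α × β), (f^[k] x).1 = [] → (∀ i < k, (f^[i] x).1 ≠ []) →
      (∀ i < k, p.eval (tsize (f^[i] x)) ≤ K) →
      (loop .count B).Exec (store d g ((toTree x).enc ++ m) [] [] [true])
        (store d g ((toTree (f^[k] x)).enc ++ m) [] [] []) (6 + k * (K + 6)) := by
    intro d g m K k
    induction k with
    | zero =>
      rintro ⟨l, x⟩ h₁ - -
      obtain rfl : l = [] := h₁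
      have e₁ : (B true).Exec (store d g ((toTree (([] : List α), x)).enc ++ m) [] [] [])
          (store d g ((toTree (([] : List α), x)).enc ++ m) [] [] []) _ :=
        Exec.pop_main (P := fun _ => pop .main (iterCase P)) (a := true)
          (Exec.pop_main (P := iterCase P) (a := false)
          ((exec_push_main false).seq (exec_push_main true)))
      exact (Exec.loop_count e₁ (exec_loop_nil rfl)).mono (by omega)
    | succ k ih =>
      rintro ⟨l, x⟩ h₁ h₂ h₃
      cases l with
      | nil => exact absurd rfl (h₂ 0 (by omega))
      | cons a t =>
        have e₁ : (B true).Exec (store d g ((toTree (a :: t, x)).enc ++ m) [] [] [])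
            (store d g ((toTree (f (a :: t, x))).enc ++ m) [] [] [true]) _ :=
          Exec.pop_main (P := fun _ => pop .main (iterCase P)) (a := true)
          (Exec.pop_main (P := iterCase P) (a := true)
            ((exec_push_main true).seq ((exec_push_main true).seq
              ((h d g (a :: t, x) m).seq (exec_push_count true)))))
        have e₂ := ih (f (a :: t, x)) h₁ (fun i hi => h₂ (i + 1) (by omega))
          (fun i hi => h₃ (i + 1) (by omega))
        have e₃ := h₃ 0 (by omega)
        rw [Function.iterate_zero_apply] at e₃
        refine (Exec.loop_count e₁ e₂).mono ?_
        have : (k + 1) * (K + 6) = k * (K + 6) + (K + 6) := by ring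
        omega
  refine ⟨I.seq ((push .count true).seq (loop .count B)), pi + (7 + q * (p.comp q + 6)),
    fun d g c m => ?_⟩
  have h₁ := key d g m ((p.comp q).eval (tsize c)) (n c) (i c) (hn c) (hn' c) (fun j hj => by
    rw [Polynomial.eval_comp]
    exact p.eval_nat_mono (hq' c j hj.le))
  refine ((hi d g c m).seq ((exec_push_count true).seq h₁)).mono ?_
  have := Nat.mul_le_mul_right ((p.comp q).eval (tsize c) + 6) (hq c)
  simp only [Polynomial.eval_add, Polynomial.eval_mul, Polynomial.eval_ofNat]
  omega

end PolyTime

/-! ### A library of polynomial-time functions -/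

open TreeRepr in
/-- The letters of the two alphabets are represented by their positions. -/
instance : TreeRepr DataLetter :=
  ⟨fun a => toTree ([DataLetter.stroke, .bit0, .bit1, .minus, .sep].idxOf a)⟩

open TreeRepr in
instance : TreeRepr FormulaLetter :=
  ⟨fun a => toTree ([FormulaLetter.stroke, .x, .zero, .one, .neg, .add, .mul, .eq, .lt, .le, .not,
    .and, .or].idxOf a)⟩

instance : TreeRepr BinTree := ⟨fun a => a⟩

section tsize

open TreeRepr

variable {α β : Type} [TreeRepr α] [TreeRepr β]

@[simp] theorem tsize_prod (x : α × β) : tsize x = tsize x.1 + tsize x.2 + 1 := rfl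

@[simp] theorem tsize_nil : tsize ([] : List α) = 1 := rfl

@[simp] theorem tsize_cons (a : α) (l : List α) : tsize (a :: l) = tsize a + tsize l + 1 := rfl

@[simp] theorem tsize_nat (n : ℕ) : tsize n = 2 * n + 1 := by
  induction n with
  | zero => rfl
  | succ n ih =>
    have : tsize (n + 1) = 1 + tsize n + 1 := rfl
    omega

theorem tsize_append (l l' : List α) : tsize (l ++ l') + 1 = tsize l + tsize l' := by
  induction l with
  | nil => simp; ring
  | cons a l ih => simp only [List.cons_append, tsize_cons]; omega

@[simp] theorem tsize_reverse (l : List α) : tsize l.reverse = tsize l := by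
  induction l with
  | nil => rfl
  | cons a l ih =>
    have := tsize_append l.reverse [a]
    simp only [List.reverse_cons, tsize_cons, tsize_nil] at this ⊢
    omega

theorem tsize_le_of_mem {a : α} {l : List α} (h : a ∈ l) : tsize a ≤ tsize l := by
  induction l with
  | nil => simp at h
  | cons b l ih =>
    rcases List.mem_cons.1 h with rfl | h
    · simp only [tsize_cons]; omega
    · have := ih h; simp only [tsize_cons]; omega

theorem tsize_le_of_prefix {l l' : List α} (h : l <+: l') : tsize l ≤ tsize l' := by
  obtain ⟨t, rfl⟩ := h
  have := tsize_append l t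
  have := tsize_pos t
  omega

theorem length_le_tsize (l : List α) : l.length ≤ tsize l := by
  induction l with
  | nil => simp
  | cons a l ih => simp only [List.length_cons, tsize_cons]; omega

theorem tsize_le_of_forall {l : List α} {B : ℕ} (h : ∀ a ∈ l, tsize a ≤ B) :
    tsize l ≤ l.length * (B + 1) + 1 := by
  induction l with
  | nil => simp
  | cons a l ih =>
    have h₁ := ih fun b hb => h b (List.mem_cons_of_mem _ hb)
    have h₂ := h a List.mem_cons_self
    have : (l.length + 1) * (B + 1) = l.length * (B + 1) + (B + 1) := by ring
    simp only [List.length_cons, tsize_cons]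
    omega

end tsize

/-! ### Lists, unary arithmetic and functions on finite types. -/

namespace PolyTime

open TreeRepr StackProg

variable {α β γ σ : Type} [TreeRepr α] [TreeRepr β] [TreeRepr γ] [TreeRepr σ]

/-- `PolyTime` depends on trees only, so types with equal representations are interchangeable: a
number and a list of units, a pair and a nonempty list, a Boolean and a list of at most one unit. -/
theorem of_toTree_eq {f : γ → α} {g : γ → β} (hf : PolyTime f)
    (h : ∀ x, toTree (g x) = toTree (f x)) : PolyTime g := by
  obtain ⟨P, p, hP⟩ := hf
  exact ⟨P, p, fun d g x m => by rw [h]; exact hP d g x m⟩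

@[fun_prop]
theorem list_cons {f : γ → α} {g : γ → List α} (hf : PolyTime f) (hg : PolyTime g) :
    PolyTime (fun c => f c :: g c) :=
  of_toTree_eq (hf.prodMk hg) fun _ => rfl

theorem list_casesOn {l : γ → List α} {f : γ → β} {g : γ → α → List α → β} (hl : PolyTime l)
    (hf : PolyTime f) (hg : PolyTime (fun p : γ × α × List α => g p.1 p.2.1 p.2.2)) :
    PolyTime (fun c => match l c with
      | [] => f c
      | a :: t => g c a t) :=
  (list_casesOn' hf hg).comp (hl.prodMk id)

@[fun_prop]
theorem list_tail {l : γ → List α} (hl : PolyTime l) : PolyTime (fun c => (l c).tail) := by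
  have := list_casesOn (f := fun _ => ([] : List α)) (g := fun _ _ t => t) hl (by fun_prop)
    (by fun_prop)
  refine of_toTree_eq this fun c => ?_
  cases l c <;> rfl

@[fun_prop]
theorem list_headD {l : γ → List α} {f : γ → α} (hl : PolyTime l) (hf : PolyTime f) :
    PolyTime (fun c => (l c).headD (f c)) := by
  have := list_casesOn (f := f) (g := fun _ a _ => a) hl hf (by fun_prop)
  refine of_toTree_eq this fun c => ?_
  cases l c <;> rfl

@[fun_prop]
theorem cond {b : γ → Bool} {f g : γ → β} (hb : PolyTime b) (hf : PolyTime f) (hg : PolyTime g) :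
    PolyTime (fun c => bif b c then f c else g c) := by
  have hl : PolyTime (fun c => bif b c then [()] else []) :=
    of_toTree_eq hb fun c => by cases b c <;> rfl
  have := list_casesOn (f := g) (g := fun c _ _ => f c) hl hg (by fun_prop)
  refine of_toTree_eq this fun c => ?_
  cases b c <;> rfl

@[fun_prop]
theorem and {b b' : γ → Bool} (hb : PolyTime b) (hb' : PolyTime b') :
    PolyTime (fun c => b c && b' c) := by
  have : (fun c => b c && b' c) = fun c => bif b c then b' c else false := by
    funext c; cases b c <;> rfl
  rw [this]; fun_prop

/-- Iteration over a list. -/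
theorem list_foldl {l : γ → List α} {step : γ → σ → α → σ} {init : γ → σ} (hl : PolyTime l)
    (hs : PolyTime (fun p : γ × σ × α => step p.1 p.2.1 p.2.2)) (hi : PolyTime init)
    (q : Polynomial ℕ)
    (hq : ∀ c l', l' <+: l c → tsize (l'.foldl (step c) (init c)) ≤ q.eval (tsize c)) :
    PolyTime (fun c => (l c).foldl (step c) (init c)) := by
  let F : List α × γ × σ → List α × γ × σ := fun x => match x.1 with
    | [] => ([], x.2)
    | a :: t => (t, x.2.1, step x.2.1 x.2.2 a)
  have hF : PolyTime F :=
    list_casesOn (f := fun x : List α × γ × σ => (([], x.2) : List α × γ × σ))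
      (g := fun x a t => (t, x.2.1, step x.2.1 x.2.2 a)) (by fun_prop) (by fun_prop)
      ((show PolyTime (fun p : (List α × γ × σ) × α × List α => p.2.2) by fun_prop).prodMk
        ((show PolyTime (fun p : (List α × γ × σ) × α × List α => p.1.2.1) by fun_prop).prodMk
          (hs.comp (show PolyTime (fun p : (List α × γ × σ) × α × List α =>
            (p.1.2.1, p.1.2.2, p.2.1)) by fun_prop))))
  have key : ∀ (c : γ) (l₁ l₂ : List α) (s : σ),
      F^[l₁.length] (l₁ ++ l₂, c, s) = (l₂, c, l₁.foldl (step c) s) := by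
    intro c l₁ l₂
    induction l₁ with
    | nil => intro s; rfl
    | cons a l₁ ih =>
      intro s
      rw [List.length_cons, Function.iterate_succ_apply]
      exact ih _
  -- Every intermediate accumulator is the fold over a prefix, which is why a size bound on prefixes
  -- is the right hypothesis.
  have key' : ∀ c, ∀ j ≤ (l c).length, F^[j] (l c, c, init c) =
      ((l c).drop j, c, ((l c).take j).foldl (step c) (init c)) := by
    intro c j hj
    have := key c ((l c).take j) ((l c).drop j) (init c)
    rwa [List.take_append_drop, List.length_take, min_eq_left hj] at this
  obtain ⟨ql, hql⟩ := hl.exists_tsize_le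
  have := iterate (i := fun c => (l c, c, init c)) hF (by fun_prop) (fun c => (l c).length)
    (fun c => by rw [key' c _ le_rfl]; simp)
    (fun c j hj => by rw [key' c _ hj.le]; simpa using hj) (ql + .X + q + 2)
    (fun c => ((length_le_tsize _).trans (hql c)).trans (by simp; omega))
    (fun c j hj => by
      rw [key' c _ hj]
      have h₁ := hq c _ (List.take_prefix j (l c))
      have h₂ : tsize ((l c).drop j) ≤ tsize (l c) := by
        have := tsize_append ((l c).take j) ((l c).drop j)
        rw [List.take_append_drop] at this
        have := tsize_pos ((l c).take j)
        omega
      have h₃ := hql c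
      simp only [tsize_prod, Polynomial.eval_add, Polynomial.eval_X, Polynomial.eval_ofNat]
      omega)
  refine of_toTree_eq this.snd.snd fun c => ?_
  rw [key' c _ le_rfl, List.take_length]

@[fun_prop]
theorem list_reverse {l : γ → List α} (hl : PolyTime l) : PolyTime (fun c => (l c).reverse) := by
  obtain ⟨q, hq⟩ := hl.exists_tsize_le
  have h₀ : ∀ (l l' : List α), l.foldl (fun s a => a :: s) l' = l.reverse ++ l' := by
    intro l
    induction l with
    | nil => intro l'; rfl
    | cons a l ih => intro l'; simp [ih]
  have := list_foldl (step := fun _ s a => a :: s) (init := fun _ => []) hl (by fun_prop)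
    (by fun_prop) q (fun c l' hl' => by
      rw [h₀, List.append_nil, tsize_reverse]
      exact (tsize_le_of_prefix hl').trans (hq c))
  refine of_toTree_eq this fun c => ?_
  rw [h₀, List.append_nil]

@[fun_prop]
theorem list_append {l l' : γ → List α} (hl : PolyTime l) (hl' : PolyTime l') :
    PolyTime (fun c => l c ++ l' c) := by
  obtain ⟨q, hq⟩ := hl.exists_tsize_le
  obtain ⟨q', hq'⟩ := hl'.exists_tsize_le
  have h₀ : ∀ (l l' : List α), l.foldl (fun s a => a :: s) l' = l.reverse ++ l' := by
    intro l
    induction l with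
    | nil => intro l'; rfl
    | cons a l ih => intro l'; simp [ih]
  have := list_foldl (step := fun _ s a => a :: s) (init := l') (hl.list_reverse) (by fun_prop)
    hl' (q + q') (fun c l₁ hl₁ => by
      rw [h₀]
      have h₁ := tsize_append l₁.reverse (l' c)
      have h₂ := tsize_le_of_prefix hl₁
      have h₃ := hq c
      have h₄ := hq' c
      rw [tsize_reverse] at h₁ h₂
      simp only [Polynomial.eval_add]
      omega)
  refine of_toTree_eq this fun c => ?_
  rw [h₀, List.reverse_reverse]

@[fun_prop]
theorem list_flatMap {l : γ → List α} {g : γ → α → List β} (hl : PolyTime l)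
    (hg : PolyTime (fun p : γ × α => g p.1 p.2)) :
    PolyTime (fun c => (l c).flatMap (g c)) := by
  obtain ⟨q, hq⟩ := hl.exists_tsize_le
  obtain ⟨r, hr⟩ := hg.exists_tsize_le
  have h₀ : ∀ (c : γ) (l : List α) (s : List β),
      l.foldl (fun s a => s ++ g c a) s = s ++ l.flatMap (g c) := by
    intro c l
    induction l with
    | nil => intro s; simp
    | cons a l ih => intro s; simp [ih]
  have h₁ : ∀ (c : γ) (B : ℕ) (l : List α), (∀ a ∈ l, tsize (g c a) ≤ B) →
      tsize (l.flatMap (g c)) ≤ 1 + l.length * B := by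
    intro c B l
    induction l with
    | nil => simp
    | cons a l ih =>
      intro h
      have h₁ := ih fun b hb => h b (List.mem_cons_of_mem _ hb)
      have h₂ := h a List.mem_cons_self
      have h₃ := tsize_append (g c a) (l.flatMap (g c))
      have : (l.length + 1) * B = l.length * B + B := by ring
      rw [List.flatMap_cons, List.length_cons]
      omega
  have := list_foldl (step := fun c s a => s ++ g c a) (init := fun _ => []) hl
    ((show PolyTime (fun p : γ × List β × α => p.2.1) by fun_prop).list_append
      (hg.comp (show PolyTime (fun p : γ × List β × α => (p.1, p.2.2)) by fun_prop)))
    (by fun_prop) (1 + q * r.comp (.X + q + 1)) (fun c l' hl' => by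
      rw [h₀, List.nil_append]
      have h₂ := h₁ c (r.eval (tsize c + q.eval (tsize c) + 1)) l' (fun a ha => by
        refine (hr (c, a)).trans (r.eval_nat_mono ?_)
        have := tsize_le_of_mem (hl'.subset ha)
        have := hq c
        simp only [tsize_prod]
        omega)
      have h₃ : l'.length ≤ q.eval (tsize c) :=
        (length_le_tsize _).trans ((tsize_le_of_prefix hl').trans (hq c))
      have := Nat.mul_le_mul_right (r.eval (tsize c + q.eval (tsize c) + 1)) h₃
      simp only [Polynomial.eval_add, Polynomial.eval_mul, Polynomial.eval_comp,
        Polynomial.eval_X, Polynomial.eval_one]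
      omega)
  refine of_toTree_eq this fun c => ?_
  rw [h₀, List.nil_append]

@[fun_prop]
theorem list_map {l : γ → List α} {g : γ → α → β} (hl : PolyTime l)
    (hg : PolyTime (fun p : γ × α => g p.1 p.2)) :
    PolyTime (fun c => (l c).map (g c)) := by
  have := list_flatMap (g := fun c a => [g c a]) hl (by fun_prop)
  refine of_toTree_eq this fun c => ?_
  rw [← List.map_eq_flatMap]

theorem toTree_nat (n : ℕ) : toTree n = toTree (List.replicate n ()) := by
  induction n with
  | zero => rfl
  | succ n ih =>
    exact congrArg (BinTree.node .nil) ih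

@[fun_prop]
theorem units {n : γ → ℕ} (hn : PolyTime n) : PolyTime (fun c => List.replicate (n c) ()) :=
  of_toTree_eq hn fun _ => (toTree_nat _).symm

@[fun_prop]
theorem list_length {l : γ → List α} (hl : PolyTime l) : PolyTime (fun c => (l c).length) := by
  have := list_map (g := fun _ _ => ()) hl (by fun_prop)
  refine of_toTree_eq this fun c => ?_
  rw [toTree_nat]
  simp

@[fun_prop]
theorem list_replicate {n : γ → ℕ} {f : γ → α} (hn : PolyTime n) (hf : PolyTime f) :
    PolyTime (fun c => List.replicate (n c) (f c)) := by
  have := list_map (l := fun c => List.replicate (n c) ()) (g := fun c _ => f c) (by fun_prop)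
    (by fun_prop)
  refine of_toTree_eq this fun c => ?_
  simp

@[fun_prop]
theorem add {m n : γ → ℕ} (hm : PolyTime m) (hn : PolyTime n) :
    PolyTime (fun c => m c + n c) := by
  have : PolyTime (fun c => (List.replicate (m c) () ++ List.replicate (n c) ()).length) := by
    fun_prop
  simpa using this

@[fun_prop]
theorem mul {m n : γ → ℕ} (hm : PolyTime m) (hn : PolyTime n) :
    PolyTime (fun c => m c * n c) := by
  have : PolyTime (fun c => ((List.replicate (m c) ()).flatMap
      fun _ => List.replicate (n c) ()).length) := by
    fun_prop
  simpa using this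

@[fun_prop]
theorem list_drop {n : γ → ℕ} {l : γ → List α} (hn : PolyTime n) (hl : PolyTime l) :
    PolyTime (fun c => (l c).drop (n c)) := by
  obtain ⟨q, hq⟩ := hl.exists_tsize_le
  have h₀ : ∀ (u : List Unit) (l : List α),
      u.foldl (fun s _ => s.tail) l = l.drop u.length := by
    intro u
    induction u with
    | nil => intro l; rfl
    | cons a u ih => intro l; simp [ih, List.drop_tail]
  have := list_foldl (l := fun c => List.replicate (n c) ()) (step := fun _ s _ => s.tail)
    (init := l) (by fun_prop) (by fun_prop) hl q (fun c u _ => by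
      rw [h₀]
      refine le_trans ?_ (hq c)
      have := tsize_append ((l c).take u.length) ((l c).drop u.length)
      rw [List.take_append_drop] at this
      have := tsize_pos ((l c).take u.length)
      omega)
  refine of_toTree_eq this fun c => ?_
  rw [h₀, List.length_replicate]

@[fun_prop]
theorem list_getD {n : γ → ℕ} {l : γ → List α} {f : γ → α} (hn : PolyTime n) (hl : PolyTime l)
    (hf : PolyTime f) : PolyTime (fun c => (l c).getD (n c) (f c)) := by
  have : PolyTime (fun c => ((l c).drop (n c)).headD (f c)) := by fun_prop
  refine of_toTree_eq this fun c => ?_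
  simp [List.head?_drop]

@[fun_prop]
theorem sub {m n : γ → ℕ} (hm : PolyTime m) (hn : PolyTime n) :
    PolyTime (fun c => m c - n c) := by
  have : PolyTime (fun c => ((List.replicate (m c) ()).drop (n c)).length) := by fun_prop
  simpa using this

@[fun_prop]
theorem decide_eq {m n : γ → ℕ} (hm : PolyTime m) (hn : PolyTime n) :
    PolyTime (fun c => decide (m c = n c)) := by
  -- With truncated subtraction, `(m - n) + (n - m)` vanishes exactly if `m = n`.
  have := list_casesOn (l := fun c => List.replicate (m c - n c + (n c - m c)) ())
    (f := fun _ => true) (g := fun _ _ _ => false) (by fun_prop) (by fun_prop) (by fun_prop)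
  refine of_toTree_eq this fun c => ?_
  by_cases h : m c = n c
  · simp [h]
  · obtain ⟨k, hk⟩ : ∃ k, m c - n c + (n c - m c) = k + 1 := ⟨_, (Nat.succ_pred (by omega)).symm⟩
    simp only [hk, List.replicate_succ, h, decide_false]

@[fun_prop]
theorem list_range {n : γ → ℕ} (hn : PolyTime n) : PolyTime (fun c => List.range (n c)) := by
  obtain ⟨q, hq⟩ := hn.exists_tsize_le
  have h₀ : ∀ (u : List Unit),
      u.foldl (fun s _ => s ++ [s.length]) [] = List.range u.length := by
    intro u
    induction u using List.reverseRecOn with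
    | nil => rfl
    | append_singleton u a ih => simp [ih, List.range_succ]
  have := list_foldl (l := fun c => List.replicate (n c) ())
    (step := fun _ s _ => s ++ [s.length]) (init := fun _ => []) (by fun_prop) (by fun_prop)
    (by fun_prop) (q * (q + 1) + 1) (fun c u hu => by
      rw [h₀]
      have h₁ : u.length ≤ n c := by simpa using hu.length_le
      have h₂ := hq c
      rw [tsize_nat] at h₂
      refine (tsize_le_of_forall (B := q.eval (tsize c)) fun a ha => ?_).trans ?_
      · rw [List.mem_range] at ha
        rw [tsize_nat]
        omega
      · rw [List.length_range]
        have := Nat.mul_le_mul_right (q.eval (tsize c) + 1)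
          (show u.length ≤ q.eval (tsize c) by omega)
        simp only [Polynomial.eval_add, Polynomial.eval_mul, Polynomial.eval_one]
        omega)
  refine of_toTree_eq this fun c => ?_
  rw [h₀, List.length_replicate]

/-- The recursion is over the fixed tree `t`, hence yields one finite program. `L` and `M` pass from
a tree to the list of left subtrees along its right spine and back; on representations both are the
identity, and they let the case distinction on lists take a tree apart. -/
theorem decide_tree_eq (t : BinTree) : ∃ f : BinTree → Bool, PolyTime f ∧
    ∀ x, f x = true ↔ x = t := by
  let L : BinTree → List BinTree := fun x => x.rec [] fun a _ _ l => a :: l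
  have hL : PolyTime L := of_toTree_eq id fun x => by
    induction x with
    | nil => rfl
    | node a b iha ihb => exact congrArg (BinTree.node a) ihb
  let M : List BinTree → BinTree := fun l => l.foldr BinTree.node .nil
  have hM : PolyTime M := of_toTree_eq id fun _ => rfl
  have hLM : ∀ x, M (L x) = x := by
    intro x
    induction x with
    | nil => rfl
    | node a b iha ihb => exact congrArg (BinTree.node a) ihb
  induction t with
  | nil =>
    refine ⟨fun x => match L x with
      | [] => true
      | _ :: _ => false, (list_casesOn (f := fun _ => true) (g := fun _ _ _ => false) hL (by fun_prop)
        (by fun_prop)).of_toTree_eq fun x => by cases L x <;> rfl, fun x => ?_⟩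
    cases x <;> simp [L]
  | node a b iha ihb =>
    obtain ⟨f, hf, hf'⟩ := iha
    obtain ⟨g, hg, hg'⟩ := ihb
    refine ⟨fun x => match L x with
      | [] => false
      | u :: v => f u && g (M v), (list_casesOn (f := fun _ => false) (g := fun _ u v => f u && g (M v)) hL
        (by fun_prop) (by fun_prop)).of_toTree_eq fun x => by cases L x <;> rfl, fun x => ?_⟩
    cases x with
    | nil => simp [L]
    | node c d =>
      have : M (L d) = d := hLM d
      change (f c && g (M (L d))) = true ↔ _
      rw [this]
      simp [hf', hg']

/-- Functions on a finite type. -/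
theorem of_finite [Finite α] (h : Function.Injective (toTree : α → BinTree)) (f : α → β) :
    PolyTime f := by
  have key : ∀ l : List α, ∃ g : α → β, PolyTime g ∧ ∀ a ∈ l, g a = f a := by
    intro l
    induction l with
    | nil =>
      rcases isEmpty_or_nonempty α with h₀ | ⟨⟨a⟩⟩
      · refine ⟨f, ⟨skip, 0, fun d g x => isEmptyElim x⟩, fun _ _ => rfl⟩
      · exact ⟨fun _ => f a, const _, by simp⟩
    | cons a l ih =>
      obtain ⟨g, hg, hg'⟩ := ih
      obtain ⟨e, he, he'⟩ := decide_tree_eq (toTree a)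
      have ht : PolyTime (fun x : α => toTree x) := of_toTree_eq id fun _ => rfl
      refine ⟨fun x => bif e (toTree x) then f a else g x, by fun_prop, fun b hb => ?_⟩
      dsimp only
      by_cases hba : b = a
      · rw [(he' _).2 (congrArg _ hba), hba]; rfl
      · have : e (toTree b) = false := by
          rw [← Bool.not_eq_true, he']
          exact fun h' => hba (h h')
        rw [this]
        exact hg' b ((List.mem_cons.1 hb).resolve_left hba)
  have := Fintype.ofFinite α
  obtain ⟨g, hg, hg'⟩ := key (Finset.univ : Finset α).toList
  have : f = g := funext fun a => (hg' a (by simp)).symm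
  rwa [this]

theorem toTree_nat_injective : Function.Injective (toTree : ℕ → BinTree) := by
  intro m n h
  have h₁ := tsize_nat m
  have h₂ := tsize_nat n
  have : tsize m = tsize n := congrArg BinTree.size h
  omega

@[fun_prop]
theorem dataLetter (f : DataLetter → β) {g : γ → DataLetter} (hg : PolyTime g) :
    PolyTime (fun c => f (g c)) :=
  (of_finite (fun a b h => by
    have := toTree_nat_injective h
    revert this
    cases a <;> cases b <;> decide) f).comp hg

@[fun_prop]
theorem formulaLetter (f : FormulaLetter → β) {g : γ → FormulaLetter} (hg : PolyTime g) :
    PolyTime (fun c => f (g c)) :=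
  (of_finite (fun a b h => by
    have := toTree_nat_injective h
    revert this
    cases a <;> cases b <;> decide) f).comp hg

end PolyTime

/-! ### From tree computations to Turing machines -/

/-- A stack that serves for input or output. -/
def Reg.IsPort (k : Reg) : Prop := k = .data ∨ k = .form

/-- The store in which only the stacks `main`, `count` and an input or output stack are
nonempty. -/
def portStore (k : Reg) (w : List k.Alph) (m c : List Bool) : Store :=
  Function.update (store [] [] m [] [] c) k w

section

variable {k : Reg} (w w' : List k.Alph) (m c m' : List Bool)

theorem portStore_port : portStore k w m c k = w := Function.update_self _ _ _

theorem portStore_main (hk : k.IsPort) : portStore k w m c .main = m := by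
  rcases hk with rfl | rfl <;> rfl

theorem portStore_count (hk : k.IsPort) : portStore k w m c .count = c := by
  rcases hk with rfl | rfl <;> rfl

theorem update_portStore_port :
    Function.update (portStore k w m c) k w' = portStore k w' m c :=
  Function.update_idem _ _ _

theorem update_portStore_main (hk : k.IsPort) :
    Function.update (portStore k w m c) .main m' = portStore k w m' c := by
  rcases hk with rfl | rfl <;> rw [portStore, Function.update_comm (by simp), update_store_main] <;>
    rfl

theorem update_portStore_count (hk : k.IsPort) :
    Function.update (portStore k w m c) .count m' = portStore k w m m' := by
  rcases hk with rfl | rfl <;>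
    rw [portStore, Function.update_comm (by simp), update_store_count] <;> rfl

end

/-! ### Reading and writing words. -/

namespace StackProg

open TreeRepr

variable {k : Reg} {w : List k.Alph} {m c : List Bool}

theorem exec_pushWord_portStore (hk : k.IsPort) (u : List Bool) : (pushWord u).Exec (portStore k w m c)
    (portStore k w (u ++ m) c) u.length := by
  induction u with
  | nil => exact exec_skip _
  | cons b u ih =>
    refine ih.seq ?_
    have := exec_push .main b (portStore k w (u ++ m) c)
    rwa [update_portStore_main _ _ _ _ hk, portStore_main _ _ _ hk] at this

theorem exec_pop_portStore (hk : k.IsPort) {P : Option Bool → StackProg} {b : Bool} {s : Store} {n : ℕ}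
    (h : (P (some b)).Exec (portStore k w m c) s n) :
    (pop .main P).Exec (portStore k w (b :: m) c) s (n + 1) :=
  Exec.pop (k := Reg.main) (by
    rw [update_portStore_main _ _ _ _ hk, portStore_main _ _ _ hk]; exact h)

/-- Turn a stack into the reversed list, as a tree. -/
def read (k : Reg) [TreeRepr k.Alph] : StackProg :=
  (pushWord [false]).seq (loop k fun a => pushWord (true :: (toTree a).enc))

theorem exec_read (hk : k.IsPort) [TreeRepr k.Alph] {B : ℕ} (hB : ∀ a : k.Alph, tsize a ≤ B) (w : List k.Alph) :
    (read k).Exec (portStore k w m []) (portStore k [] ((toTree w.reverse).enc ++ m) [])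
      (w.length * (B + 2) + 2) := by
  have key : ∀ (w u : List k.Alph), (loop k fun a => pushWord (true :: (toTree a).enc)).Exec
      (portStore k w ((toTree u).enc ++ m) [])
      (portStore k [] ((toTree (w.reverse ++ u)).enc ++ m) []) (w.length * (B + 2) + 1) := by
    intro w
    induction w with
    | nil => intro u; exact (exec_loop_nil (portStore_port _ _ _)).mono (by omega)
    | cons a w ih =>
      intro u
      have h₁ := exec_pushWord_portStore hk (w := w) (m := (toTree u).enc ++ m) (c := [])
        (true :: (toTree a).enc)
      have e : true :: (toTree a).enc ++ ((toTree u).enc ++ m) = (toTree (a :: u)).enc ++ m := by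
        simp [toTree, BinTree.enc]
      rw [e] at h₁
      have h₂ := Exec.loop (k := k) (s := portStore k (a :: w) ((toTree u).enc ++ m) [])
        (P := fun a => pushWord (true :: (toTree a).enc)) (portStore_port _ _ _)
        (by rw [update_portStore_port]; exact h₁) (ih (a :: u))
      rw [List.reverse_cons, List.append_assoc]
      refine h₂.mono ?_
      have h₃ := hB a
      have h₄ : (a :: w).length * (B + 2) = w.length * (B + 2) + (B + 2) := by
        rw [List.length_cons]; ring
      rw [tsize, ← BinTree.length_enc] at h₃
      rw [h₄, List.length_cons]
      omega
  have := (exec_pushWord_portStore hk (w := w) (m := m) (c := []) [false]).seq (key w [])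
  rw [List.append_nil] at this
  exact this.mono (by simp; omega)

/-- Push the letter with the position that is represented on the main stack. -/
def emit (k : Reg) : List k.Alph → StackProg
  | [] => skip
  | a :: l => pop .main fun
    | none => skip
    | some false => push k a
    | some true => pop .main fun _ => emit k l

/-- A position is written in unary, `true, false` for each unit and then `false`, so every skipped
element of `l` costs two pops. -/
theorem exec_emit (hk : k.IsPort) [DecidableEq k.Alph] (l : List k.Alph) (a : k.Alph) (ha : a ∈ l) :
    (emit k l).Exec (portStore k w ((toTree (l.idxOf a)).enc ++ m) c) (portStore k (a :: w) m c)
      (2 * l.length) := by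
  induction l with
  | nil => simp at ha
  | cons b l ih =>
    rw [emit]
    by_cases hab : b = a
    · subst hab
      rw [List.idxOf_cons_self]
      refine (exec_pop_portStore hk (b := false) (n := 1) ?_).mono (by simp)
      have := exec_push k b (portStore k w m c)
      rwa [update_portStore_port, portStore_port] at this
    · rw [List.idxOf_cons_ne _ hab]
      have h₁ := ih ((List.mem_cons.1 ha).resolve_left fun h => hab h.symm)
      exact (exec_pop_portStore hk (b := true) (exec_pop_portStore hk (b := false)
        (P := fun _ => emit k l) h₁)).mono (by simp; omega)

/-- The treatment of one letter of an output. -/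
def writeCase (k : Reg) (l : List k.Alph) : Option Bool → StackProg
  | some true => (emit k l).seq (push .count true)
  | _ => skip

/-- Move the list that is represented on the main stack in reverse to a stack. -/
def write (k : Reg) (l : List k.Alph) : StackProg :=
  (push .count true).seq (loop .count fun _ => pop .main (writeCase k l))

theorem exec_write (hk : k.IsPort) [DecidableEq k.Alph] [TreeRepr k.Alph] (l : List k.Alph)
    (hl : ∀ a : k.Alph, a ∈ l ∧ toTree a = toTree (l.idxOf a)) (u : List k.Alph) :
    (write k l).Exec (portStore k [] ((toTree u).enc ++ m) []) (portStore k u.reverse m [])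
      (u.length * (2 * l.length + 3) + 4) := by
  have key : ∀ (u w : List k.Alph), (loop .count fun _ => pop .main (writeCase k l)).Exec
      (portStore k w ((toTree u).enc ++ m) [true]) (portStore k (u.reverse ++ w) m [])
      (u.length * (2 * l.length + 3) + 3) := by
    intro u
    induction u with
    | nil =>
      intro w
      refine (Exec.loop (k := Reg.count) (a := true) (u := []) (portStore_count _ _ _ hk)
        (s' := portStore k w m []) (m := 1) (n := 1) ?_
        (exec_loop_nil (portStore_count _ _ _ hk))).mono (by omega)
      rw [update_portStore_count _ _ _ _ hk]
      exact exec_pop_portStore hk (b := false) (exec_skip _)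
    | cons a u ih =>
      intro w
      have h₁ := exec_emit hk (w := w) (m := (toTree u).enc ++ m) (c := []) l a (hl a).1
      have h₂ := exec_push .count true (portStore k (a :: w) ((toTree u).enc ++ m) [])
      rw [update_portStore_count _ _ _ _ hk, portStore_count _ _ _ hk] at h₂
      have h₃ := exec_pop_portStore hk (P := writeCase k l) (b := true) (h₁.seq h₂)
      have e : true :: ((toTree (l.idxOf a)).enc ++ ((toTree u).enc ++ m)) =
          (toTree (a :: u)).enc ++ m := by
        rw [← (hl a).2]
        simp [toTree, BinTree.enc]
      rw [e] at h₃
      have h₄ := Exec.loop (k := Reg.count) (a := true) (u := [])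
        (s := portStore k w ((toTree (a :: u)).enc ++ m) [true])
        (P := fun _ => pop .main (writeCase k l))
        (portStore_count _ _ _ hk) (by rw [update_portStore_count _ _ _ _ hk]; exact h₃) (ih (a :: w))
      rw [List.reverse_cons, List.append_assoc]
      refine h₄.mono ?_
      have h₄ : (a :: u).length * (2 * l.length + 3) =
          u.length * (2 * l.length + 3) + (2 * l.length + 3) := by
        rw [List.length_cons]; ring
      omega
  have h₁ := exec_push .count true (portStore k [] ((toTree u).enc ++ m) [])
  rw [update_portStore_count _ _ _ _ hk, portStore_count _ _ _ hk] at h₁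
  have h₂ := key u []
  rw [List.append_nil] at h₂
  exact (h₁.seq h₂).mono (by omega)

end StackProg

namespace PolyTime

open StackProg TreeRepr

/-- A polynomial-time function on trees yields a polynomial-time Turing machine. -/
theorem computable {k₀ k₁ : Reg} (hk₀ : k₀.IsPort) (hk₁ : k₁.IsPort) [Fintype k₀.Alph]
    [TreeRepr k₀.Alph] [TreeRepr k₁.Alph] [DecidableEq k₁.Alph] (l : List k₁.Alph)
    (hl : ∀ a : k₁.Alph, a ∈ l ∧ toTree a = toTree (l.idxOf a)) {α β : Type}
    {ea : α → List k₀.Alph} {eb : β → List k₁.Alph} {f : α → β}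
    {F : List k₀.Alph → List k₁.Alph} (hF : PolyTime F) (h : ∀ a, F (ea a) = eb (f a)) :
    Nonempty (Turing.TM2ComputableInPolyTime ea eb f) := by
  -- `read` and `write` both reverse the word, so the program between them computes `F` conjugated
  -- by reversal.
  have hG : PolyTime (fun w : List k₀.Alph => (F w.reverse).reverse) := by fun_prop
  obtain ⟨q, hq⟩ := hG.exists_tsize_le
  obtain ⟨P, p, hP⟩ := hG
  obtain ⟨B, hB⟩ : ∃ B, ∀ a : k₀.Alph, tsize a ≤ B :=
    ⟨Finset.univ.sup tsize, fun a => Finset.le_sup (f := tsize) (Finset.mem_univ a)⟩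
  let r : Polynomial ℕ := .X * .C (B + 1) + 1
  refine StackProg.computable ((read k₀).seq (P.seq (write k₁ l))) k₀ k₁ ea eb f
    (.X * .C (B + 2) + 2 + (p.comp r + (q.comp r * .C (2 * l.length + 3) + 4))) fun a => ?_
  have e₀ : ∀ (k : Reg) (w : List k.Alph),
      Function.update (fun _ => []) k w = portStore k w [] [] := by
    intro k w
    unfold portStore
    congr 1
    funext k
    cases k <;> rfl
  have e₁ : ∀ (k : Reg) (m : List Bool), k.IsPort →
      portStore k [] m [] = store [] [] m [] [] [] := by
    rintro k m (rfl | rfl)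
    · exact update_store_data _ _ _ _ _ _ _
    · exact update_store_form _ _ _ _ _ _ _
  rw [e₀, e₀]
  have hw : tsize (ea a).reverse ≤ r.eval (ea a).length := by
    have := tsize_le_of_forall (l := (ea a).reverse) fun a _ => hB a
    simpa [r] using this
  have h₁ := exec_read hk₀ (m := []) hB (ea a)
  rw [e₁ _ _ hk₀] at h₁
  have h₂ := hP [] [] (ea a).reverse []
  dsimp only at h₂
  rw [List.reverse_reverse, h a] at h₂
  have h₃ := exec_write hk₁ (m := []) l hl (eb (f a)).reverse
  rw [e₁ _ _ hk₁, List.reverse_reverse] at h₃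
  refine (h₁.seq (h₂.seq h₃)).mono ?_
  have h₄ := p.eval_nat_mono hw
  have h₅ : (eb (f a)).length ≤ q.eval (r.eval (ea a).length) := by
    have := (hq (ea a).reverse).trans (q.eval_nat_mono hw)
    rw [List.reverse_reverse, h a, tsize_reverse] at this
    exact (length_le_tsize _).trans this
  have h₆ := Nat.mul_le_mul_right (2 * l.length + 3) h₅
  simp only [Polynomial.eval_add, Polynomial.eval_mul, Polynomial.eval_comp, Polynomial.eval_C,
    Polynomial.eval_X, Polynomial.eval_ofNat, List.length_reverse] at h₄ ⊢
  omega

theorem computable_data_form {α β : Type} {ea : α → List DataLetter} {eb : β → List FormulaLetter}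
    {f : α → β} {F : List DataLetter → List FormulaLetter} (hF : PolyTime F)
    (h : ∀ a, F (ea a) = eb (f a)) : Nonempty (Turing.TM2ComputableInPolyTime ea eb f) :=
  computable (k₀ := .data) (k₁ := .form) (.inl rfl) (.inr rfl) _
    (fun a => ⟨by cases a <;> decide, rfl⟩) hF h

theorem computable_form_data {α β : Type} {ea : α → List FormulaLetter} {eb : β → List DataLetter}
    {f : α → β} {F : List FormulaLetter → List DataLetter} (hF : PolyTime F)
    (h : ∀ a, F (ea a) = eb (f a)) : Nonempty (Turing.TM2ComputableInPolyTime ea eb f) :=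
  computable (k₀ := .form) (k₁ := .data) (.inr rfl) (.inl rfl) _
    (fun a => ⟨by cases a <;> decide, rfl⟩) hF h

end PolyTime

/-! ### From formulas to quadratic equations -/

/-- The quadratic equation `x_a x_b + x_c x_d = x_e x_f`, given by its indices. -/
abbrev QuadEq : Type := ℕ × ℕ × ℕ × ℕ × ℕ × ℕ

namespace QuadEq

/-- The equation is satisfied at a real point. -/
def Holds (x : ℕ → ℝ) (e : QuadEq) : Prop :=
  x e.1 * x e.2.1 + x e.2.2.1 * x e.2.2.2.1 = x e.2.2.2.2.1 * x e.2.2.2.2.2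

/-- All indices are smaller than `n`. -/
def Below (n : ℕ) (e : QuadEq) : Prop :=
  e.1 < n ∧ e.2.1 < n ∧ e.2.2.1 < n ∧ e.2.2.2.1 < n ∧ e.2.2.2.2.1 < n ∧ e.2.2.2.2.2 < n

theorem Below.mono {m n : ℕ} {e : QuadEq} (h : e.Below m) (hmn : m ≤ n) : e.Below n := by
  unfold Below at *; omega

theorem Holds.congr {x y : ℕ → ℝ} {n : ℕ} {e : QuadEq} (hx : e.Holds x) (he : e.Below n)
    (h : ∀ i < n, y i = x i) : e.Holds y := by
  obtain ⟨h₁, h₂, h₃, h₄, h₅, h₆⟩ := he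
  unfold Holds at *
  rw [h _ h₁, h _ h₂, h _ h₃, h _ h₄, h _ h₅, h _ h₆]
  exact hx

end QuadEq

/-! ### Quadratic equations for single operations. -/

namespace FormulaLetter

/-- Equations that express that `x_v` is the result of the operation `c` on `x_a` and `x_b`, if
`x₀ = 1` and `x₁ = 0`; truth values are `0` and `1`. They use the auxiliary variables
`x_{v+1}, …, x_{v+5}`. -/
def gadget (c : FormulaLetter) (a b v : ℕ) : List QuadEq :=
  match c with
  | neg => [(a, 0, v, 0, 1, 1)]
  | add => [(a, 0, b, 0, v, 0)]
  | mul => [(a, b, 1, 1, v, 0)]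
  | eq => [(b, 0, v + 1, 0, a, 0), (v, v + 1, 1, 1, 1, 1), (v + 1, v + 2, v, 0, 0, 0)]
  | lt => [(a, 0, v + 1, 0, b, 0), (v + 1, 0, v + 3, v + 3, v + 2, v + 2),
      (v + 2, v + 4, 1, 1, v, 0), (v, v + 3, 1, 1, 1, 1), (v, v + 2, 1, 1, v + 2, 0)]
  | le => [(b, 0, v + 1, 0, a, 0), (v + 1, 0, v + 3, v + 3, v + 2, v + 2),
      (v + 2, v + 4, 1, 1, v + 5, 0), (v + 5, v + 3, 1, 1, 1, 1), (v + 5, v + 2, 1, 1, v + 2, 0),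
      (v + 5, 0, v, 0, 0, 0)]
  | not => [(a, 0, v, 0, 0, 0)]
  | and => [(a, b, 1, 1, v, 0)]
  | or => [(a, 0, b, 0, v + 2, 0), (a, b, 1, 1, v + 1, 0), (v, 0, v + 1, 0, v + 2, 0)]
  | _ => []

open Classical in
/-- The operations that are denoted by the letters. -/
noncomputable def op (c : FormulaLetter) (α β : ℝ) : ℝ :=
  match c with
  | neg => -α
  | add => α + β
  | mul => α * β
  | eq => if α = β then 1 else 0
  | lt => if α < β then 1 else 0
  | le => if α ≤ β then 1 else 0
  | not => 1 - α
  | and => α * β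
  | or => α + β - α * β
  | _ => 0

/-- The letters that denote operations. -/
def IsOp : FormulaLetter → Prop
  | stroke | x | zero | one => False
  | _ => True

/-- Here `d = β - α = p² - q²`. If `p ≠ 0`, then `u p = p` gives `u = 1`, next `u q = 0` gives `q =
0`, and `d = p² > 0`. If `p = 0`, then `u = p w = 0` and `d = -q² ≤ 0`. Thus equations alone
determine the truth value of a strict inequality. -/
theorem lt_of_gadget {α β d p q w u : ℝ} (h₁ : α + d = β) (h₂ : d + q * q = p * p)
    (h₃ : p * w = u) (h₄ : u * q = 0) (h₅ : u * p = p) :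
    (α < β ∧ u = 1) ∨ (¬ α < β ∧ u = 0) := by
  by_cases hp : p = 0
  · subst hp
    exact .inr ⟨by nlinarith [mul_self_nonneg q], by linarith⟩
  · have hu : u = 1 := by
      have : (u - 1) * p = 0 := by linarith
      rcases mul_eq_zero.1 this with h | h
      · linarith
      · exact absurd h hp
    subst hu
    have hq : q = 0 := by linarith
    subst hq
    have := mul_self_pos.2 hp
    exact .inl ⟨by linarith, rfl⟩

/-- For `eq`, with `d = x_a - x_b`, the equations `u d = 0` and `d w + u = 1` force `u` to be the
truth value of `d = 0`. For `le`, the value is one minus that of the reversed strict inequality. The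
Boolean operations are polynomials in truth values. -/
theorem gadget_sound {c : FormulaLetter} (hc : c.IsOp) {a b v : ℕ} {x : ℕ → ℝ} (h₀ : x 0 = 1)
    (h₁ : x 1 = 0) (h : ∀ e ∈ c.gadget a b v, QuadEq.Holds x e) : x v = c.op (x a) (x b) := by
  cases c <;> simp only [gadget, QuadEq.Holds, List.mem_cons, List.not_mem_nil, or_false,
    forall_eq_or_imp, forall_eq, h₀, h₁, mul_one, mul_zero, add_zero, IsOp] at h hc ⊢ <;>
    simp only [op]
  case neg => linarith
  case add => exact h.symm
  case mul => exact h.symm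
  case not => linarith
  case and => exact h.symm
  case or => linarith
  case eq =>
    obtain ⟨h₂, h₃, h₄⟩ := h
    by_cases hab : x a = x b
    · have : x (v + 1) = 0 := by linarith
      rw [this] at h₄
      rw [if_pos hab]; linarith
    · have : x (v + 1) ≠ 0 := fun h' => hab (by linarith)
      rw [if_neg hab]
      exact (mul_eq_zero.1 h₃).resolve_right this
  case lt =>
    obtain ⟨h₂, h₃, h₄, h₅, h₆⟩ := h
    rcases lt_of_gadget h₂ h₃ h₄ h₅ h₆ with ⟨h, h'⟩ | ⟨h, h'⟩
    · rw [if_pos h, h']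
    · rw [if_neg h, h']
  case le =>
    obtain ⟨h₂, h₃, h₄, h₅, h₆, h₇⟩ := h
    rcases lt_of_gadget h₂ h₃ h₄ h₅ h₆ with ⟨h, h'⟩ | ⟨h, h'⟩
    · rw [if_neg (not_le.2 h)]; linarith
    · rw [if_pos (not_lt.1 h)]; linarith

theorem exists_lt_gadget (α β : ℝ) : ∃ d p q w u : ℝ, α + d = β ∧ d + q * q = p * p ∧ p * w = u ∧
    u * q = 0 ∧ u * p = p := by
  rcases lt_or_ge α β with h | h
  · have h₁ := Real.mul_self_sqrt (sub_pos.2 h).le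
    have h₂ : √(β - α) ≠ 0 := (Real.sqrt_pos.2 (sub_pos.2 h)).ne'
    exact ⟨β - α, √(β - α), 0, (√(β - α))⁻¹, 1, by ring, by linarith,
      mul_inv_cancel₀ h₂, by ring, by ring⟩
  · have h₁ := Real.mul_self_sqrt (sub_nonneg.2 h)
    exact ⟨β - α, 0, √(α - β), 0, 0, by ring, by linarith, by ring, by ring, by ring⟩

/-- The auxiliary values are chosen from `α` and `β` alone, before the indices and the point, so
that `quadSol` can be defined with them. Seven values fill the block of indices from `v` to the next
index reserved for a variable of the formula. -/
theorem gadget_complete (c : FormulaLetter) (α β : ℝ) : ∃ y : ℕ → ℝ, ∀ (a b v : ℕ) (x : ℕ → ℝ),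
    x 0 = 1 → x 1 = 0 → x a = α → x b = β → (∀ r < 7, x (v + r) = y r) →
    ∀ e ∈ c.gadget a b v, QuadEq.Holds x e := by
  have key : ∃ y₀ y₁ y₂ y₃ y₄ y₅ : ℝ, ∀ (a b v : ℕ) (x : ℕ → ℝ), x 0 = 1 → x 1 = 0 → x a = α →
      x b = β → x v = y₀ → x (v + 1) = y₁ → x (v + 2) = y₂ → x (v + 3) = y₃ → x (v + 4) = y₄ →
      x (v + 5) = y₅ → ∀ e ∈ c.gadget a b v, QuadEq.Holds x e := by
    cases c <;> simp only [gadget, QuadEq.Holds, List.mem_cons, List.not_mem_nil, or_false,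
      forall_eq_or_imp, forall_eq]
    case neg =>
      refine ⟨-α, 0, 0, 0, 0, 0, fun a b v x h₀ h₁ ha hb e₀ e₁ e₂ e₃ e₄ e₅ => ?_⟩
      simp only [h₀, h₁, ha, e₀]; ring
    case add =>
      refine ⟨α + β, 0, 0, 0, 0, 0, fun a b v x h₀ h₁ ha hb e₀ e₁ e₂ e₃ e₄ e₅ => ?_⟩
      simp only [h₀, ha, hb, e₀]; ring
    case mul | and =>
      refine ⟨α * β, 0, 0, 0, 0, 0, fun a b v x h₀ h₁ ha hb e₀ e₁ e₂ e₃ e₄ e₅ => ?_⟩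
      simp only [h₀, h₁, ha, hb, e₀]; ring
    case not =>
      refine ⟨1 - α, 0, 0, 0, 0, 0, fun a b v x h₀ h₁ ha hb e₀ e₁ e₂ e₃ e₄ e₅ => ?_⟩
      simp only [h₀, ha, e₀]; ring
    case or =>
      refine ⟨α + β - α * β, α * β, α + β, 0, 0, 0,
        fun a b v x h₀ h₁ ha hb e₀ e₁ e₂ e₃ e₄ e₅ => ?_⟩
      simp only [h₀, h₁, ha, hb, e₀, e₁, e₂]
      refine ⟨?_, ?_, ?_⟩ <;> ring
    case eq =>
      by_cases hab : α = β
      · refine ⟨1, 0, 0, 0, 0, 0, fun a b v x h₀ h₁ ha hb e₀ e₁ e₂ e₃ e₄ e₅ => ?_⟩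
        simp only [h₀, h₁, ha, hb, e₀, e₁, e₂, hab]
        refine ⟨?_, ?_, ?_⟩ <;> ring
      · have h' : α - β ≠ 0 := sub_ne_zero.2 hab
        refine ⟨0, α - β, (α - β)⁻¹, 0, 0, 0, fun a b v x h₀ h₁ ha hb e₀ e₁ e₂ e₃ e₄ e₅ => ?_⟩
        simp only [h₀, h₁, ha, hb, e₀, e₁, e₂, mul_inv_cancel₀ h']
        refine ⟨?_, ?_, ?_⟩ <;> ring
    case lt =>
      obtain ⟨d, p, q, w, u, hd, hp, hw, hq, hu⟩ := exists_lt_gadget α β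
      refine ⟨u, d, p, q, w, 0, fun a b v x h₀ h₁ ha hb e₀ e₁ e₂ e₃ e₄ e₅ => ?_⟩
      simp only [h₀, h₁, ha, hb, e₀, e₁, e₂, e₃, e₄]
      refine ⟨?_, ?_, ?_, ?_, ?_⟩ <;> linarith
    case le =>
      obtain ⟨d, p, q, w, u, hd, hp, hw, hq, hu⟩ := exists_lt_gadget β α
      refine ⟨1 - u, d, p, q, w, u, fun a b v x h₀ h₁ ha hb e₀ e₁ e₂ e₃ e₄ e₅ => ?_⟩
      simp only [h₀, h₁, ha, hb, e₀, e₁, e₂, e₃, e₄, e₅]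
      refine ⟨?_, ?_, ?_, ?_, ?_, ?_⟩ <;> linarith
    all_goals
      refine ⟨0, 0, 0, 0, 0, 0, ?_⟩
      simp
  obtain ⟨y₀, y₁, y₂, y₃, y₄, y₅, key⟩ := key
  refine ⟨fun r => match r with
    | 0 => y₀
    | 1 => y₁
    | 2 => y₂
    | 3 => y₃
    | 4 => y₄
    | _ => y₅, fun a b v x h₀ h₁ ha hb h => key a b v x h₀ h₁ ha hb (h 0 (by omega))
      (h 1 (by omega)) (h 2 (by omega)) (h 3 (by omega)) (h 4 (by omega)) (h 5 (by omega))⟩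

theorem gadget_below (c : FormulaLetter) {a b v n : ℕ} (ha : a < n) (hb : b < n)
    (hv : v + 6 < n) : ∀ e ∈ c.gadget a b v, QuadEq.Below n e := by
  cases c <;> simp only [gadget, QuadEq.Below, List.mem_cons, List.not_mem_nil, or_false,
    forall_eq_or_imp, forall_eq, IsEmpty.forall_iff, implies_true] <;> omega

theorem length_gadget_le (c : FormulaLetter) (a b v : ℕ) : (c.gadget a b v).length ≤ 6 := by
  cases c <;> simp [gadget]

/-- The effect of a letter on a stack of indices of variables. -/
def shift (c : FormulaLetter) (v : ℕ) (s : List ℕ) : List ℕ :=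
  match c with
  | stroke => (s.headD 0 + 8) :: s.tail
  | x => 2 :: s
  | zero => 1 :: s
  | one => 0 :: s
  | neg => v :: s.tail
  | not => v :: s.tail
  | _ => v :: s.tail.tail

end FormulaLetter

/-! ### Translation of a word by means of a stack of indices. -/

/-- The state in a translation of a formula to quadratic equations: a stack of indices of
variables, the equations, and the number of letters that have been read. -/
abbrev QuadState : Type := List ℕ × List QuadEq × ℕ

/-- Read a letter. -/
def quadStep (c : FormulaLetter) (s : QuadState) : QuadState :=
  (c.shift (8 * s.2.2 + 3) s.1,
    c.gadget (s.1.headD 0) (s.1.tail.headD 0) (8 * s.2.2 + 3) ++ s.2.1, s.2.2 + 1)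

/-- Read a word from right to left. The variable `xᵢ` of the formula becomes `x_{8i+2}`. -/
def quadRun (w : List FormulaLetter) : QuadState := w.foldr quadStep ([], [], 0)

@[simp] theorem quadRun_cons (c : FormulaLetter) (w : List FormulaLetter) :
    quadRun (c :: w) = quadStep c (quadRun w) := rfl

@[simp] theorem quadRun_length (w : List FormulaLetter) : (quadRun w).2.2 = w.length := by
  induction w with
  | nil => rfl
  | cons c w ih => simp [quadStep, ih]

theorem List.headD_lt {s : List ℕ} {n : ℕ} (h : ∀ i ∈ s, i < n) (hn : 0 < n) :
    s.headD 0 < n := by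
  cases s with
  | nil => exact hn
  | cons a s => exact h a (by simp)

/-- The bound is the first fresh index for the next letter, so later letters do not touch the
variables of earlier equations. It is also the dimension of the matrices. -/
theorem quadRun_below (w : List FormulaLetter) :
    (∀ i ∈ (quadRun w).1, i < 8 * w.length + 3) ∧
      ∀ e ∈ (quadRun w).2.1, QuadEq.Below (8 * w.length + 3) e := by
  induction w with
  | nil => simp [quadRun]
  | cons c w ih =>
    obtain ⟨ih₁, ih₂⟩ := ih
    have ht : ∀ i ∈ (quadRun w).1.tail, i < 8 * w.length + 3 :=
      fun i hi => ih₁ i (List.mem_of_mem_tail hi)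
    have htt : ∀ i ∈ (quadRun w).1.tail.tail, i < 8 * w.length + 3 :=
      fun i hi => ht i (List.mem_of_mem_tail hi)
    have h₁ := List.headD_lt ih₁ (by omega)
    have h₂ := List.headD_lt ht (by omega)
    simp only [quadRun_cons, quadStep, quadRun_length, List.length_cons]
    constructor
    · intro i hi
      cases c <;> simp only [FormulaLetter.shift, List.mem_cons] at hi <;>
        rcases hi with rfl | hi <;>
        first
        | omega
        | (have := ih₁ i hi; omega)
        | (have := ht i hi; omega)
        | (have := htt i hi; omega)
    · intro e he
      rcases List.mem_append.1 he with he | he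
      · exact FormulaLetter.gadget_below c (by omega) (by omega) (by omega) e he
      · exact (ih₂ e he).mono (by omega)

theorem length_quadRun_le (w : List FormulaLetter) :
    (quadRun w).1.length ≤ w.length ∧ (quadRun w).2.1.length ≤ 6 * w.length := by
  induction w with
  | nil => simp [quadRun]
  | cons c w ih =>
    have := c.length_gadget_le ((quadRun w).1.headD 0) ((quadRun w).1.tail.headD 0)
      (8 * w.length + 3)
    simp only [quadRun_cons, quadStep, quadRun_length, List.length_cons, List.length_append]
    refine ⟨?_, by omega⟩
    cases c <;> simp only [FormulaLetter.shift, List.length_cons, List.length_tail] <;> omega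

/-! #### Correctness -/

section

variable {x : ℕ → ℝ}

theorem quadRun_var (i : ℕ) (w : List FormulaLetter) :
    (quadRun ((PolyTerm.var i).encode ++ w)).1 = (8 * i + 2) :: (quadRun w).1 ∧
      (quadRun ((PolyTerm.var i).encode ++ w)).2.1 = (quadRun w).2.1 := by
  induction i with
  | zero => exact ⟨rfl, rfl⟩
  | succ i ih =>
    obtain ⟨ih₁, ih₂⟩ := ih
    have e : (PolyTerm.var (i + 1)).encode ++ w = .stroke :: ((PolyTerm.var i).encode ++ w) := by
      simp [PolyTerm.encode, List.replicate_succ]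
    rw [e, quadRun_cons]
    simp only [quadStep, FormulaLetter.shift, FormulaLetter.gadget, ih₁, ih₂, List.headD_cons,
      List.tail_cons, List.nil_append, and_true]
    congr 1

/-- When an operation is read from the right, its arguments are on top of the stack, the first one
uppermost. The rest `w` is arbitrary because the first argument of a binary operation is followed by
the second. -/
theorem quadRun_term (h₀ : x 0 = 1) (h₁ : x 1 = 0) (t : PolyTerm) (w : List FormulaLetter)
    (h : ∀ e ∈ (quadRun (t.encode ++ w)).2.1, QuadEq.Holds x e) :
    (∃ i, (quadRun (t.encode ++ w)).1 = i :: (quadRun w).1 ∧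
      x i = t.eval fun j => x (8 * j + 2)) ∧ ∀ e ∈ (quadRun w).2.1, QuadEq.Holds x e := by
  induction t generalizing w with
  | var i =>
    obtain ⟨e₁, e₂⟩ := quadRun_var i w
    rw [e₂] at h
    exact ⟨⟨_, e₁, rfl⟩, h⟩
  | zero => exact ⟨⟨1, rfl, h₁⟩, h⟩
  | one => exact ⟨⟨0, rfl, h₀⟩, h⟩
  | neg s ih =>
    simp only [PolyTerm.encode, List.cons_append, quadRun_cons, quadStep] at h ⊢
    obtain ⟨⟨i, hi, hi'⟩, hw⟩ := ih w fun e he => h e (List.mem_append_right _ he)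
    refine ⟨⟨_, by rw [hi]; rfl, ?_⟩, hw⟩
    rw [FormulaLetter.gadget_sound (c := .neg) trivial h₀ h₁
      fun e he => h e (List.mem_append_left _ he), hi]
    simp [FormulaLetter.op, PolyTerm.eval, hi']
  | add s t ihs iht | mul s t ihs iht =>
    simp only [PolyTerm.encode, List.cons_append, List.append_assoc, quadRun_cons, quadStep] at h ⊢
    obtain ⟨⟨i, hi, hi'⟩, hw⟩ := ihs _ fun e he => h e (List.mem_append_right _ he)
    obtain ⟨⟨j, hj, hj'⟩, hw'⟩ := iht w hw
    refine ⟨⟨_, by rw [hi, hj]; rfl, ?_⟩, hw'⟩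
    rw [FormulaLetter.gadget_sound (by trivial) h₀ h₁
      fun e he => h e (List.mem_append_left _ he), hi, hj]
    simp [FormulaLetter.op, PolyTerm.eval, hi', hj']

open Classical in
theorem quadRun_formula (h₀ : x 0 = 1) (h₁ : x 1 = 0) (φ : PolyFormula)
    (w : List FormulaLetter)
    (h : ∀ e ∈ (quadRun (φ.encode ++ w)).2.1, QuadEq.Holds x e) :
    (∃ i, (quadRun (φ.encode ++ w)).1 = i :: (quadRun w).1 ∧
      x i = if φ.Holds fun j => x (8 * j + 2) then 1 else 0) ∧
      ∀ e ∈ (quadRun w).2.1, QuadEq.Holds x e := by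
  induction φ generalizing w with
  | eq s t | lt s t | le s t =>
    simp only [PolyFormula.encode, List.cons_append, List.append_assoc, quadRun_cons, quadStep]
      at h ⊢
    obtain ⟨⟨i, hi, hi'⟩, hw⟩ := quadRun_term h₀ h₁ s _
      fun e he => h e (List.mem_append_right _ he)
    obtain ⟨⟨j, hj, hj'⟩, hw'⟩ := quadRun_term h₀ h₁ t w hw
    refine ⟨⟨_, by rw [hi, hj]; rfl, ?_⟩, hw'⟩
    rw [FormulaLetter.gadget_sound (by trivial) h₀ h₁
      fun e he => h e (List.mem_append_left _ he), hi, hj]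
    simp only [FormulaLetter.op, PolyFormula.Holds, List.headD_cons, List.tail_cons, hi', hj']
    congr
  | not φ ih =>
    simp only [PolyFormula.encode, List.cons_append, quadRun_cons, quadStep] at h ⊢
    obtain ⟨⟨i, hi, hi'⟩, hw⟩ := ih w fun e he => h e (List.mem_append_right _ he)
    refine ⟨⟨_, by rw [hi]; rfl, ?_⟩, hw⟩
    rw [FormulaLetter.gadget_sound (c := .not) trivial h₀ h₁
      fun e he => h e (List.mem_append_left _ he), hi]
    simp only [FormulaLetter.op, PolyFormula.Holds, List.headD_cons, hi']
    by_cases p : φ.Holds fun j => x (8 * j + 2) <;> simp [p]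
  | and φ ψ ihs iht | or φ ψ ihs iht =>
    simp only [PolyFormula.encode, List.cons_append, List.append_assoc, quadRun_cons, quadStep]
      at h ⊢
    obtain ⟨⟨i, hi, hi'⟩, hw⟩ := ihs _ fun e he => h e (List.mem_append_right _ he)
    obtain ⟨⟨j, hj, hj'⟩, hw'⟩ := iht w hw
    refine ⟨⟨_, by rw [hi, hj]; rfl, ?_⟩, hw'⟩
    rw [FormulaLetter.gadget_sound (by trivial) h₀ h₁
      fun e he => h e (List.mem_append_left _ he), hi, hj]
    simp only [FormulaLetter.op, PolyFormula.Holds, List.headD_cons, List.tail_cons, hi', hj']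
    by_cases p : φ.Holds fun j => x (8 * j + 2) <;>
      by_cases q : ψ.Holds fun j => x (8 * j + 2) <;> simp [p, q]

end

/-- A solution of the equations, for given values of the variables of the formula. -/
noncomputable def quadSol (y : ℕ → ℝ) : List FormulaLetter → ℕ → ℝ
  | [], k => if k = 0 then 1 else if k % 8 = 2 then y (k / 8) else 0
  | c :: w, k =>
    if 8 * w.length + 3 ≤ k ∧ k < 8 * w.length + 10 then
      (c.gadget_complete (quadSol y w ((quadRun w).1.headD 0))
        (quadSol y w ((quadRun w).1.tail.headD 0))).choose (k - (8 * w.length + 3))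
    else quadSol y w k

/-- The indices `8 j + 2` avoid all blocks `8 m + 3, …, 8 m + 9` of auxiliary variables, so the
given values survive. -/
theorem quadSol_var (y : ℕ → ℝ) (w : List FormulaLetter) (j : ℕ) :
    quadSol y w (8 * j + 2) = y j := by
  induction w with
  | nil =>
    rw [quadSol, if_neg (by omega), if_pos (by omega)]
    congr 1
    omega
  | cons c w ih => rw [quadSol, if_neg (by omega), ih]

theorem quadSol_lt (y : ℕ → ℝ) (c : FormulaLetter) (w : List FormulaLetter) {k : ℕ}
    (h : k < 8 * w.length + 3) : quadSol y (c :: w) k = quadSol y w k := by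
  rw [quadSol, if_neg (by omega)]

theorem quadSol_zero (y : ℕ → ℝ) (w : List FormulaLetter) : quadSol y w 0 = 1 := by
  induction w with
  | nil => simp [quadSol]
  | cons c w ih => rw [quadSol_lt _ _ _ (by omega), ih]

theorem quadSol_one (y : ℕ → ℝ) (w : List FormulaLetter) : quadSol y w 1 = 0 := by
  induction w with
  | nil => simp [quadSol]
  | cons c w ih => rw [quadSol_lt _ _ _ (by omega), ih]

/-- The equations of the new letter hold by the choice of its block; the older ones only involve
smaller indices, whose values do not change. -/
theorem quadSol_holds (y : ℕ → ℝ) (w : List FormulaLetter) :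
    ∀ e ∈ (quadRun w).2.1, QuadEq.Holds (quadSol y w) e := by
  induction w with
  | nil => simp [quadRun]
  | cons c w ih =>
    obtain ⟨b₁, b₂⟩ := quadRun_below w
    intro e he
    simp only [quadRun_cons, quadStep, quadRun_length] at he
    rcases List.mem_append.1 he with he | he
    · refine (c.gadget_complete (quadSol y w ((quadRun w).1.headD 0))
        (quadSol y w ((quadRun w).1.tail.headD 0))).choose_spec _ _ (8 * w.length + 3) _ (quadSol_zero y _)
        (quadSol_one y _) (quadSol_lt _ _ _ (List.headD_lt b₁ (by omega)))
        (quadSol_lt _ _ _ (List.headD_lt (fun i hi => b₁ i (List.mem_of_mem_tail hi)) (by omega)))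
        (fun r hr => ?_) e he
      rw [quadSol, if_pos (by omega), Nat.add_sub_cancel_left]
    · exact (ih e he).congr (b₂ e he) fun i hi => quadSol_lt _ _ _ hi

/-- The equations for a formula. The first one is to be modified on the right hand side, to
`x₀ x₀ = 1`. -/
def quadSystem (w : List FormulaLetter) : List QuadEq :=
  (0, 0, 1, 1, 1, 1) :: (1, 1, 1, 1, 1, 1) :: ((quadRun w).1.headD 0, 0, 1, 1, 0, 0) ::
    (quadRun w).2.1

theorem quadSystem_below (w : List FormulaLetter) :
    ∀ e ∈ quadSystem w, QuadEq.Below (8 * w.length + 3) e := by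
  obtain ⟨h₁, h₂⟩ := quadRun_below w
  intro e he
  simp only [quadSystem, List.mem_cons] at he
  rcases he with rfl | rfl | rfl | he
  · simp [QuadEq.Below]
  · simp [QuadEq.Below]
  · have := List.headD_lt h₁ (by omega)
    simp only [QuadEq.Below]
    omega
  · exact h₂ e he

/-- Apart from the gadgets, the remaining equations are `x₁² + x₁² = x₁²`, which forces `x₁ = 0`,
and one that gives the whole formula the truth value `1`. -/
theorem exists_holds_iff (φ : PolyFormula) : (∃ x, φ.Holds x) ↔
    ∃ x : ℕ → ℝ, x 0 = 1 ∧ ∀ e ∈ (quadSystem φ.encode).tail, QuadEq.Holds x e := by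
  classical
  have hnil : φ.encode = φ.encode ++ [] := (List.append_nil _).symm
  constructor
  · rintro ⟨y, hy⟩
    have h₀ := quadSol_zero y φ.encode
    have h₁ := quadSol_one y φ.encode
    have hh := quadSol_holds y φ.encode
    refine ⟨quadSol y φ.encode, h₀, ?_⟩
    intro e he
    simp only [quadSystem, List.tail_cons, List.mem_cons] at he
    rcases he with rfl | rfl | he
    · simp [QuadEq.Holds, h₁]
    · rw [hnil] at hh
      obtain ⟨⟨i, hi, hi'⟩, -⟩ := quadRun_formula (x := quadSol y φ.encode) h₀ h₁ φ [] (by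
        rwa [hnil, List.append_nil] at hh ⊢)
      rw [List.append_nil] at hi
      simp only [quadSol_var] at hi'
      rw [if_pos hy] at hi'
      simp [QuadEq.Holds, hi, hi', h₀, h₁]
    · exact hh e he
  · rintro ⟨x, h₀, hx⟩
    simp only [quadSystem, List.tail_cons, List.mem_cons, forall_eq_or_imp] at hx
    obtain ⟨hx₁, hx₂, hx₃⟩ := hx
    have h₁ : x 1 = 0 := by
      simp only [QuadEq.Holds] at hx₁
      exact mul_self_eq_zero.1 (by linarith)
    rw [hnil] at hx₃ hx₂
    obtain ⟨⟨i, hi, hi'⟩, -⟩ := quadRun_formula h₀ h₁ φ [] hx₃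
    simp only [QuadEq.Holds, hi, List.headD_cons, h₀, h₁] at hx₂
    by_contra hne
    rw [if_neg fun h => hne ⟨_, h⟩] at hi'
    rw [hi'] at hx₂
    norm_num at hx₂

/-! ### Hardness of rank-constrained semidefinite optimization -/

theorem Matrix.exists_eq_mul_of_rank_le_one {n : ℕ} {X : Matrix (Fin n) (Fin n) ℝ}
    (h : X.rank ≤ 1) : ∃ u v : Fin n → ℝ, ∀ i j, X i j = u i * v j := by
  rw [Matrix.rank_eq_finrank_span_cols, finrank_le_one_iff] at h
  obtain ⟨u, hu⟩ := h
  have hc : ∀ j, ∃ c : ℝ, c • (u : Fin n → ℝ) = X.col j := by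
    intro j
    obtain ⟨c, hc⟩ := hu ⟨X.col j, Submodule.subset_span ⟨j, rfl⟩⟩
    exact ⟨c, congrArg Subtype.val hc⟩
  choose c hc using hc
  refine ⟨u, c, fun i j => ?_⟩
  have := congrFun (hc j) i
  simp only [Pi.smul_apply, smul_eq_mul, Matrix.col_apply] at this
  rw [← this, mul_comm]

namespace QuadEq

/-- The coefficient of an equation at a position, as a function of three conditions. -/
def coeff (p q r : Bool) : ℚ :=
  (bif p then 1 else 0) + (bif q then 1 else 0) - (bif r then 1 else 0)

/-- The entries of the matrix of an equation. -/
def entry (e : QuadEq) (i j : ℕ) : ℚ :=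
  coeff (decide (e.1 = i) && decide (e.2.1 = j))
    (decide (e.2.2.1 = i) && decide (e.2.2.2.1 = j))
    (decide (e.2.2.2.2.1 = i) && decide (e.2.2.2.2.2 = j))

theorem matrixInner_entry {n : ℕ} (e : QuadEq) (X : Matrix (Fin n) (Fin n) ℝ) (Y : ℕ → ℕ → ℝ)
    (hXY : ∀ i j : Fin n, X i j = Y i j) (he : e.Below n) :
    matrixInner (fun i j => e.entry i j) X =
      Y e.1 e.2.1 + Y e.2.2.1 e.2.2.2.1 - Y e.2.2.2.2.1 e.2.2.2.2.2 := by
  obtain ⟨h₁, h₂, h₃, h₄, h₅, h₆⟩ := he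
  have key : ∀ a b : ℕ, a < n → b < n → ∑ i : Fin n, ∑ j : Fin n,
      (((bif decide (a = i) && decide (b = j) then 1 else 0 : ℚ)) : ℝ) * X i j = Y a b := by
    intro a b ha hb
    rw [Finset.sum_eq_single ⟨a, ha⟩, Finset.sum_eq_single ⟨b, hb⟩]
    · simp [hXY]
    · intro j _ hj
      have : b ≠ j := fun h => hj (Fin.ext h.symm)
      simp [this]
    · simp
    · intro i _ hi
      have : a ≠ i := fun h => hi (Fin.ext h.symm)
      simp [this]
    · simp
  simp only [matrixInner, entry, coeff, Rat.cast_add, Rat.cast_sub, add_mul, sub_mul,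
    Finset.sum_add_distrib, Finset.sum_sub_distrib]
  rw [key _ _ h₁ h₂, key _ _ h₃ h₄, key _ _ h₅ h₆]

end QuadEq

/-- The instance of the optimization problem for a formula. -/
def quadInstance (w : List FormulaLetter) : LowRankInstance where
  n := 8 * w.length + 3
  l := (quadSystem w).length
  k := 1
  lam := 0
  t := 0
  C := 0
  A := fun s i j => ((quadSystem w)[s]).entry i j
  b := fun s => if (s : ℕ) = 0 then 1 else 0

/-- A solution `x` yields `X = x xᵀ`. Conversely, rank at most one gives `Xᵢⱼ X₀₀ = Xᵢ₀ X₀ⱼ`, so by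
`X₀₀ = 1` and symmetry the column `x = X·₀` satisfies `X = x xᵀ`. Positive semidefiniteness is
needed here for symmetry only. Taking a column avoids the sign ambiguity of `x₀² = 1`. -/
theorem exists_holds_iff_yes (φ : PolyFormula) :
    (∃ x, φ.Holds x) ↔ lowRankPSD.Yes (quadInstance φ.encode) := by
  rw [exists_holds_iff]
  set w := φ.encode
  have hobj : ∀ X, (quadInstance w).objective X ≤ ((quadInstance w).t : ℝ) := by
    intro X
    simp [LowRankInstance.objective, quadInstance, matrixInner]
  have htail : ∀ P : QuadEq → Prop, (∀ e ∈ (quadSystem w).tail, P e) ↔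
      ∀ s : Fin (quadSystem w).length, (s : ℕ) ≠ 0 → P (quadSystem w)[s] := by
    intro P
    constructor
    · intro h s hs
      refine h _ ?_
      rw [List.mem_iff_getElem]
      refine ⟨s - 1, by simp; omega, ?_⟩
      rw [List.getElem_tail]
      congr 1
      omega
    · intro h e he
      obtain ⟨i, hi, rfl⟩ := List.mem_iff_getElem.1 he
      rw [List.getElem_tail]
      rw [List.length_tail] at hi
      exact h ⟨i + 1, by omega⟩ (by simp)
  have h0 : ∀ h, (quadSystem w)[0]'h = (0, 0, 1, 1, 1, 1) := fun _ => rfl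
  change _ ↔ ∃ X, (quadInstance w).Feasible X ∧
    (quadInstance w).objective X ≤ ((quadInstance w).t : ℝ)
  constructor
  · rintro ⟨x, hx₀, hx⟩
    let v : Fin (8 * w.length + 3) → ℝ := fun i => x i
    refine ⟨Matrix.vecMulVec v v, ⟨?_, ?_, ?_⟩, hobj _⟩
    · intro s
      have hs := quadSystem_below w _ (List.getElem_mem s.2)
      refine (QuadEq.matrixInner_entry _ (Matrix.vecMulVec v v) (fun i j => x i * x j)
        (fun i j => rfl) hs).trans ?_
      by_cases h : (s : ℕ) = 0
      · simp only [h, h0, quadInstance, if_true, hx₀]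
        norm_num
      · have := (htail _).1 hx s h
        have e : ((quadInstance w).b s : ℝ) = 0 := by simp [quadInstance, h]
        rw [e]
        exact sub_eq_zero.2 this
    · exact Matrix.rank_vecMulVec_le _ _
    · have := Matrix.posSemidef_vecMulVec_self_star v
      rwa [star_trivial] at this
  · rintro ⟨X, ⟨hA, hr, hX⟩, -⟩
    obtain ⟨u, v, huv⟩ := Matrix.exists_eq_mul_of_rank_le_one (hr.trans le_rfl)
    have hsym : ∀ i j, X i j = X j i := fun i j => by
      have := hX.1.apply i j
      rw [star_trivial] at this
      exact this.symm
    let z : Fin (8 * w.length + 3) := ⟨0, by omega⟩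
    let Y : ℕ → ℕ → ℝ := fun i j => if h : i < 8 * w.length + 3 ∧ j < 8 * w.length + 3 then
      X ⟨i, h.1⟩ ⟨j, h.2⟩ else 0
    have hA' : ∀ s : Fin (quadSystem w).length, Y _ _ + Y _ _ - Y _ _ = _ := fun s =>
      (QuadEq.matrixInner_entry ((quadSystem w)[s]) X Y (fun i j => by
        simp only [Y]; rw [dif_pos ⟨i.2, j.2⟩])
        (quadSystem_below w _ (List.getElem_mem s.2))).symm.trans (hA s)
    -- The first equation is the one with right hand side `1`; its second and third terms cancel.
    have hz : X z z = 1 := by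
      have := hA' ⟨0, by simp [quadSystem]⟩
      simp only [Fin.getElem_fin, h0, quadInstance, if_true] at this
      have e : Y 0 0 = X z z := dif_pos (by omega)
      rw [e] at this
      push_cast at this
      linarith
    let x : ℕ → ℝ := fun i => Y i 0
    have hx : ∀ i j, i < 8 * w.length + 3 → j < 8 * w.length + 3 → Y i j = x i * x j := by
      intro i j hi hj
      have e₁ : Y i j = X ⟨i, hi⟩ ⟨j, hj⟩ := dif_pos ⟨hi, hj⟩
      have e₂ : x i = X ⟨i, hi⟩ z := dif_pos ⟨hi, by omega⟩
      have e₃ : x j = X z ⟨j, hj⟩ := (dif_pos ⟨hj, by omega⟩).trans (hsym _ _)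
      rw [e₁, e₂, e₃]
      calc X ⟨i, hi⟩ ⟨j, hj⟩ = X ⟨i, hi⟩ ⟨j, hj⟩ * X z z := by rw [hz, mul_one]
        _ = X ⟨i, hi⟩ z * X z ⟨j, hj⟩ := by
          have a := huv ⟨i, hi⟩ ⟨j, hj⟩
          have b := huv z z
          have c := huv ⟨i, hi⟩ z
          have d := huv z ⟨j, hj⟩
          simp only [a, b, c, d]
          ring
    refine ⟨x, (dif_pos (by omega)).trans hz, (htail _).2 fun s hs => ?_⟩
    obtain ⟨h₁, h₂, h₃, h₄, h₅, h₆⟩ := quadSystem_below w _ (List.getElem_mem s.2)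
    have := hA' s
    simp only [quadInstance, hs, if_false, Fin.getElem_fin] at this
    rw [hx _ _ h₁ h₂, hx _ _ h₃ h₄, hx _ _ h₅ h₆] at this
    simp only [QuadEq.Holds, Fin.getElem_fin]
    push_cast at this
    linarith

/-! #### Computation -/

/-- Replaces vectors over `Fin n` by functions on `ℕ` and a `flatMap` over `List.range`, a form in
which `PolyTime` applies. -/
theorem encodeVec_eq {α : Type} (e : α → List DataLetter) {n : ℕ} (v : Fin n → α) (g : ℕ → α)
    (h : ∀ i : Fin n, v i = g i) : encodeVec e v = (List.range n).flatMap fun i => e (g i) := by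
  have : List.ofFn v = (List.range n).map g := by
    rw [funext h]
    refine List.ext_getElem (by simp) fun i h₁ h₂ => by simp
  rw [encodeVec, this, List.flatMap_map]

theorem encodeVec_getElem {α β : Type} (e : β → List DataLetter) (l : List α) (g : α → β) :
    encodeVec e (fun i : Fin l.length => g l[i]) = l.flatMap fun a => e (g a) := by
  have : List.ofFn (fun i : Fin l.length => g l[i]) = l.map g := List.ofFn_getElem_eq_map l g
  rw [encodeVec, this, List.flatMap_map]

theorem encodeMatrix_eq (n : ℕ) (M : ℕ → ℕ → ℚ) :
    encodeMatrix (fun i j : Fin n => M i j) =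
      (List.range n).flatMap fun i => (List.range n).flatMap fun j => encodeRat (M i j) := by
  refine (encodeVec_eq _ _ (fun i (j : Fin n) => M i j) fun i => rfl).trans ?_
  congr 1
  funext i
  exact encodeVec_eq _ _ (fun j => M i j) fun j => rfl

/-- The word for the instance of the optimization problem for a formula. -/
def quadWord (w : List FormulaLetter) : List DataLetter :=
  encodeUnary (8 * w.length + 3) ++ encodeUnary (quadSystem w).length ++ encodeNat 1 ++
    encodeRat 0 ++ encodeRat 0 ++
    ((List.range (8 * w.length + 3)).flatMap fun _ =>
      (List.range (8 * w.length + 3)).flatMap fun _ => encodeRat 0) ++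
    ((quadSystem w).flatMap fun e => (List.range (8 * w.length + 3)).flatMap fun i =>
      (List.range (8 * w.length + 3)).flatMap fun j => encodeRat (e.entry i j)) ++
    (encodeRat 1 ++ (quadSystem w).tail.flatMap fun _ => encodeRat 0)

theorem quadWord_eq (w : List FormulaLetter) : quadWord w = (quadInstance w).encode := by
  have hC : encodeMatrix (quadInstance w).C = (List.range (8 * w.length + 3)).flatMap fun _ =>
      (List.range (8 * w.length + 3)).flatMap fun _ => encodeRat 0 :=
    encodeMatrix_eq (8 * w.length + 3) fun _ _ => 0
  have hA : encodeVec encodeMatrix (quadInstance w).A = (quadSystem w).flatMap fun e =>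
      (List.range (8 * w.length + 3)).flatMap fun i =>
      (List.range (8 * w.length + 3)).flatMap fun j => encodeRat (e.entry i j) :=
    (encodeVec_getElem _ (quadSystem w)
      (fun e (i j : Fin (8 * w.length + 3)) => e.entry i j)).trans (by
        congr 1; funext e; exact encodeMatrix_eq (8 * w.length + 3) e.entry)
  have hb : encodeVec encodeRat (quadInstance w).b =
      encodeRat 1 ++ (quadSystem w).tail.flatMap fun _ => encodeRat 0 := by
    refine (encodeVec_eq _ (n := (quadSystem w).length) _ (fun s => if s = 0 then 1 else 0)
      (fun i => rfl)).trans ?_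
    rw [show (quadSystem w).length = (quadSystem w).tail.length + 1 by simp [quadSystem],
      List.range_succ_eq_map, List.flatMap_cons, if_pos rfl]
    congr 1
    generalize (quadSystem w).tail = l
    rw [List.flatMap_map]
    simp only [Nat.succ_eq_add_one, Nat.add_eq_zero_iff, one_ne_zero, and_false, if_false]
    induction l with
    | nil => rfl
    | cons a l ih =>
      rw [List.length_cons, List.range_succ_eq_map, List.flatMap_cons, List.flatMap_map, ih]
      rfl
  simp only [LowRankInstance.encode, hC, hA, hb]
  rfl

namespace PolyTime

variable {α β γ : Type} [TreeRepr α] [TreeRepr β] [TreeRepr γ]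

/-- Case distinction on a letter. -/
theorem formulaLetter_cases {h : γ → FormulaLetter} {g : FormulaLetter → γ → β}
    (hh : PolyTime h) (hg : ∀ a, PolyTime (g a)) : PolyTime (fun c => g (h c) c) := by
  have key : ∀ l : List FormulaLetter, ∃ f : γ → β, PolyTime f ∧ ∀ c, h c ∈ l →
      f c = g (h c) c := by
    intro l
    induction l with
    | nil => exact ⟨g .x, hg _, by simp⟩
    | cons a l ih =>
      obtain ⟨f, hf, hf'⟩ := ih
      have he : PolyTime (fun c => decide (h c = a)) :=
        formulaLetter (fun b => decide (b = a)) hh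
      refine ⟨fun c => bif decide (h c = a) then g a c else f c,
        he.cond (hg a) hf, fun c hc => ?_⟩
      by_cases hca : h c = a
      · simp [hca]
      · simp only [hca, decide_false, cond_false]
        exact hf' c ((List.mem_cons.1 hc).resolve_left hca)
  obtain ⟨f, hf, hf'⟩ := key (Finset.univ : Finset FormulaLetter).toList
  have : (fun c => g (h c) c) = f := funext fun c => (hf' c (by simp)).symm
  rwa [this]

theorem quadStep : PolyTime (fun p : FormulaLetter × QuadState => quadStep p.1 p.2) := by
  unfold _root_.quadStep
  have h₁ : PolyTime (fun p : FormulaLetter × QuadState =>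
      p.1.shift (8 * p.2.2.2 + 3) p.2.1) := by
    refine formulaLetter_cases (g := fun a (p : FormulaLetter × QuadState) =>
      a.shift (8 * p.2.2.2 + 3) p.2.1) (by fun_prop) fun a => ?_
    cases a <;> simp only [FormulaLetter.shift] <;> fun_prop
  have h₂ : PolyTime (fun p : FormulaLetter × QuadState =>
      p.1.gadget (p.2.1.headD 0) (p.2.1.tail.headD 0) (8 * p.2.2.2 + 3)) := by
    have : PolyTime (fun p : FormulaLetter × ℕ × ℕ × ℕ =>
        p.1.gadget p.2.1 p.2.2.1 p.2.2.2) := by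
      refine formulaLetter_cases (g := fun a (p : FormulaLetter × ℕ × ℕ × ℕ) =>
        a.gadget p.2.1 p.2.2.1 p.2.2.2) (by fun_prop) fun a => ?_
      cases a <;> simp only [FormulaLetter.gadget] <;> fun_prop
    exact this.comp (show PolyTime (fun p : FormulaLetter × QuadState =>
      (p.1, p.2.1.headD 0, p.2.1.tail.headD 0, 8 * p.2.2.2 + 3)) by fun_prop)
  fun_prop

theorem quadRun : PolyTime quadRun := by
  have h₀ : ∀ w : List FormulaLetter,
      w.foldl (fun s c => _root_.quadStep c s) ([], [], 0) = _root_.quadRun w.reverse := by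
    intro w
    rw [_root_.quadRun, List.foldr_reverse]
  have := list_foldl (l := fun w : List FormulaLetter => w.reverse)
    (step := fun _ s c => _root_.quadStep c s) (init := fun _ => (([], [], 0) : QuadState))
    (by fun_prop)
    (quadStep.comp (show PolyTime (fun p : List FormulaLetter × QuadState × FormulaLetter =>
      (p.2.2, p.2.1)) by fun_prop)) (by fun_prop)
    -- After `N` letters there are at most `N` indices on the stack, at most `6 N` equations, and a
    -- counter. An index below `8 N + 3` has unary size at most `16 N + 5`, an equation consists of
    -- six of them; the constants are rounded up.
    ((.X * (16 * .X + 8 + 1) + 1) + (6 * .X * (96 * .X + 47 + 1) + 1) + (2 * .X + 1) + 2)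
    (fun w w' hw' => by
      rw [h₀]
      have hlen : w'.length ≤ tsize w := by
        have := hw'.length_le
        rw [List.length_reverse] at this
        exact this.trans (length_le_tsize w)
      obtain ⟨b₁, b₂⟩ := quadRun_below w'.reverse
      obtain ⟨l₁, l₂⟩ := length_quadRun_le w'.reverse
      have l₃ := quadRun_length w'.reverse
      rw [List.length_reverse] at b₁ b₂ l₁ l₂ l₃
      have s₁ := tsize_le_of_forall (B := 16 * tsize w + 8) (l := (_root_.quadRun w'.reverse).1)
        fun i hi => by have := b₁ i hi; rw [tsize_nat]; omega
      have s₂ := tsize_le_of_forall (B := 96 * tsize w + 47)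
        (l := (_root_.quadRun w'.reverse).2.1) fun e he => by
          have := b₂ e he
          simp only [QuadEq.Below] at this
          simp only [tsize_prod, tsize_nat]
          omega
      have s₃ := Nat.mul_le_mul_right (16 * tsize w + 8 + 1) (l₁.trans hlen)
      have s₄ := Nat.mul_le_mul_right (96 * tsize w + 47 + 1)
        (l₂.trans (Nat.mul_le_mul_left 6 hlen))
      simp only [tsize_prod, tsize_nat, l₃, Polynomial.eval_add, Polynomial.eval_mul,
        Polynomial.eval_X, Polynomial.eval_ofNat, Polynomial.eval_one]
      omega)
  refine of_toTree_eq this fun w => ?_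
  rw [h₀, List.reverse_reverse]

/-- An entry of a constraint matrix depends on three conditions on indices only. Its numeral is
looked up in a table of eight words, without rational arithmetic. -/
theorem bool₃ (f : Bool → Bool → Bool → β) {p q r : γ → Bool} (hp : PolyTime p) (hq : PolyTime q)
    (hr : PolyTime r) : PolyTime (fun c => f (p c) (q c) (r c)) := by
  have : (fun c => f (p c) (q c) (r c)) = fun c =>
      bif p c then
        bif q c then bif r c then f true true true else f true true false
        else bif r c then f true false true else f true false false
      else
        bif q c then bif r c then f false true true else f false true false
        else bif r c then f false false true else f false false false := by
    funext c
    cases p c <;> cases q c <;> cases r c <;> rfl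
  rw [this]
  fun_prop

theorem quadSystem : PolyTime quadSystem := by
  have := PolyTime.quadRun
  unfold _root_.quadSystem
  fun_prop

theorem quadWord : PolyTime quadWord := by
  have h := PolyTime.quadSystem
  have he : PolyTime (fun p : ((List FormulaLetter × QuadEq) × ℕ) × ℕ =>
      encodeRat (p.1.1.2.entry p.1.2 p.2)) :=
    bool₃ (fun p q r => encodeRat (QuadEq.coeff p q r)) (by fun_prop) (by fun_prop) (by fun_prop)
  unfold _root_.quadWord encodeUnary
  fun_prop

end PolyTime

theorem etr_reducible_lowRankPSD : PolyTimeReducible etr lowRankPSD :=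
  ⟨fun φ : PolyFormula => quadInstance φ.encode,
    PolyTime.computable_form_data PolyTime.quadWord fun _ => quadWord_eq _, exists_holds_iff_yes⟩

/-! ### From the optimization problem to formulas -/

namespace Matrix

/-- A positive semidefinite matrix has a square factor with orthogonal columns. -/
theorem PosSemidef.exists_eq_mul_transpose {n : ℕ} {X : Matrix (Fin n) (Fin n) ℝ}
    (hX : X.PosSemidef) : ∃ (Y : Matrix (Fin n) (Fin n) ℝ) (μ : Fin n → ℝ),
      X = Y * Yᵀ ∧ Yᵀ * Y = diagonal μ := by
  let U : Matrix (Fin n) (Fin n) ℝ := hX.1.eigenvectorUnitary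
  let S : Matrix (Fin n) (Fin n) ℝ := diagonal fun i => √(hX.1.eigenvalues i)
  have hS : S * S = diagonal hX.1.eigenvalues := by
    rw [diagonal_mul_diagonal]
    congr 1
    funext i
    exact Real.mul_self_sqrt (hX.eigenvalues_nonneg i)
  have hSt : Sᵀ = S := diagonal_transpose _
  have hU : Uᵀ * U = 1 := by
    have := Unitary.coe_star_mul_self hX.1.eigenvectorUnitary
    rwa [star_eq_conjTranspose, conjTranspose_eq_transpose_of_trivial] at this
  refine ⟨U * S, hX.1.eigenvalues, ?_, ?_⟩
  · have := hX.1.spectral_theorem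
    rw [Unitary.conjStarAlgAut_apply] at this
    rw [star_eq_conjTranspose, conjTranspose_eq_transpose_of_trivial] at this
    rw [transpose_mul, hSt, Matrix.mul_assoc, ← Matrix.mul_assoc S, hS, ← Matrix.mul_assoc]
    exact this
  · rw [transpose_mul, hSt, Matrix.mul_assoc, ← Matrix.mul_assoc Uᵀ, hU, Matrix.one_mul, hS]

/-- The rank of `Y Yᵀ`, if the columns of `Y` are orthogonal, is counted by `0`-`1`-variables. -/
theorem rank_mul_transpose_eq_sum {n : ℕ} {Y : Matrix (Fin n) (Fin n) ℝ} {μ d : Fin n → ℝ}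
    (h : Yᵀ * Y = diagonal μ) (hd : ∀ i, d i = 0 ∧ μ i = 0 ∨ d i = 1 ∧ μ i ≠ 0) :
    ((Y * Yᵀ).rank : ℝ) = ∑ i, d i := by
  -- `Y Yᵀ`, `Y` and `Yᵀ Y` have the same rank, and the last matrix is diagonal.
  rw [rank_self_mul_transpose, ← rank_transpose_mul_self, h, rank_diagonal, Fintype.card_subtype,
    Finset.card_eq_sum_ones, Finset.sum_filter]
  push_cast
  refine Finset.sum_congr rfl fun i _ => ?_
  rcases hd i with ⟨h₁, h₂⟩ | ⟨h₁, h₂⟩ <;> simp [h₁, h₂]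

end Matrix

/-! #### Sums and conjunctions -/

namespace PolyTerm

/-- The sum of the terms `f 0, …, f (n - 1)`. -/
def sum (n : ℕ) (f : ℕ → PolyTerm) : PolyTerm := (List.range n).foldr (fun i s => (f i).add s) zero

theorem eval_sum (x : ℕ → ℝ) (n : ℕ) (f : ℕ → PolyTerm) :
    (sum n f).eval x = ∑ i ∈ Finset.range n, (f i).eval x := by
  have key : ∀ l : List ℕ, (l.foldr (fun i s => (f i).add s) zero).eval x =
      (l.map fun i => (f i).eval x).sum := by
    intro l
    induction l with
    | nil => rfl
    | cons i l ih => simp [eval, ih]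
  rw [sum, key]
  rfl

/-- In prefix notation a sum nested to the right is a concatenation, so its word is a `flatMap`;
likewise for conjunctions in `encode_all`. -/
theorem encode_sum (n : ℕ) (f : ℕ → PolyTerm) : (sum n f).encode =
    ((List.range n).flatMap fun i => .add :: (f i).encode) ++ [.zero] := by
  rw [sum]
  induction List.range n with
  | nil => rfl
  | cons i l ih => simp [encode, ih]

/-- The number whose binary digits, least significant first, are given by the letters. -/
def ofData : List DataLetter → PolyTerm
  | [] => zero
  | .bit0 :: w => add zero (mul (add one one) (ofData w))
  | .bit1 :: w => add one (mul (add one one) (ofData w))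
  | _ :: w => neg (ofData w)

/-- The letters that a digit contributes to the prefix notation of a number. -/
def digitPrefix : DataLetter → List FormulaLetter
  | .bit0 => [.add, .zero, .mul, .add, .one, .one]
  | .bit1 => [.add, .one, .mul, .add, .one, .one]
  | _ => [.neg]

/-- Horner's scheme nests in the last argument only, so each digit contributes a fixed prefix and
the length is linear in the number of digits. -/
theorem encode_ofData (w : List DataLetter) : (ofData w).encode =
    w.flatMap digitPrefix ++ [.zero] := by
  induction w with
  | nil => rfl
  | cons c w ih => cases c <;> simp [ofData, encode, digitPrefix, ih]

end PolyTerm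

namespace PolyFormula

/-- The conjunction of the formulas `f 0, …, f (n - 1)`. -/
def all (n : ℕ) (f : ℕ → PolyFormula) : PolyFormula :=
  (List.range n).foldr (fun i s => (f i).and s) (eq .zero .zero)

theorem holds_all (x : ℕ → ℝ) (n : ℕ) (f : ℕ → PolyFormula) :
    (all n f).Holds x ↔ ∀ i < n, (f i).Holds x := by
  have key : ∀ l : List ℕ, (l.foldr (fun i s => (f i).and s) (eq .zero .zero)).Holds x ↔
      ∀ i ∈ l, (f i).Holds x := by
    intro l
    induction l with
    | nil => simp [Holds]
    | cons i l ih => simp [Holds, ih]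
  rw [all, key]
  simp

theorem encode_all (n : ℕ) (f : ℕ → PolyFormula) : (all n f).encode =
    ((List.range n).flatMap fun i => .and :: (f i).encode) ++ [.eq, .zero, .zero] := by
  rw [all]
  induction List.range n with
  | nil => rfl
  | cons i l ih => simp [encode, ih]

end PolyFormula

/-! #### Parsing -/

namespace DataLetter

/-- The binary digits of a number. -/
def natToken (m : ℕ) : List DataLetter := m.bits.map fun b => if b then .bit1 else .bit0

/-- The sign and the binary digits of a number. -/
def intToken (z : ℤ) : List DataLetter :=
  if z < 0 then .minus :: natToken z.natAbs else natToken z.natAbs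

theorem eval_ofData_natToken (x : ℕ → ℝ) (m : ℕ) : (PolyTerm.ofData (natToken m)).eval x = m := by
  have key : ∀ l : List Bool,
      (PolyTerm.ofData (l.map fun b => if b then .bit1 else .bit0)).eval x =
        (Nat.ofDigits 2 (l.map fun b => bif b then 1 else 0) : ℕ) := by
    intro l
    induction l with
    | nil => simp [PolyTerm.ofData, PolyTerm.eval]
    | cons b l ih =>
      cases b <;> simp [PolyTerm.ofData, PolyTerm.eval, ih, Nat.ofDigits_cons] <;> norm_num
  rw [natToken, key, ← Nat.digits_two_eq_bits, Nat.ofDigits_digits]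

theorem eval_ofData_intToken (x : ℕ → ℝ) (z : ℤ) : (PolyTerm.ofData (intToken z)).eval x = z := by
  unfold intToken
  split_ifs with h
  · rw [PolyTerm.ofData, PolyTerm.eval, eval_ofData_natToken]
    · have : ((z.natAbs : ℤ) : ℝ) = -z := by rw [Int.ofNat_natAbs_of_nonpos h.le]; push_cast; rfl
      rw [← Int.cast_natCast, this, neg_neg]
    all_goals simp
  · rw [eval_ofData_natToken, ← Int.cast_natCast, Int.natAbs_of_nonneg (not_lt.1 h)]

/-- The words between the separators. -/
def tokens (w : List DataLetter) : List (List DataLetter) :=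
  w.foldr (fun c T => bif decide (c = sep) then [] :: T else (c :: T.headD []) :: T.tail) []

theorem tokens_cons (c : DataLetter) (w : List DataLetter) : tokens (c :: w) =
    bif decide (c = sep) then [] :: tokens w
    else (c :: (tokens w).headD []) :: (tokens w).tail := rfl

theorem tokens_append {u : List DataLetter} (hu : sep ∉ u) (w : List DataLetter) :
    tokens (u ++ sep :: w) = u :: tokens w := by
  induction u with
  | nil => rfl
  | cons c u ih =>
    rw [List.mem_cons, not_or] at hu
    rw [List.cons_append, tokens_cons, ih hu.2]
    simp [Ne.symm hu.1]

theorem sep_notMem_natToken (m : ℕ) : sep ∉ natToken m := by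
  intro h
  obtain ⟨b, -, hb⟩ := List.mem_map.1 h
  cases b <;> simp at hb

theorem sep_notMem_intToken (z : ℤ) : sep ∉ intToken z := by
  unfold intToken
  split_ifs <;> simp [sep_notMem_natToken]

/-- The words for the numerators and denominators of some rational numbers. -/
def ratTokens (R : List ℚ) : List (List DataLetter) :=
  R.flatMap fun q => [intToken q.num, natToken q.den]

theorem tokens_flatMap_encodeRat (R : List ℚ) : tokens (R.flatMap encodeRat) = ratTokens R := by
  induction R with
  | nil => rfl
  | cons q R ih =>
    have h₁ : encodeNat q.den = natToken q.den ++ [sep] := rfl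
    have h₂ : encodeInt q.num = intToken q.num ++ [sep] := by
      unfold encodeInt intToken encodeNat natToken
      split_ifs <;> simp
    rw [List.flatMap_cons, encodeRat, h₁, h₂]
    simp only [List.append_assoc, List.cons_append, List.nil_append]
    rw [tokens_append (sep_notMem_intToken _), tokens_append (sep_notMem_natToken _), ih]
    rfl

/-- Beyond the end of the list the default `[]` is still the token of the numerator of `0`, but not
that of its denominator `1`; hence the bound on `m` in the second part only. -/
theorem getD_ratTokens (R : List ℚ) (m : ℕ) :
    (ratTokens R).getD (2 * m) [] = intToken (R.getD m 0).num ∧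
      (m < R.length → (ratTokens R).getD (2 * m + 1) [] = natToken (R.getD m 0).den) := by
  induction R generalizing m with
  | nil => simp [ratTokens, intToken, natToken]
  | cons q R ih =>
    cases m with
    | zero => simp [ratTokens]
    | succ m =>
      have := ih m
      simp only [ratTokens, List.flatMap_cons, List.cons_append, List.nil_append] at this ⊢
      rw [show 2 * (m + 1) = 2 * m + 1 + 1 by ring]
      simpa using this

end DataLetter

theorem List.getD_flatMap {α β : Type} (l : List α) (g : α → List β) (L : ℕ)
    (hg : ∀ a, (g a).length = L) (d : β) (i : ℕ) (hi : i < l.length) (j : ℕ) (hj : j < L) :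
    (l.flatMap g).getD (i * L + j) d = (g l[i]).getD j d := by
  induction l generalizing i with
  | nil => simp at hi
  | cons a l ih =>
    rw [List.flatMap_cons]
    cases i with
    | zero => rw [List.getD_append _ _ _ _ (by rw [hg]; omega)]; simp
    | succ i =>
      rw [List.getD_append_right _ _ _ _ (by rw [hg]; nlinarith), hg,
        show (i + 1) * L + j - L = i * L + j by rw [Nat.succ_mul]; omega,
        ih i (by simpa using hi)]
      simp

/-! ### Positions of the data in the word for an instance. -/

namespace LowRankInstance

theorem encodeVec_eq_finRange {α : Type} (e : α → List DataLetter) {n : ℕ} (v : Fin n → α) :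
    encodeVec e v = (List.finRange n).flatMap fun i => e (v i) := by
  rw [encodeVec, List.ofFn_eq_map, List.flatMap_map]

/-- The entries of a matrix, row by row. -/
def entries {n : ℕ} (M : Matrix (Fin n) (Fin n) ℚ) : List ℚ :=
  (List.finRange n).flatMap fun i => (List.finRange n).map fun j => M i j

theorem encodeMatrix_eq_entries {n : ℕ} (M : Matrix (Fin n) (Fin n) ℚ) :
    encodeMatrix M = (entries M).flatMap encodeRat := by
  rw [entries, List.flatMap_assoc]
  refine (encodeVec_eq_finRange _ _).trans ?_
  congr 1
  funext i
  rw [List.flatMap_map]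
  exact encodeVec_eq_finRange _ _

theorem length_entries {n : ℕ} (M : Matrix (Fin n) (Fin n) ℚ) : (entries M).length = n * n := by
  simp [entries, List.length_flatMap]

theorem getD_entries {n : ℕ} (M : Matrix (Fin n) (Fin n) ℚ) (i j : Fin n) :
    (entries M).getD (i * n + j) 0 = M i j := by
  rw [entries, List.getD_flatMap _ _ n (by simp) _ _ (by simp) _ j.2]
  simp

variable (p : LowRankInstance)

/-- The entries of the constraint matrices. -/
def constraintEntries : List ℚ := (List.finRange p.l).flatMap fun s => entries (p.A s)

theorem length_constraintEntries : p.constraintEntries.length = p.l * (p.n * p.n) := by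
  simp [constraintEntries, List.length_flatMap, length_entries]

/-- The rational numbers of an instance. -/
def rationals : List ℚ :=
  p.lam :: p.t :: (entries p.C ++ (p.constraintEntries ++ List.ofFn p.b))

theorem tokens_encode : DataLetter.tokens p.encode =
    List.replicate p.n .stroke :: List.replicate p.l .stroke :: DataLetter.natToken p.k ::
      DataLetter.ratTokens p.rationals := by
  have : p.encode = List.replicate p.n .stroke ++ .sep :: (List.replicate p.l .stroke ++
      .sep :: (DataLetter.natToken p.k ++ .sep :: p.rationals.flatMap encodeRat)) := by
    have hA : encodeVec encodeMatrix p.A = p.constraintEntries.flatMap encodeRat := by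
      simp only [encodeVec_eq_finRange, constraintEntries, List.flatMap_assoc,
        encodeMatrix_eq_entries]
    rw [encode, hA, encodeMatrix_eq_entries]
    simp only [encodeUnary, encodeNat, DataLetter.natToken, rationals, List.flatMap_append,
      List.append_assoc, List.flatMap_cons, List.cons_append, List.nil_append, encodeVec]
  rw [this, DataLetter.tokens_append (by simp), DataLetter.tokens_append (by simp),
    DataLetter.tokens_append (DataLetter.sep_notMem_natToken _),
    DataLetter.tokens_flatMap_encodeRat]

theorem length_rationals :
    p.rationals.length = p.n * p.n + (p.l * (p.n * p.n) + p.l) + 2 := by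
  simp [rationals, length_entries, length_constraintEntries]

theorem getD_rationals (m : ℕ) : p.rationals.getD (2 + m) 0 =
    (entries p.C ++ (p.constraintEntries ++ List.ofFn p.b)).getD m 0 := by
  rw [add_comm]; rfl

theorem getD_rationals_C (i j : Fin p.n) :
    p.rationals.getD (2 + (i * p.n + j)) 0 = p.C i j := by
  have : (i * p.n + j : ℕ) < p.n * p.n := by nlinarith [i.2, j.2]
  rw [getD_rationals, List.getD_append _ _ _ _ (by rwa [length_entries])]
  exact getD_entries p.C i j

theorem getD_rationals_A (s : Fin p.l) (i j : Fin p.n) :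
    p.rationals.getD (2 + (p.n * p.n + s * (p.n * p.n) + (i * p.n + j))) 0 = p.A s i j := by
  have h : (i * p.n + j : ℕ) < p.n * p.n := by nlinarith [i.2, j.2]
  have h' : (s * (p.n * p.n) + (i * p.n + j) : ℕ) < p.l * (p.n * p.n) := by nlinarith [s.2]
  rw [getD_rationals, List.getD_append_right _ _ _ _ (by rw [length_entries]; omega),
    length_entries, add_assoc, Nat.add_sub_cancel_left,
    List.getD_append _ _ _ _ (by rwa [length_constraintEntries]), constraintEntries,
    List.getD_flatMap _ _ (p.n * p.n) (fun _ => length_entries _) _ _ (by simp) _ h]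
  simpa using getD_entries (p.A s) i j

theorem getD_rationals_b (s : Fin p.l) :
    p.rationals.getD (2 + (p.n * p.n + (p.l * (p.n * p.n) + s))) 0 = p.b s := by
  rw [getD_rationals, List.getD_append_right _ _ _ _ (by rw [length_entries]; omega),
    length_entries, Nat.add_sub_cancel_left,
    List.getD_append_right _ _ _ _ (by rw [length_constraintEntries]; omega),
    length_constraintEntries, Nat.add_sub_cancel_left]
  simp

end LowRankInstance

namespace LowRankInstance

variable (p : LowRankInstance)

/-- The problem in terms of a factor `Y` of the matrix with orthogonal columns; the variables `d i`
indicate which columns do not vanish. -/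
theorem yes_iff : lowRankPSD.Yes p ↔ ∃ (Y : Matrix (Fin p.n) (Fin p.n) ℝ) (d : Fin p.n → ℝ),
    (∀ i j, i ≠ j → ∑ a, Y a i * Y a j = 0) ∧
    (∀ i, d i = 0 ∧ ∑ a, Y a i * Y a i = 0 ∨ d i = 1 ∧ ∑ a, Y a i * Y a i ≠ 0) ∧
    (∀ s, ∑ i, ∑ j, (p.A s i j : ℝ) * ∑ a, Y i a * Y j a = p.b s) ∧
    ∑ i, ∑ j, (p.C i j : ℝ) * ∑ a, Y i a * Y j a + p.lam * ∑ i, d i ≤ p.t ∧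
    ∑ i, d i ≤ p.k := by
  have hinner (B : Matrix (Fin p.n) (Fin p.n) ℚ) (Y : Matrix (Fin p.n) (Fin p.n) ℝ) :
      matrixInner B (Y * Y.transpose) = ∑ i, ∑ j, (B i j : ℝ) * ∑ a, Y i a * Y j a := by
    simp only [matrixInner, Matrix.mul_apply, Matrix.transpose_apply]
  change (∃ X, p.Feasible X ∧ p.objective X ≤ (p.t : ℝ)) ↔ _
  constructor
  · rintro ⟨X, ⟨hA, hr, hX⟩, ht⟩
    obtain ⟨Y, μ, rfl, hY⟩ := hX.exists_eq_mul_transpose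
    have hμ (i j) : ∑ a, Y a i * Y a j = Matrix.diagonal μ i j := by
      rw [← hY, Matrix.mul_apply]; rfl
    classical
    have hd (i) : (if μ i = 0 then (0 : ℝ) else 1) = 0 ∧ μ i = 0 ∨
        (if μ i = 0 then (0 : ℝ) else 1) = 1 ∧ μ i ≠ 0 := by
      by_cases h : μ i = 0 <;> simp [h]
    have hrank := Matrix.rank_mul_transpose_eq_sum hY hd
    refine ⟨Y, fun i => if μ i = 0 then 0 else 1, fun i j hij => ?_, fun i => ?_, fun s => ?_,
      ?_, ?_⟩
    · rw [hμ, Matrix.diagonal_apply_ne _ hij]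
    · rw [hμ, Matrix.diagonal_apply_eq]; exact hd i
    · rw [← hinner]; exact hA s
    · rw [← hinner, ← hrank]; exact ht
    · rw [← hrank]; exact_mod_cast hr
  · rintro ⟨Y, d, hort, hd, hA, ht, hk⟩
    have hY : Y.transpose * Y = Matrix.diagonal fun i => ∑ a, Y a i * Y a i := by
      ext i j
      by_cases h : i = j
      · subst h; rw [Matrix.diagonal_apply_eq, Matrix.mul_apply]; rfl
      · rw [Matrix.diagonal_apply_ne _ h, Matrix.mul_apply]; exact hort i j h
    have hrank := Matrix.rank_mul_transpose_eq_sum hY hd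
    refine ⟨Y * Y.transpose, ⟨fun s => ?_, ?_, ?_⟩, ?_⟩
    · rw [hinner]; exact hA s
    · rw [← hrank] at hk; exact_mod_cast hk
    · have := Matrix.posSemidef_self_mul_conjTranspose Y
      rwa [Matrix.conjTranspose_eq_transpose_of_trivial] at this
    · rw [objective, hinner, hrank]; exact ht

end LowRankInstance

/-! #### The formula -/

namespace RankFormula

open PolyTerm PolyFormula

/-- The entry `(i, j)` of `Y Yᵀ`. -/
def gram (n i j : ℕ) : PolyTerm :=
  sum n fun a => mul (var (3 * (i * n + a) + 1)) (var (3 * (j * n + a) + 1))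

/-- The inner product of the columns `i` and `j` of `Y`. -/
def column (n i j : ℕ) : PolyTerm :=
  sum n fun a => mul (var (3 * (a * n + i) + 1)) (var (3 * (a * n + j) + 1))

/-- The inner product of `Y Yᵀ` with the matrix whose entries are the rational numbers with the
indices `2 + m, 2 + m + 1, …`. -/
def inner (n m : ℕ) : PolyTerm :=
  sum n fun i => sum n fun j => mul (var (3 * (2 + (m + (i * n + j))))) (gram n i j)

/-- The rank of `Y Yᵀ`. -/
def rank (n : ℕ) : PolyTerm := sum n fun i => var (3 * i + 2)

/-- The variables for the rational numbers have the right values. -/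
def data (T : List (List DataLetter)) : PolyFormula :=
  all T.length fun m => eq (mul (ofData (T.getD (2 * m + 1) [])) (var (3 * m)))
    (ofData (T.getD (2 * m) []))

/-- The columns of `Y` are orthogonal, and the nonzero ones are indicated. -/
def columns (n : ℕ) : PolyFormula :=
  all n fun i => all n fun j => bif decide (i = j) then
      or (and (eq (var (3 * i + 2)) zero) (eq (column n i i) zero))
        (and (eq (var (3 * i + 2)) one) (not (eq (column n i i) zero)))
    else eq (column n i j) zero

/-- The linear constraints. -/
def constraints (n l : ℕ) : PolyFormula :=
  all l fun s => eq (inner n (n * n + s * (n * n)))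
    (var (3 * (2 + (n * n + (l * (n * n) + s)))))

/-- The bounds for the objective function and the rank. -/
def bounds (n : ℕ) (k : List DataLetter) : PolyFormula :=
  and (le (add (inner n 0) (mul (var (3 * 0)) (rank n))) (var (3 * 1))) (le (rank n) (ofData k))

end RankFormula

open RankFormula in
/-- The formula for an instance of the optimization problem, given by its tokens. -/
def rankFormula (T : List (List DataLetter)) : PolyFormula :=
  .and (data T.tail.tail.tail) (.and (columns (T.headD []).length)
    (.and (constraints (T.headD []).length (T.tail.headD []).length)
      (bounds (T.headD []).length (T.tail.tail.headD []))))

namespace RankFormula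

variable (p : LowRankInstance) (x : ℕ → ℝ)

/-- The variables of the formula are sorted by the residue of their index modulo `3`: `3 m` stands
for the rational number with index `m`, `3 (i n + a) + 1` for the entry `(i, a)` of `Y`, and `3 i +
2` for the indicator `d i`. -/
theorem holds_data : (data (DataLetter.ratTokens p.rationals)).Holds x ↔
    ∀ m < p.rationals.length, x (3 * m) = (p.rationals.getD m 0 : ℚ) := by
  have hlen : (DataLetter.ratTokens p.rationals).length = p.rationals.length * 2 := by
    simp [DataLetter.ratTokens, List.length_flatMap]
  rw [data, PolyFormula.holds_all, hlen]
  simp only [PolyFormula.Holds, PolyTerm.eval]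
  have key : ∀ m < p.rationals.length,
      (PolyTerm.eval x (.ofData ((DataLetter.ratTokens p.rationals).getD (2 * m + 1) [])) *
        x (3 * m) = PolyTerm.eval x (.ofData ((DataLetter.ratTokens p.rationals).getD (2 * m) []))
        ↔ x (3 * m) = (p.rationals.getD m 0 : ℚ)) := by
    intro m hm
    obtain ⟨h₁, h₂⟩ := DataLetter.getD_ratTokens p.rationals m
    rw [h₁, h₂ hm, DataLetter.eval_ofData_natToken, DataLetter.eval_ofData_intToken]
    generalize p.rationals.getD m 0 = q
    have hq : (q.den : ℝ) ≠ 0 := by exact_mod_cast q.den_ne_zero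
    rw [Rat.cast_def, eq_div_iff hq, mul_comm]
  constructor
  · exact fun h m hm => (key m hm).1 (h m (by omega))
  · intro h m hm
    -- `data` ranges over the number of tokens, twice the number of rationals, so that nothing has
    -- to be halved. The surplus equations read `0 * x = 0`.
    by_cases hm' : m < p.rationals.length
    · exact (key m hm').2 (h m hm')
    · rw [List.getD_eq_default _ _ (by omega), List.getD_eq_default _ _ (by omega)]
      simp [PolyTerm.ofData, PolyTerm.eval]

variable {p x} {Y : Matrix (Fin p.n) (Fin p.n) ℝ} {d : Fin p.n → ℝ}

theorem eval_gram (hY : ∀ i a : Fin p.n, x (3 * (i * p.n + a) + 1) = Y i a) (i j : Fin p.n) :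
    (gram p.n i j).eval x = ∑ a, Y i a * Y j a := by
  simp only [gram, PolyTerm.eval_sum, Finset.sum_range, PolyTerm.eval, hY]

theorem eval_column (hY : ∀ i a : Fin p.n, x (3 * (i * p.n + a) + 1) = Y i a) (i j : Fin p.n) :
    (column p.n i j).eval x = ∑ a, Y a i * Y a j := by
  simp only [column, PolyTerm.eval_sum, Finset.sum_range, PolyTerm.eval, hY]

theorem eval_inner (hY : ∀ i a : Fin p.n, x (3 * (i * p.n + a) + 1) = Y i a) {m : ℕ}
    {B : Matrix (Fin p.n) (Fin p.n) ℚ}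
    (hB : ∀ i j : Fin p.n, x (3 * (2 + (m + (i * p.n + j)))) = B i j) :
    (inner p.n m).eval x = ∑ i, ∑ j, (B i j : ℝ) * ∑ a, Y i a * Y j a := by
  simp only [inner, PolyTerm.eval_sum, Finset.sum_range, PolyTerm.eval, eval_gram hY, hB]

theorem eval_rank (hd : ∀ i : Fin p.n, x (3 * i + 2) = d i) : (rank p.n).eval x = ∑ i, d i := by
  simp only [rank, PolyTerm.eval_sum, Finset.sum_range, PolyTerm.eval, hd]

theorem holds_columns (hY : ∀ i a : Fin p.n, x (3 * (i * p.n + a) + 1) = Y i a)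
    (hd : ∀ i : Fin p.n, x (3 * i + 2) = d i) : (columns p.n).Holds x ↔
    (∀ i j, i ≠ j → ∑ a, Y a i * Y a j = 0) ∧
    (∀ i, d i = 0 ∧ ∑ a, Y a i * Y a i = 0 ∨ d i = 1 ∧ ∑ a, Y a i * Y a i ≠ 0) := by
  have hne (i j : Fin p.n) (h : i ≠ j) : decide ((i : ℕ) = j) = false := by
    simpa [Fin.ext_iff] using h
  simp only [columns, PolyFormula.holds_all]
  constructor
  · intro h
    refine ⟨fun i j hij => ?_, fun i => ?_⟩
    · have := h i i.2 j j.2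
      rw [hne i j hij, cond_false] at this
      simpa only [PolyFormula.Holds, eval_column hY, PolyTerm.eval] using this
    · have := h i i.2 i i.2
      rw [decide_eq_true rfl, cond_true] at this
      simpa only [PolyFormula.Holds, eval_column hY, PolyTerm.eval, hd] using this
  · rintro ⟨h₁, h₂⟩ i hi j hj
    by_cases hij : i = j
    · subst hij
      have := h₂ ⟨i, hi⟩
      rw [← eval_column hY, ← hd] at this
      rw [decide_eq_true rfl, cond_true]
      exact this
    · have := h₁ ⟨i, hi⟩ ⟨j, hj⟩ (by simpa using hij)
      rw [← eval_column hY] at this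
      rw [decide_eq_false hij, cond_false]
      exact this

theorem holds_rankFormula (hx : ∀ m < p.rationals.length, x (3 * m) = (p.rationals.getD m 0 : ℚ))
    (hY : ∀ i a : Fin p.n, x (3 * (i * p.n + a) + 1) = Y i a)
    (hd : ∀ i : Fin p.n, x (3 * i + 2) = d i) :
    (rankFormula (DataLetter.tokens p.encode)).Holds x ↔
    (∀ i j, i ≠ j → ∑ a, Y a i * Y a j = 0) ∧
    (∀ i, d i = 0 ∧ ∑ a, Y a i * Y a i = 0 ∨ d i = 1 ∧ ∑ a, Y a i * Y a i ≠ 0) ∧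
    (∀ s, ∑ i, ∑ j, (p.A s i j : ℝ) * ∑ a, Y i a * Y j a = p.b s) ∧
    ∑ i, ∑ j, (p.C i j : ℝ) * ∑ a, Y i a * Y j a + p.lam * ∑ i, d i ≤ p.t ∧
    ∑ i, d i ≤ p.k := by
  have hl := p.length_rationals
  have hb (s : Fin p.l) : x (3 * (2 + (p.n * p.n + (p.l * (p.n * p.n) + s)))) = p.b s := by
    rw [hx _ (by omega), p.getD_rationals_b]
  have hin (i j : Fin p.n) : (i * p.n + j : ℕ) < p.n * p.n := by nlinarith [i.2, j.2]
  have hC : (inner p.n 0).eval x = _ := eval_inner hY (B := p.C) fun i j => by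
    have := hin i j
    rw [zero_add, hx _ (by omega), p.getD_rationals_C]
  have hA (s : Fin p.l) : (inner p.n (p.n * p.n + s * (p.n * p.n))).eval x = _ :=
    eval_inner hY (B := p.A s) fun i j => by
      have := hin i j
      have : (s * (p.n * p.n) + (i * p.n + j) : ℕ) < p.l * (p.n * p.n) := by nlinarith [s.2]
      rw [hx _ (by omega), p.getD_rationals_A]
  have hlam : x (3 * 0) = p.lam := hx 0 (by omega)
  have ht : x (3 * 1) = p.t := hx 1 (by omega)
  rw [p.tokens_encode, rankFormula]
  simp only [List.headD_cons, List.tail_cons, List.length_replicate, PolyFormula.Holds,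
    holds_data, holds_columns hY hd, bounds, constraints, PolyFormula.holds_all, hC,
    eval_rank hd, PolyTerm.eval, DataLetter.eval_ofData_natToken, hlam, ht]
  have hs : (∀ s < p.l, (inner p.n (p.n * p.n + s * (p.n * p.n))).eval x =
      x (3 * (2 + (p.n * p.n + (p.l * (p.n * p.n) + s))))) ↔
      ∀ s, ∑ i, ∑ j, (p.A s i j : ℝ) * ∑ a, Y i a * Y j a = p.b s :=
    ⟨fun h s => by rw [← hA, h s s.2, hb], fun h s hs => by
      rw [hA ⟨s, hs⟩, h, ← hb]⟩
  rw [hs]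
  tauto

end RankFormula

theorem lowRankPSD_yes_iff (p : LowRankInstance) : lowRankPSD.Yes p ↔
    ∃ x, (rankFormula (DataLetter.tokens p.encode)).Holds x := by
  rw [p.yes_iff]
  constructor
  · rintro ⟨Y, d, h⟩
    -- The three families of values are interleaved modulo `3`; a position `(i, a)` in `Y` is
    -- recovered from `i n + a` by division with remainder.
    let x : ℕ → ℝ := fun N =>
      if N % 3 = 0 then (p.rationals.getD (N / 3) 0 : ℚ)
      else if N % 3 = 1 then
        if h : N / 3 / p.n < p.n ∧ N / 3 % p.n < p.n then Y ⟨N / 3 / p.n, h.1⟩ ⟨N / 3 % p.n, h.2⟩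
        else 0
      else if h : N / 3 < p.n then d ⟨N / 3, h⟩ else 0
    refine ⟨x, (RankFormula.holds_rankFormula (Y := Y) (d := d) ?_ ?_ ?_).2 h⟩
    · intro m _
      have h₁ : 3 * m % 3 = 0 := by omega
      have h₂ : 3 * m / 3 = m := by omega
      simp only [x, h₁, h₂, if_true]
    · intro i a
      have h₁ : (3 * (i * p.n + a) + 1) % 3 = 1 := by omega
      have h₂ : (3 * (i * p.n + a) + 1) / 3 = i * p.n + a := by omega
      have hn : 0 < p.n := i.pos
      have h₃ : (i * p.n + a) / p.n = i := by
        rw [add_comm, Nat.add_mul_div_right _ _ hn, Nat.div_eq_of_lt a.2, zero_add]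
      have h₄ : (i * p.n + a) % p.n = a := by
        rw [add_comm, Nat.add_mul_mod_self_right, Nat.mod_eq_of_lt a.2]
      simp only [x, h₁, h₂, h₃, h₄, one_ne_zero, if_false, if_true, i.2, a.2, and_self, dif_pos]
    · intro i
      have h₁ : (3 * i + 2 : ℕ) % 3 = 2 := by omega
      have h₂ : (3 * i + 2 : ℕ) / 3 = i := by omega
      simp [x, h₁, h₂]
  · rintro ⟨x, hx⟩
    refine ⟨fun i a => x (3 * (i * p.n + a) + 1), fun i => x (3 * i + 2),
      (RankFormula.holds_rankFormula ?_ (fun i a => rfl) (fun i => rfl)).1 hx⟩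
    -- The first conjunct alone already fixes the variables for the rational data, which the
    -- equivalence for the whole formula presupposes.
    rw [p.tokens_encode] at hx
    exact (RankFormula.holds_data p x).1 hx.1

/-! #### Computation -/

namespace PolyTime

variable {γ : Type} [TreeRepr γ]

theorem tokens : PolyTime DataLetter.tokens := by
  have h₀ : ∀ w : List DataLetter,
      w.foldl (fun T c => bif decide (c = .sep) then [] :: T else (c :: T.headD []) :: T.tail) [] =
        DataLetter.tokens w.reverse := by
    intro w
    rw [DataLetter.tokens, List.foldr_reverse]
  have hsize : ∀ w : List DataLetter, tsize (DataLetter.tokens w) ≤ 2 * tsize w := by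
    intro w
    induction w with
    | nil => simp [DataLetter.tokens]
    | cons c w ih =>
      have hc := tsize_pos c
      rw [DataLetter.tokens_cons, tsize_cons]
      cases decide (c = .sep)
      · cases hT : DataLetter.tokens w with
        | nil => simp; have := tsize_pos w; omega
        | cons t T => rw [hT] at ih; simp at ih ⊢; omega
      · simp; omega
  have hsep : PolyTime (fun c : DataLetter => decide (c = .sep)) :=
    dataLetter (fun c => decide (c = .sep)) id
  have := list_foldl (l := fun w : List DataLetter => w.reverse)
    (step := fun _ (T : List (List DataLetter)) (c : DataLetter) =>
      bif decide (c = .sep) then [] :: T else (c :: T.headD []) :: T.tail) (init := fun _ => [])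
    (by fun_prop) (by
      have : PolyTime (fun p : List DataLetter × List (List DataLetter) × DataLetter =>
        decide (p.2.2 = .sep)) := hsep.comp (by fun_prop)
      fun_prop) (by fun_prop) (2 * .X) (fun w w' hw' => by
      rw [h₀]
      have h₁ := hsize w'.reverse
      have h₂ := tsize_le_of_prefix hw'
      rw [tsize_reverse] at h₁ h₂
      simp only [Polynomial.eval_mul, Polynomial.eval_X, Polynomial.eval_ofNat]
      omega)
  refine of_toTree_eq this fun w => ?_
  rw [h₀, List.reverse_reverse]

theorem encode_ofData {w : γ → List DataLetter} (hw : PolyTime w) :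
    PolyTime (fun c => (PolyTerm.ofData (w c)).encode) := by
  simp only [PolyTerm.encode_ofData]
  have : PolyTime (fun p : γ × DataLetter => PolyTerm.digitPrefix p.2) :=
    dataLetter PolyTerm.digitPrefix (by fun_prop)
  fun_prop

/-- Once all encodings are unfolded, the word consists of concatenations, `flatMap`s over ranges,
case distinctions and unary arithmetic on indices, within reach of `fun_prop`. -/
theorem encode_rankFormula : PolyTime (fun T => (rankFormula T).encode) := by
  simp only [rankFormula, RankFormula.data, RankFormula.columns, RankFormula.constraints,
    RankFormula.bounds, RankFormula.inner, RankFormula.rank, RankFormula.column, RankFormula.gram,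
    PolyFormula.encode, PolyTerm.encode, PolyFormula.encode_all, PolyTerm.encode_sum,
    Bool.apply_cond PolyFormula.encode]
  have := @encode_ofData
  fun_prop

end PolyTime

theorem lowRankPSD_reducible_etr : PolyTimeReducible lowRankPSD etr :=
  ⟨fun p : LowRankInstance => rankFormula (DataLetter.tokens p.encode),
    PolyTime.computable_data_form (PolyTime.encode_rankFormula.comp PolyTime.tokens) fun _ => rfl,
    lowRankPSD_yes_iff⟩

theorem theorem2 : ExistsRComplete lowRankPSD := by
  refine ⟨lowRankPSD_reducible_etr, fun Q hQ => ?_⟩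
  obtain ⟨f, ⟨hf⟩, hf'⟩ := hQ
  obtain ⟨g, ⟨hg⟩, hg'⟩ := etr_reducible_lowRankPSD
  exact ⟨g ∘ f, hf.comp hg, fun x => (hf' x).trans (hg' (f x))⟩
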